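/- **Tiles and mosaics.** Let $T_0,\dots,T_{10}$ be the standard knot mosaic tiles: $T_0$ is blank; $T_1,T_2,T_3,T_4$ carry one arc joining the sides W–S, S–E, E–N, N–W; $T_5,T_6$ carry one straight arc W–E, N–S; $T_7$ carries the two arcs W–S and N–E, $T_8$ the two arcs N–W and S–E; $T_9$ and $T_{10}$ carry a crossing of a W–E strand and an N–S strand (the W–E strand is over in $T_9$ and under in $T_{10}$). The black tile $T_\infty$ has connection points on W and E, or on N and S, or on all four sides; this choice is its connection data. An $RV(2,4)$ tangle $n$-mosaic is an $n\times n$ matrix of such tiles in which neighbouring tiles match along their common side, no two black tiles are adjacent, and no black tile lies along the boundary; it is a knot mosaic if moreover it has no connection points on the boundary of the square. The dihedral group $D_4$ acts on mosaics by quarter turns and by the flip along the NW–SE diagonal (the half turn of space about that diagonal). **Moves.** Two $n$-mosaics are *related by moves* if they are related by a finite sequence of the following moves and their inverses, each of which replaces a block of tiles and leaves all other tiles, the connection points on the boundary of the block, and all black tiles with their connection data unchanged: the planar isotopies of $2\times2$ blocks (a strand is pushed across the common corner of the four tiles, or a crossing of two parallel strands is moved from one tile to another), the Reidemeister moves I and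 II in $2\times 2$ blocks, and the moves III, IV, VI in $3\times3$ blocks. In the latter, a strand running through the border tiles of the block from a corner tile to a corner tile (possibly the same one) is pushed across the central tile to the complementary side of the border. The central tile is a crossing (III; the three strands are not cyclically over each other), a black tile of degree $4$ (IV), or a black tile of degree $2$ (VI); in IV and VI the strand passes over all, or under all, of the strands at the black tile that it meets. Rotations, diagonal flips, and mirror images of moves are moves. **Tree knot mosaics.** A tree mosaic $M=(T,F,i)$ consists of a (finite or infinite) rooted tree $T$, an $RV(2,4)$ mosaic $F(v)$ for each vertex $v$, and for each edge $(u,w)$, with $u$ the parent of $w$, an oriented embedding $i(u,w)$, that is, a position $(a,b)$ in $F(u)$ and an orientation $g\in D_4$ in which $F(w)$ is to be inserted there. It is a *tree knot mosaic* if (well-defined) for every $v$ the embeddings of the edges from $v$ to its children target the black tiles of $F(v)$, each exactly once; and (suitably connected) the root carries a knot mosaic, every other vertex carries a tangle mosaic of odd dimension $\ge 3$, and for every edge $(u,w)$ with $i(u,w)=((a,b),g)$ the mosaic $g\cdot F(w)$ has exactly one boundary connection point on each side on which the black tile $F(u)_{ab}$ has a connection point, and none on the other sides. **Realization.** Use coordinates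 of $\mathbb R^3$ in which the first one increases from north to south, the second one from west to east, and the third one is height. Each tile $T_0,\dots,T_{10}$ is realized by its arcs in $[0,1]^3$, as polygonal arcs whose ends are the centres of the side faces and whose interiors lie in the open cube, with the over-strand of a crossing above the under-strand. For an $n$-mosaic $L$, let $|L|_{\mathrm{tame}}\subset[0,n]^2\times[0,1]$ be the union of the realizations of its tiles $T_0,\dots,T_{10}$, the tile $L_{ab}$ being placed in $[a-1,a]\times[b-1,b]\times[0,1]$ (black tiles contribute nothing). To each vertex $v$ assign a scale $\sigma(v)$, a position $\rho(v)$ and an orientation $g_v\in D_4$: for the root $\sigma=1$, $\rho=0$, $g=e$; for an edge $(u,w)$ with $i(u,w)=((a,b),g)$, $$\sigma(w)=\frac{\sigma(u)}{\dim F(w)},\qquad \rho(w)=\rho(u)+\sigma(u)\,(a'-1,b'-1,0),\qquad g_w=g_u g,$$ where $(a',b')$ is the position to which $g_u$ moves the tile $(a,b)$ of $F(u)$. Then $$|M|=\overline{\bigcup_{v}\bigl(\sigma(v)\,|g_v\cdot F(v)|_{\mathrm{tame}}+\rho(v)\bigr)\;\cup\;\bigcup_{(u,w)}\mathcal C(u,w)}\subset\mathbb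 R^3,$$ where $\mathcal C(u,w)$ is the union of the straight segments joining each connection point of the targeted black tile of the placed copy of $F(u)$ to the boundary connection point of the placed copy of $F(w)$ on the same side. **Mosaic-level equivalence.** Tree knot mosaics $M_1=(T,F_1,i)$ and $M_2=(T,F_2,i)$ on the same tree with the same embeddings are *mosaic-level equivalent* if for every vertex $v$ the mosaics $F_1(v)$ and $F_2(v)$ have the same dimension, have black tiles in the same positions with the same connection data, and are related by moves. **Lemma.** If $M_1$ and $M_2$ are mosaic-level equivalent tree knot mosaics, then their geometric realizations are ambient homeomorphic: there is a homeomorphism $h\colon\mathbb R^3\to\mathbb R^3$ with $h(|M_1|)=|M_2|$. -/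

import Mathlib

namespace KnotMosaic

/-! ### Tiles and mosaics -/

/-- The four sides of a tile. -/
inductive Side
  | north | east | south | west
  deriving DecidableEq

/-- Connection data of a black tile `T_∞`: two connection points on the west and east sides, two
connection points on the north and south sides, or four connection points. -/
inductive VertexKind
  | horizontal | vertical | four
  deriving DecidableEq

/-- The tiles `T_0, …, T_10`, together with the black tile `T_∞` and its connection data. -/
inductive Tile
  | t0 | t1 | t2 | t3 | t4 | t5 | t6 | t7 | t8 | t9 | t10
  | vertex (k : VertexKind)
  deriving DecidableEq

open Side VertexKind Tile

/-- The sides of a black tile that carry a connection point. -/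
def VertexKind.sides : VertexKind → Finset Side
  | horizontal => {west, east}
  | vertical => {north, south}
  | four => {north, east, south, west}

/-- The sides of a tile that carry a connection point. -/
def Tile.sides : Tile → Finset Side
  | t0 => ∅
  | t1 => {west, south}
  | t2 => {south, east}
  | t3 => {east, north}
  | t4 => {north, west}
  | t5 => {west, east}
  | t6 => {north, south}
  | t7 | t8 | t9 | t10 => {north, east, south, west}
  | vertex k => k.sides

/-- `RV(2,4)` mosaics of dimension `n`: `n × n` matrices of tiles. Rows are numbered from north to
south, columns from west to east. -/
abbrev Mosaic (n : ℕ) := Matrix (Fin n) (Fin n) Tile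

/-- An `RV(2,4)` mosaic of some dimension. -/
abbrev RVMosaic := Σ n : ℕ, Mosaic n

/-- The side `s` of the tile in position `(i, j)` lies on the boundary of the `n × n` square. -/
def OnBoundary {n : ℕ} (i j : Fin n) : Side → Prop
  | north => i.val = 0
  | south => i.val + 1 = n
  | west => j.val = 0
  | east => j.val + 1 = n

/-- `(i, j, s)` is a connection point on the boundary of the mosaic: it is the connection point on
the side `s` of the tile in position `(i, j)`. -/
def Mosaic.BoundaryPoint {n : ℕ} (M : Mosaic n) (i j : Fin n) (s : Side) : Prop :=
  OnBoundary i j s ∧ s ∈ (M i j).sides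

/-- There is a black tile with connection data `k` in position `(a, b)` (counted from `0`). -/
def Mosaic.VertexAt {n : ℕ} (M : Mosaic n) (a b : ℕ) (k : VertexKind) : Prop :=
  ∃ (ha : a < n) (hb : b < n), M ⟨a, ha⟩ ⟨b, hb⟩ = vertex k

/-- `RV(2,4)` tangle mosaics: all tiles are suitably connected to their neighbours, no two black
tiles are adjacent, and there is no black tile along the boundary. -/
structure Mosaic.IsTangle {n : ℕ} (M : Mosaic n) : Prop where
  connected_row : ∀ i j j' : Fin n, j.val + 1 = j'.val →
    (east ∈ (M i j).sides ↔ west ∈ (M i j').sides)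
  connected_col : ∀ i i' j : Fin n, i.val + 1 = i'.val →
    (south ∈ (M i j).sides ↔ north ∈ (M i' j).sides)
  not_adjacent_row : ∀ (i j j' : Fin n) (k k' : VertexKind), j.val + 1 = j'.val →
    ¬(M i j = vertex k ∧ M i j' = vertex k')
  not_adjacent_col : ∀ (i i' j : Fin n) (k k' : VertexKind), i.val + 1 = i'.val →
    ¬(M i j = vertex k ∧ M i' j = vertex k')
  not_boundary : ∀ (i j : Fin n) (s : Side) (k : VertexKind), OnBoundary i j s → M i j ≠ vertex k

/-- `RV(2,4)` knot mosaics: no connection points on the boundary either. -/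
structure Mosaic.IsKnot {n : ℕ} (M : Mosaic n) : Prop extends M.IsTangle where
  no_boundaryPoint : ∀ (i j : Fin n) (s : Side), ¬M.BoundaryPoint i j s

/-! ### The action of the dihedral group -/

/-- The quarter turn of a tile. -/
def Tile.rotate : Tile → Tile
  | t0 => t0
  | t1 => t4
  | t2 => t1
  | t3 => t2
  | t4 => t3
  | t5 => t6
  | t6 => t5
  | t7 => t8
  | t8 => t7
  | t9 => t10
  | t10 => t9
  | vertex horizontal => vertex vertical
  | vertex vertical => vertex horizontal
  | vertex four => vertex four

/-- The flip of a tile along its NW–SE diagonal. As a motion of the cube this is the half turn about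
that diagonal, so crossing tiles are unchanged. -/
def Tile.flip : Tile → Tile
  | t0 => t0
  | t1 => t3
  | t2 => t2
  | t3 => t1
  | t4 => t4
  | t5 => t6
  | t6 => t5
  | t7 => t7
  | t8 => t8
  | t9 => t9
  | t10 => t10
  | vertex horizontal => vertex vertical
  | vertex vertical => vertex horizontal
  | vertex four => vertex four

/-- The mirror image of a tile in the plane of projection: crossings are switched. -/
def Tile.mirror : Tile → Tile
  | t9 => t10
  | t10 => t9
  | t => t

def Mosaic.rotate {n : ℕ} (M : Mosaic n) : Mosaic n :=
  Matrix.of fun i j => (M j.rev i).rotate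

def Mosaic.flip {n : ℕ} (M : Mosaic n) : Mosaic n :=
  Matrix.of fun i j => (M j i).flip

def Mosaic.mirror {n : ℕ} (M : Mosaic n) : Mosaic n :=
  Matrix.of fun i j => (M i j).mirror

/-- The left action of `D_4` on mosaics. The generator `r 1` acts by the quarter turn and `sr 0` by
the diagonal flip; recall `sr i = sr 0 * r i`. -/
def Mosaic.act {n : ℕ} (g : DihedralGroup 4) (M : Mosaic n) : Mosaic n :=
  match g with
  | .r i => Mosaic.rotate^[i.val] M
  | .sr i => (Mosaic.rotate^[i.val] M).flip

/-- The position to which the tile in position `p` of an `n`-mosaic is moved by the quarter turn. -/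
def rotatePos (n : ℕ) (p : ℕ × ℕ) : ℕ × ℕ := (p.2, n - 1 - p.1)

/-- The position to which the tile in position `p` of an `n`-mosaic is moved by `g`. -/
def actPos (n : ℕ) (g : DihedralGroup 4) (p : ℕ × ℕ) : ℕ × ℕ :=
  match g with
  | .r i => (rotatePos n)^[i.val] p
  | .sr i => ((rotatePos n)^[i.val] p).swap

/-! ### Mosaic moves

All moves replace a `2 × 2` or `3 × 3` block of a mosaic by another one. In the planar isotopies and
in the moves III, IV, VI a strand is pushed from one side of the centre of the block to the other:
across the common corner of the four tiles of a `2 × 2` block (planar isotopy), or across the central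
tile of a `3 × 3` block, which is a crossing (move III), a black tile of degree four (move IV) or a
black tile of degree two (move VI). In each corner tile that the moving strand may enter, the other
pair of sides may be joined by a further arc, which stays where it is. -/

/-- Corner tiles of a block without and with the moving strand, which passes through the two inner
sides of the tile; the two outer sides may be joined by another arc. -/
def passNE : Set (Tile × Tile) := {(t0, t1), (t3, t7)}

/-- The same in the SW corner. -/
def passSW : Set (Tile × Tile) := {(t0, t3), (t1, t7)}

/-- The same in the SE corner. -/
def passSE : Set (Tile × Tile) := {(t0, t4), (t2, t8)}

/-- Corner tiles of a block in which the moving strand leaves the block through an outer side. In the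
first tile it comes from the horizontal neighbour in the block, in the second tile from the vertical
neighbour. -/
def endNW : Set (Tile × Tile) := {(t5, t1), (t3, t6)}

/-- The same in the NE corner. -/
def endNE : Set (Tile × Tile) := {(t5, t2), (t4, t6)}

/-- The same in the SE corner, with the roles of the neighbours exchanged: in the first tile the
strand comes from the vertical neighbour. -/
def endSE : Set (Tile × Tile) := {(t3, t5), (t6, t1)}

/-- The crossing tiles. -/
def crossings : Set Tile := {t9, t10}

/-- `Passes x h v`: the moving strand may be pushed across the central tile `x`. Here `h` are the
tiles between `x` and the west or east side of the block, without and with the moving strand, and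
`v` those between `x` and the north or south side. In `t9` the horizontal strand lies over the
vertical one, in `t10` under it. -/
inductive Passes : Tile → Tile × Tile → Tile × Tile → Prop
  /-- Move III. The three strands involved are not cyclically over each other. -/
  | crossing {x y z : Tile} (hx : x ∈ crossings) (hy : y ∈ crossings) (hz : z ∈ crossings)
      (h : y = z → x = y) : Passes x (t5, y) (t6, z)
  /-- Move IV, the strand passes over the vertex. -/
  | vertexOver : Passes (vertex four) (t5, t10) (t6, t9)
  /-- Move IV, the strand passes under the vertex. -/
  | vertexUnder : Passes (vertex four) (t5, t9) (t6, t10)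
  /-- Move VI, for a vertex of degree two on a horizontal strand. -/
  | horizontal {y : Tile} (hy : y ∈ crossings) : Passes (vertex horizontal) (t5, y) (t0, t5)
  /-- Move VI, for a vertex of degree two on a vertical strand. -/
  | vertical {z : Tile} (hz : z ∈ crossings) : Passes (vertex vertical) (t0, t6) (t6, z)

/-- `BlockMove A B`: the block `B` arises from the block `A` by a mosaic planar isotopy, by one of
the mosaic Reidemeister moves I, II, III, or by one of the mosaic moves IV, VI for rigid vertices. -/
inductive BlockMove : {k : ℕ} → Mosaic k → Mosaic k → Prop
  /-- Planar isotopy: a strand in the NW corner is pushed around the centre. -/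
  | planar_one {b c d : Tile × Tile} (hb : b ∈ passNE) (hc : c ∈ passSW) (hd : d ∈ passSE) :
      BlockMove !![t4, b.1; c.1, d.1] !![t7, b.2; c.2, d.2]
  /-- Planar isotopy: a strand through the two northern tiles is pushed around the centre. -/
  | planar_two {a b c d : Tile × Tile} (ha : a ∈ endNW) (hb : b ∈ endNE) (hc : c ∈ passSW)
      (hd : d ∈ passSE) : BlockMove !![a.1, b.1; c.1, d.1] !![a.2, b.2; c.2, d.2]
  /-- Planar isotopy: a strand from the NW tile to the SE tile is pushed across the centre. -/
  | planar_three {a b c d : Tile × Tile} (ha : a ∈ endNW) (hb : b ∈ passNE) (hc : c ∈ passSW)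
      (hd : d ∈ endSE) : BlockMove !![a.1, b.2; c.1, d.1] !![a.2, b.1; c.2, d.2]
  /-- Planar isotopy: a crossing of two parallel strands is moved to a neighbouring tile. -/
  | slide_adjacent {x : Tile} {c d : Tile × Tile} (hx : x ∈ crossings) (hc : c ∈ passSW)
      (hd : d ∈ passSE) : BlockMove !![x, t8; c.2, d.2] !![t7, x.mirror; c.2, d.2]
  /-- Planar isotopy: a crossing of two parallel strands is moved to the opposite tile. -/
  | slide_opposite {x : Tile} {b c : Tile × Tile} (hx : x ∈ crossings) (hb : b ∈ passNE)
      (hc : c ∈ passSW) : BlockMove !![x, b.2; c.2, t7] !![t7, b.2; c.2, x]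
  /-- Move I. -/
  | reidemeister_one {x : Tile} {b c d : Tile × Tile} (hx : x ∈ crossings) (hb : b ∈ passNE)
      (hc : c ∈ passSW) (hd : d ∈ passSE) :
      BlockMove !![t4, b.1; c.1, d.1] !![x, b.2; c.2, d.2]
  /-- Move II, the two crossings in neighbouring tiles. -/
  | reidemeister_two_adjacent {x : Tile} {c d : Tile × Tile} (hx : x ∈ crossings)
      (hc : c ∈ passSW) (hd : d ∈ passSE) :
      BlockMove !![t7, t8; c.2, d.2] !![x, x; c.2, d.2]
  /-- Move II, the two crossings in opposite tiles. -/
  | reidemeister_two_opposite {x : Tile} {b c : Tile × Tile} (hx : x ∈ crossings)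
      (hb : b ∈ passNE) (hc : c ∈ passSW) :
      BlockMove !![t7, b.2; c.2, t7] !![x, b.2; c.2, x.mirror]
  /-- Moves III, IV, VI: a strand in the NW corner is pushed across the central tile. -/
  | across_one {x : Tile} {h v b c d : Tile × Tile} (hx : Passes x h v) (hb : b ∈ passNE)
      (hc : c ∈ passSW) (hd : d ∈ passSE) :
      BlockMove !![t4, v.1, b.1; h.1, x, h.1; c.1, v.1, d.1]
        !![t7, v.2, b.2; h.2, x, h.2; c.2, v.2, d.2]
  /-- Moves III, IV, VI: a strand along the northern side is pushed across the central tile. -/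
  | across_two {x : Tile} {h v a b c d : Tile × Tile} (hx : Passes x h v) (ha : a ∈ endNW)
      (hb : b ∈ endNE) (hc : c ∈ passSW) (hd : d ∈ passSE) :
      BlockMove !![a.1, v.2, b.1; h.1, x, h.1; c.1, v.1, d.1]
        !![a.2, v.1, b.2; h.2, x, h.2; c.2, v.2, d.2]
  /-- Moves III, IV, VI: a strand from the NW corner to the SE corner is pushed across the central
  tile. -/
  | across_three {x : Tile} {h v a b c d : Tile × Tile} (hx : Passes x h v) (ha : a ∈ endNW)
      (hb : b ∈ passNE) (hc : c ∈ passSW) (hd : d ∈ endSE) :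
      BlockMove !![a.1, v.2, b.2; h.1, x, h.2; c.1, v.1, d.1]
        !![a.2, v.1, b.1; h.2, x, h.1; c.2, v.2, d.2]
  /-- Rotations of moves are moves. -/
  | rotate {k : ℕ} {A B : Mosaic k} (h : BlockMove A B) : BlockMove A.rotate B.rotate
  /-- Diagonal flips of moves are moves. -/
  | flip {k : ℕ} {A B : Mosaic k} (h : BlockMove A B) : BlockMove A.flip B.flip
  /-- Mirror images of moves are moves. -/
  | mirror {k : ℕ} {A B : Mosaic k} (h : BlockMove A B) : BlockMove A.mirror B.mirror

/-- The row (column) of an `n`-mosaic that is the `i`-th row (column) of a block with offset `p`. -/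
def shift {k n : ℕ} (p : ℕ) (hp : p + k ≤ n) (i : Fin k) : Fin n := ⟨p + i.val, by omega⟩

/-- `N` arises from `M` by a mosaic move: some block `A` of `M` is replaced by a block `B` with
`BlockMove A B`, and all other tiles stay the same. -/
inductive MosaicMove : RVMosaic → RVMosaic → Prop
  | mk {k n : ℕ} {A B : Mosaic k} {M N : Mosaic n} (p q : ℕ) (hp : p + k ≤ n) (hq : q + k ≤ n)
      (hAB : BlockMove A B)
      (hM : ∀ i j, M (shift p hp i) (shift q hq j) = A i j)
      (hN : ∀ i j, N (shift p hp i) (shift q hq j) = B i j)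
      (hMN : ∀ i j, ¬((∃ i', i = shift p hp i') ∧ ∃ j', j = shift q hq j') → M i j = N i j) :
      MosaicMove ⟨n, M⟩ ⟨n, N⟩

/-- `M` and `N` are related by a finite sequence of mosaic moves and inverse mosaic moves. -/
def MoveEquivalent : RVMosaic → RVMosaic → Prop := Relation.EqvGen MosaicMove

/-! ### Tree mosaics -/

/-- The edges `(u, w)` of a rooted tree, the parent `u` first and the child `w` second. -/
abbrev Edge (T : RootedTree) := {e : T × T // e.1 ⋖ e.2}

/-- The data that determine an oriented embedding `x_{ab}^σ (M, N)` of `M` into `N`: the position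
`(a, b)` (counted from `0`) of the tile of `N` into which `M` is inserted, and the orientation
`σ` in which it is inserted. -/
structure OrientedEmbedding where
  row : ℕ
  col : ℕ
  orientation : DihedralGroup 4

/-- A labelled rooted tree: a mosaic for every vertex, an oriented embedding for every edge. -/
structure TreeMosaic (T : RootedTree) where
  mosaic : T → RVMosaic
  embedding : Edge T → OrientedEmbedding

namespace TreeMosaic

variable {T : RootedTree} (M : TreeMosaic T)

/-- The dimension of the mosaic at `v`. -/
def dim (v : T) : ℕ := (M.mosaic v).1

/-- A tree mosaic is well-defined if for every vertex `v` the embeddings of the edges to the children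
of `v` target the black tiles of the mosaic at `v`, each black tile exactly once. In particular,
the tree is then locally finite. -/
def IsWellDefined : Prop :=
  ∀ v : T, Set.BijOn (fun e => ((M.embedding e).row, (M.embedding e).col))
    {e : Edge T | e.1.1 = v} {p | ∃ k, (M.mosaic v).2.VertexAt p.1 p.2 k}

/-- A tree mosaic is suitably connected if the root carries a knot mosaic, all other vertices carry
tangle mosaics of odd dimension at least `3`, and for every edge the boundary connection points of
the mosaic of the child, in the orientation in which it is inserted, match those of the black tile
that is targeted: one on each side of the black tile with a connection point, none on the others. -/
structure IsSuitablyConnected : Prop where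
  root : (M.mosaic ⊥).2.IsKnot
  tangle : ∀ v : T, v ≠ ⊥ → (M.mosaic v).2.IsTangle
  odd_dim : ∀ v : T, v ≠ ⊥ → Odd (M.dim v)
  three_le_dim : ∀ v : T, v ≠ ⊥ → 3 ≤ M.dim v
  matching : ∀ (e : Edge T) (k : VertexKind),
    (M.mosaic e.1.1).2.VertexAt (M.embedding e).row (M.embedding e).col k →
      ∀ s : Side,
        (s ∈ k.sides → ∃! p : Fin (M.dim e.1.2) × Fin (M.dim e.1.2),
          ((M.mosaic e.1.2).2.act (M.embedding e).orientation).BoundaryPoint p.1 p.2 s) ∧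
        (s ∉ k.sides → ∀ i j,
          ¬((M.mosaic e.1.2).2.act (M.embedding e).orientation).BoundaryPoint i j s)

/-- Tree knot mosaics. -/
structure IsTreeKnotMosaic : Prop where
  wellDefined : M.IsWellDefined
  suitablyConnected : M.IsSuitablyConnected

/-- Mosaic-level equivalence of tree mosaics on the same tree. -/
structure MosaicLevelEquivalent (M₁ M₂ : TreeMosaic T) : Prop where
  embedding_eq : M₁.embedding = M₂.embedding
  dim_eq : ∀ v, M₁.dim v = M₂.dim v
  vertexAt_iff : ∀ v a b k, (M₁.mosaic v).2.VertexAt a b k ↔ (M₂.mosaic v).2.VertexAt a b k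
  moveEquivalent : ∀ v, MoveEquivalent (M₁.mosaic v) (M₂.mosaic v)

end TreeMosaic

/-! ### Geometric realization -/

/-- Three-dimensional space. The first coordinate increases from north to south, the second one from
west to east, and the third one is the height. -/
abbrev Space := EuclideanSpace ℝ (Fin 3)

/-- The centre of the face of the unit cube `[0,1]³` on a given side. -/
noncomputable def Side.point : Side → Space
  | north => !₂[0, 1 / 2, 1 / 2]
  | south => !₂[1, 1 / 2, 1 / 2]
  | west => !₂[1 / 2, 0, 1 / 2]
  | east => !₂[1 / 2, 1, 1 / 2]

/-- The arc joining two sides of a tile by a straight segment. -/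
noncomputable def straightArc (s t : Side) : Set Space := segment ℝ s.point t.point

/-- The arc joining two sides of a tile through the point at height `z` above or below the centre. -/
noncomputable def bentArc (s t : Side) (z : ℝ) : Set Space :=
  segment ℝ s.point !₂[1 / 2, 1 / 2, z] ∪ segment ℝ !₂[1 / 2, 1 / 2, z] t.point

/-- The arcs of a tile in the unit cube. Black tiles contribute nothing to the tame part. -/
noncomputable def Tile.tameArcs : Tile → Set Space
  | t0 => ∅
  | t1 => straightArc west south
  | t2 => straightArc south east
  | t3 => straightArc east north
  | t4 => straightArc north west
  | t5 => straightArc west east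
  | t6 => straightArc north south
  | t7 => straightArc west south ∪ straightArc north east
  | t8 => straightArc north west ∪ straightArc south east
  | t9 => bentArc west east (3 / 4) ∪ bentArc north south (1 / 4)
  | t10 => bentArc west east (1 / 4) ∪ bentArc north south (3 / 4)
  | vertex _ => ∅

/-- The corner `(a, b, 0)` of the cube of the tile in position `(a, b)` (counted from `0`). -/
noncomputable def corner (a b : ℕ) : Space := !₂[(a : ℝ), (b : ℝ), 0]

/-- The tame part `|M|_tame` of the realization of a mosaic. -/
noncomputable def Mosaic.tamePart {n : ℕ} (M : Mosaic n) : Set Space :=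
  ⋃ (i : Fin n) (j : Fin n), (fun x => x + corner i j) '' (M i j).tameArcs

/-- Scale factor, position and orientation of a vertex mosaic in the realization of a tree mosaic. -/
structure Frame where
  scale : ℝ
  position : Space
  orientation : DihedralGroup 4

/-- The similarity of space belonging to a frame. -/
noncomputable def Frame.map (f : Frame) (x : Space) : Space := f.scale • x + f.position

/-- The frame of a child. Here `f` is the frame of the parent, `n` is the dimension of the mosaic of
the parent, `m` that of the child, and `x` is the embedding. The mosaic of the parent is placed in
the orientation `f.orientation`, which moves the targeted tile. -/
noncomputable def Frame.child (f : Frame) (n m : ℕ) (x : OrientedEmbedding) : Frame where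
  scale := f.scale / m
  position := f.position + f.scale •
    corner (actPos n f.orientation (x.row, x.col)).1 (actPos n f.orientation (x.row, x.col)).2
  orientation := f.orientation * x.orientation

namespace TreeMosaic

variable {T : RootedTree} (M : TreeMosaic T)

open Classical in
/-- The number of edges of the path from the root to `v`. -/
noncomputable def depth (v : T) : ℕ := Nat.find (bot_le (a := v)).exists_pred_iterate

open Classical in
/-- The frame of `v`, computed along the last `d` edges of the path from the root to `v`. -/
noncomputable def frameAux : ℕ → T → Frame
  | 0, _ => ⟨1, 0, 1⟩
  | d + 1, v =>
    if h : v = ⊥ then ⟨1, 0, 1⟩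
    else (frameAux d (Order.pred v)).child (M.dim (Order.pred v)) (M.dim v)
      (M.embedding ⟨(Order.pred v, v), Order.pred_covBy_of_not_isMin (by rwa [isMin_iff_eq_bot])⟩)

/-- The frame of `v`. For the root it is the trivial one, for a child it is computed from the frame of
the parent, see `frame_bot` and `frame_edge`. -/
noncomputable def frame (v : T) : Frame := M.frameAux (depth v) v

theorem frame_bot : M.frame ⊥ = ⟨1, 0, 1⟩ := by
  unfold frame
  cases depth (⊥ : T) with
  | zero => rfl
  | succ d => simp [frameAux]

theorem depth_edge (e : Edge T) : depth e.1.2 = depth e.1.1 + 1 := by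
  classical
  obtain ⟨⟨u, w⟩, h⟩ := e
  have hp : Order.pred w = u := h.pred_eq
  have hw : w ≠ ⊥ := fun hw => by
    subst hw
    exact not_lt_bot h.lt
  unfold depth
  rw [Nat.find_comp_succ (bot_le (a := w)).exists_pred_iterate ?_ (by simpa using hw)]
  · congr 1
    simp only [Function.iterate_succ_apply]
    simp only [hp]
  · obtain ⟨n, hn⟩ := (bot_le (a := u)).exists_pred_iterate
    exact ⟨n, by rw [Function.iterate_succ_apply, hp, hn]⟩

theorem frame_edge (e : Edge T) :
    M.frame e.1.2 = (M.frame e.1.1).child (M.dim e.1.1) (M.dim e.1.2) (M.embedding e) := by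
  obtain ⟨⟨u, w⟩, h⟩ := e
  have hp : u = Order.pred w := h.pred_eq.symm
  have hw : w ≠ ⊥ := fun hw => by
    subst hw
    exact not_lt_bot h.lt
  have hd := depth_edge ⟨(u, w), h⟩
  subst hp
  simp only at hd ⊢
  unfold frame
  rw [hd]
  simp [frameAux, hw]

/-- The mosaic of `v` in the orientation in which it is placed in the realization. -/
noncomputable def placedMosaic (v : T) : Mosaic (M.dim v) :=
  (M.mosaic v).2.act (M.frame v).orientation

/-- The connecting segments of an edge `(u, w)`: for each side of the targeted black tile of the
mosaic of `u` with a connection point, the segment from this connection point to the boundary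
connection point of the mosaic of `w` on the same side. -/
def connectingSegments (e : Edge T) : Set Space :=
  let p := actPos (M.dim e.1.1) (M.frame e.1.1).orientation
    ((M.embedding e).row, (M.embedding e).col)
  {x | ∃ (k : VertexKind) (s : Side) (i j : Fin (M.dim e.1.2)),
    (M.placedMosaic e.1.1).VertexAt p.1 p.2 k ∧ s ∈ k.sides ∧
    (M.placedMosaic e.1.2).BoundaryPoint i j s ∧
    x ∈ segment ℝ ((M.frame e.1.1).map (s.point + corner p.1 p.2))
      ((M.frame e.1.2).map (s.point + corner i j))}

/-- The geometric realization of a tree mosaic. -/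
noncomputable def realization : Set Space :=
  closure ((⋃ v, (M.frame v).map '' (M.placedMosaic v).tamePart) ∪
    ⋃ e, M.connectingSegments e)

end TreeMosaic

end KnotMosaic

open KnotMosaic

namespace KnotMosaic

open Set Topology Filter

/-! Each mosaic move is realized by a homeomorphism of space supported over its block and away from
the black tiles. Composing such homeomorphisms gives, for every vertex of the tree, one that carries
the arcs of one mosaic to those of the other. Their placed supports are disjoint and shrink
geometrically with the depth, so infinitely many of them glue to one homeomorphism. A homeomorphism
commutes with closures, so the limit points of the realization need no separate treatment.

The elementary deformation is the triangle move `deforms_triangle`: one side of a triangle is pushed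
to the other two, fixing a closed set that meets the triangle at most in the end points of that
side. Every block move reduces to such moves: in both blocks each strand involved is pushed,
triangle by triangle, to a two-edged path through a common apex. That the triangles avoid all
obstacles is a finite statement about separating planes with integral coefficients, checked by
evaluation; `deforms_of_moveOK` turns the check into a deformation, `BlockMove.cellDeform` collects
the moves and their symmetries, and `CellDeform.of_block` inserts a block into a mosaic.

The supports are governed by cells: over a square, at distance `d` from its boundary, the cell
consists of the heights from `-3d` to `1 + 3d`. In a `3 × 3` block the cell is tall enough to pass a
strand above or below the whole cell of a central black tile, which stays fixed. A child's mosaic,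
shrunk to a tile, has its cell inside the cell of that tile (`smul_mem_openCell`). Hence the
supports of different vertices are disjoint (`disjoint_support`), and arcs and connecting segments
meet no foreign support. The gluing is `exists_glued_homeomorph`, fed by `finite_displacement`; the
result is `exists_homeomorph`. Frames and connecting segments are the same for both tree mosaics. -/

/-! ### Homeomorphisms that move points along lines -/

/-- A continuous family of increasing bijections of the line is a homeomorphism of the product. -/
noncomputable def fiberHomeomorph {Y : Type*} [TopologicalSpace Y] (f : Y × ℝ → ℝ)
    (hf : Continuous f) (hmono : ∀ y, StrictMono fun v => f (y, v))
    (hsurj : ∀ y, Function.Surjective fun v => f (y, v)) : (Y × ℝ) ≃ₜ (Y × ℝ) where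
  toFun p := (p.1, f p)
  invFun p := (p.1, (hsurj p.1 p.2).choose)
  left_inv p := by
    have h := (hsurj p.1 (f p)).choose_spec
    exact Prod.ext rfl ((hmono p.1).injective h)
  right_inv p := Prod.ext rfl (hsurj p.1 p.2).choose_spec
  continuous_toFun := by fun_prop
  continuous_invFun := by
    -- Preimages of rays suffice: by monotonicity the solution exceeds `a` exactly if `f (y, a)`
    -- lies below the second coordinate, an open condition in which the solution no longer occurs.
    refine continuous_fst.prodMk (OrderTopology.continuous_iff.2 fun a => ⟨?_, ?_⟩)
    · have : (fun p : Y × ℝ => (hsurj p.1 p.2).choose) ⁻¹' Ioi a = {p | f (p.1, a) < p.2} := by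
        ext p
        have h := (hsurj p.1 p.2).choose_spec
        simp only [mem_preimage, mem_Ioi, mem_ofPred_eq]
        conv_rhs => rw [← h]
        exact (hmono p.1).lt_iff_lt.symm
      rw [this]
      exact isOpen_lt (by fun_prop) (by fun_prop)
    · have : (fun p : Y × ℝ => (hsurj p.1 p.2).choose) ⁻¹' Iio a = {p | p.2 < f (p.1, a)} := by
        ext p
        have h := (hsurj p.1 p.2).choose_spec
        simp only [mem_preimage, mem_Iio, mem_ofPred_eq]
        conv_rhs => rw [← h]
        exact (hmono p.1).lt_iff_lt.symm
      rw [this]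
      exact isOpen_lt (by fun_prop) (by fun_prop)

/-! ### The push across a triangle in model coordinates -/

/-- The profile of a push on a line: it is `1` at the origin, vanishes outside `(-e, l + e)`. -/
noncomputable def pushProfile (e l v : ℝ) : ℝ := max 0 (min (1 + v / e) (1 - v / (l + e)))

theorem pushProfile_nonneg (e l v : ℝ) : 0 ≤ pushProfile e l v := le_max_left _ _

theorem pushProfile_le_one {e l : ℝ} (he : 0 ≤ e) (hl : 0 ≤ l) (v : ℝ) : pushProfile e l v ≤ 1 := by
  refine max_le zero_le_one ?_
  rcases le_total 0 v with h | h
  · exact (min_le_right _ _).trans (by have := div_nonneg h (add_nonneg hl he); linarith)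
  · exact (min_le_left _ _).trans (by have := div_nonpos_of_nonpos_of_nonneg h he; linarith)

theorem pushProfile_zero (e l : ℝ) : pushProfile e l 0 = 1 := by simp [pushProfile]

theorem mem_of_pushProfile_pos {e l v : ℝ} (he : 0 < e) (hl : 0 ≤ l) (h : 0 < pushProfile e l v) :
    -e < v ∧ v < l + e := by
  have hle : 0 < l + e := by linarith
  have h1 : 0 < min (1 + v / e) (1 - v / (l + e)) := by
    rcases lt_max_iff.1 h with h | h
    · exact absurd h (lt_irrefl _)
    · exact h
  obtain ⟨h2, h3⟩ := lt_min_iff.1 h1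
  constructor
  · have : -1 < v / e := by linarith
    rw [lt_div_iff₀ he] at this
    linarith
  · have : v / (l + e) < 1 := by linarith
    rw [div_lt_one hle] at this
    exact this

/-- The only falling piece of the profile has slope `-1 / (l + e)`. With an amplitude of at most `l`
the loss stays below the gain of the identity, which is what makes the push increasing. -/
theorem pushProfile_sub {e l v v' : ℝ} (he : 0 < e) (hl : 0 ≤ l) (h : v ≤ v') :
    pushProfile e l v - (v' - v) / (l + e) ≤ pushProfile e l v' := by
  have hle : 0 < l + e := by linarith
  have h0 : 0 ≤ (v' - v) / (l + e) := div_nonneg (by linarith) hle.le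
  have h1 : v / e ≤ v' / e := div_le_div_of_nonneg_right h he.le
  have h2 : (v' - v) / (l + e) = v' / (l + e) - v / (l + e) := by ring
  rw [sub_le_iff_le_add]
  refine max_le (add_nonneg (pushProfile_nonneg _ _ _) h0) ?_
  have h3 : min (1 + v' / e) (1 - v' / (l + e)) ≤ pushProfile e l v' := le_max_right _ _
  refine le_trans ?_ (add_le_add_left h3 _)
  rw [min_add]
  refine le_min ((min_le_left _ _).trans (by linarith)) ((min_le_right _ _).trans (by linarith))

section push

variable (ε : ℝ → ℝ)

/-- The length of the fibre of the model triangle over `u`. -/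
noncomputable def fiberLength (u : ℝ) : ℝ := max 0 (1 - |u|)

/-- The map that pushes the base of the model triangle to its other two sides. -/
noncomputable def modelPush (p : (ℝ × ℝ) × ℝ) : ℝ :=
  p.2 + max 0 (1 - |p.1.2| / ε p.1.1) * fiberLength p.1.1 *
    pushProfile (ε p.1.1) (fiberLength p.1.1) p.2

variable {ε}

theorem fiberLength_nonneg (u : ℝ) : 0 ≤ fiberLength u := le_max_left _ _

theorem continuous_fiberLength : Continuous fiberLength := by unfold fiberLength; fun_prop

theorem fiberLength_of_one_le {u : ℝ} (hu : 1 ≤ |u|) : fiberLength u = 0 :=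
  max_eq_left (by linarith)

theorem modelPush_amplitude (h0 : ∀ u, 0 ≤ ε u) (u w : ℝ) :
    0 ≤ max 0 (1 - |w| / ε u) * fiberLength u ∧
      max 0 (1 - |w| / ε u) * fiberLength u ≤ fiberLength u := by
  refine ⟨mul_nonneg (le_max_left _ _) (fiberLength_nonneg u), ?_⟩
  refine mul_le_of_le_one_left (fiberLength_nonneg u) (max_le zero_le_one ?_)
  have := div_nonneg (abs_nonneg w) (h0 u)
  linarith

/-- These bounds survive where `ε` vanishes. They give continuity over the ends of the triangle by
squeezing, and surjectivity on each fibre. -/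
theorem modelPush_bounds (h0 : ∀ u, 0 ≤ ε u) (u w v : ℝ) :
    v ≤ modelPush ε ((u, w), v) ∧ modelPush ε ((u, w), v) ≤ v + fiberLength u := by
  obtain ⟨h1, h2⟩ := modelPush_amplitude h0 u w
  have h3 := pushProfile_nonneg (ε u) (fiberLength u) v
  have h4 := pushProfile_le_one (h0 u) (fiberLength_nonneg u) v
  unfold modelPush
  constructor
  · have := mul_nonneg h1 h3
    simpa using this
  · have := mul_le_of_le_one_right h1 h4
    simp only
    linarith

theorem continuous_modelPush (hε : Continuous ε) (h0 : ∀ u, 0 ≤ ε u)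
    (hpos : ∀ u, |u| < 1 → 0 < ε u) : Continuous (modelPush ε) := by
  rw [continuous_iff_continuousAt]
  rintro ⟨⟨u, w⟩, v⟩
  rcases lt_or_ge |u| 1 with hu | hu
  · have he := hpos u hu
    have hl := fiberLength_nonneg u
    have hc := continuous_fiberLength
    unfold modelPush pushProfile
    have h1 : ContinuousAt (fun p : (ℝ × ℝ) × ℝ => |p.1.2| / ε p.1.1) ((u, w), v) :=
      ContinuousAt.div (by fun_prop) (by fun_prop) he.ne'
    have h2 : ContinuousAt (fun p : (ℝ × ℝ) × ℝ => p.2 / ε p.1.1) ((u, w), v) :=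
      ContinuousAt.div (by fun_prop) (by fun_prop) he.ne'
    have h3 : ContinuousAt (fun p : (ℝ × ℝ) × ℝ => p.2 / (fiberLength p.1.1 + ε p.1.1))
        ((u, w), v) :=
      ContinuousAt.div (by fun_prop) (by fun_prop) (by simp only; linarith)
    fun_prop
  -- Here `ε` may be zero and the quotients need not be continuous; instead the map is squeezed
  -- between `v` and `v + fiberLength u`, which agree at this point.
  · have hz := fiberLength_of_one_le hu
    have hval : modelPush ε ((u, w), v) = v := by simp [modelPush, hz]
    unfold ContinuousAt
    rw [hval]
    have hc : Continuous fun p : (ℝ × ℝ) × ℝ => p.2 + fiberLength p.1.1 := by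
      have := continuous_fiberLength
      fun_prop
    have ht := hc.tendsto ((u, w), v)
    simp only [hz, add_zero] at ht
    exact tendsto_of_tendsto_of_tendsto_of_le_of_le (continuous_snd.tendsto ((u, w), v)) ht
      (fun p => (modelPush_bounds h0 p.1.1 p.1.2 p.2).1)
      (fun p => (modelPush_bounds h0 p.1.1 p.1.2 p.2).2)

theorem strictMono_modelPush (h0 : ∀ u, 0 ≤ ε u) (hpos : ∀ u, |u| < 1 → 0 < ε u) (y : ℝ × ℝ) :
    StrictMono fun v => modelPush ε (y, v) := by
  intro v v' hv
  obtain ⟨u, w⟩ := y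
  rcases lt_or_ge |u| 1 with hu | hu
  · have he := hpos u hu
    have hl := fiberLength_nonneg u
    obtain ⟨h1, h2⟩ := modelPush_amplitude h0 u w
    have h3 := pushProfile_sub he hl hv.le
    have hle : 0 < fiberLength u + ε u := by linarith
    simp only [modelPush]
    set A := max 0 (1 - |w| / ε u) * fiberLength u
    have h4 := mul_le_mul_of_nonneg_left h3 h1
    have h5 : A * ((v' - v) / (fiberLength u + ε u)) < v' - v := by
      rw [← mul_div_assoc, div_lt_iff₀ hle, mul_comm]
      exact mul_lt_mul_of_pos_left (by linarith) (by linarith)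
    rw [mul_sub] at h4
    linarith
  · simpa [modelPush, fiberLength_of_one_le hu] using hv

theorem surjective_modelPush (hε : Continuous ε) (h0 : ∀ u, 0 ≤ ε u)
    (hpos : ∀ u, |u| < 1 → 0 < ε u) (y : ℝ × ℝ) :
    Function.Surjective fun v => modelPush ε (y, v) := by
  have hc : Continuous fun v => modelPush ε (y, v) :=
    (continuous_modelPush hε h0 hpos).comp (by fun_prop)
  refine hc.surjective ?_ ?_
  · exact tendsto_atTop_mono (fun v => (modelPush_bounds h0 y.1 y.2 v).1) tendsto_id
  · exact tendsto_atBot_mono (fun v => (modelPush_bounds h0 y.1 y.2 v).2)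
      (tendsto_atBot_add_const_right _ _ tendsto_id)

end push

/-- The distance of a closed set from the fibres of the model triangle, as a continuous function. -/
theorem exists_push_radius {C : Set ((ℝ × ℝ) × ℝ)} (hC : IsClosed C) (hne : C.Nonempty)
    (h : ∀ u v, 0 ≤ v → |u| + v ≤ 1 → ((u, 0), v) ∈ C → |u| = 1) :
    ∃ ε : ℝ → ℝ, Continuous ε ∧ (∀ u, 0 ≤ ε u) ∧ (∀ u, |u| < 1 → 0 < ε u) ∧
      ∀ u, ∀ s ∈ Icc (0 : ℝ) 1, ∀ x ∈ C, ε u ≤ dist ((u, 0), s * fiberLength u) x := by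
  -- Rescaling every fibre to `[0, 1]` gives a fixed compact parameter space, so the minimum over
  -- the fibre is continuous in `u` even where the fibre shrinks to a point.
  obtain ⟨F, hFdef⟩ : ∃ F : ℝ → ℝ → ℝ,
      F = fun u s => Metric.infDist ((u, 0), s * fiberLength u) C := ⟨_, rfl⟩
  have hF : Continuous ↿F := by
    have hc := continuous_fiberLength
    rw [hFdef]
    refine (Metric.continuous_infDist_pt C).comp ?_
    fun_prop
  have hcpt : ∀ u, IsCompact (F u '' Icc 0 1) := fun u =>
    isCompact_Icc.image (hF.comp (by fun_prop : Continuous fun s => (u, s)))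
  have hmem : ∀ u, sInf (F u '' Icc 0 1) ∈ F u '' Icc 0 1 := fun u =>
    (hcpt u).sInf_mem ((nonempty_Icc.2 zero_le_one).image _)
  refine ⟨fun u => sInf (F u '' Icc 0 1), isCompact_Icc.continuous_sInf hF, fun u => ?_,
    fun u hu => ?_, fun u s hs x hx => ?_⟩
  · obtain ⟨s, -, hs⟩ := hmem u
    simp only
    rw [← hs, hFdef]
    exact Metric.infDist_nonneg
  · obtain ⟨s, hs, hs'⟩ := hmem u
    simp only
    rw [← hs', hFdef]
    refine (hC.notMem_iff_infDist_pos hne).1 fun hin => ?_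
    have hL : fiberLength u = 1 - |u| := max_eq_right (by linarith)
    have := h u _ (mul_nonneg hs.1 (fiberLength_nonneg u)) (by
      have := mul_le_of_le_one_left (fiberLength_nonneg u) hs.2
      linarith) hin
    linarith
  · refine (csInf_le (hcpt u).bddBelow (mem_image_of_mem _ hs)).trans ?_
    rw [hFdef]
    exact Metric.infDist_le_dist_of_mem hx

/-- A point that moves has `|w| < ε u` and `v` within `ε u` of the interval `[0, fiberLength u]`. In
the maximum metric of the product it is then closer than `ε u` to the fibre, which no point of `C`
is. -/
theorem modelPush_eq_self {ε : ℝ → ℝ} {C : Set ((ℝ × ℝ) × ℝ)}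
    (hpos : ∀ u, |u| < 1 → 0 < ε u)
    (h : ∀ u, ∀ s ∈ Icc (0 : ℝ) 1, ∀ x ∈ C, ε u ≤ dist ((u, 0), s * fiberLength u) x)
    {u w v : ℝ} (hx : ((u, w), v) ∈ C) : modelPush ε ((u, w), v) = v := by
  by_contra hcon
  have hφ : max 0 (1 - |w| / ε u) * fiberLength u *
      pushProfile (ε u) (fiberLength u) v ≠ 0 := by
    intro hz
    apply hcon
    simp only [modelPush]
    rw [hz, add_zero]
  obtain ⟨hA, hP⟩ := mul_ne_zero_iff.1 hφ
  obtain ⟨hA, hL⟩ := mul_ne_zero_iff.1 hA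
  have hu : |u| < 1 := by
    by_contra hu
    exact hL (fiberLength_of_one_le (not_lt.1 hu))
  have he := hpos u hu
  have hLpos : 0 < fiberLength u := lt_of_le_of_ne (fiberLength_nonneg u) hL.symm
  have hw : |w| < ε u := by
    by_contra hw
    apply hA
    have : 1 ≤ |w| / ε u := (one_le_div he).2 (not_lt.1 hw)
    exact max_eq_left (by linarith)
  obtain ⟨hv1, hv2⟩ := mem_of_pushProfile_pos he hLpos.le
    (lt_of_le_of_ne (pushProfile_nonneg _ _ _) hP.symm)
  obtain ⟨s, hs, hsv⟩ : ∃ s ∈ Icc (0 : ℝ) 1, |v - s * fiberLength u| < ε u := by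
    rcases le_total v 0 with hv | hv
    · exact ⟨0, by simp, by rw [zero_mul, sub_zero, abs_of_nonpos hv]; linarith⟩
    rcases le_total v (fiberLength u) with hv' | hv'
    · refine ⟨v / fiberLength u, ⟨div_nonneg hv hLpos.le, (div_le_one hLpos).2 hv'⟩, ?_⟩
      rw [div_mul_cancel₀ _ hL]
      simpa using he
    · exact ⟨1, by simp, by rw [one_mul, abs_of_nonneg (by linarith)]; linarith⟩
  have h1 := h u s hs _ hx
  have h3 : dist (((u, 0), s * fiberLength u) : (ℝ × ℝ) × ℝ) ((u, w), v) < ε u := by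
    rw [Prod.dist_eq, Prod.dist_eq]
    refine max_lt (max_lt (by simpa using he) ?_) ?_
    · simpa [Real.dist_eq] using hw
    · rw [dist_comm, Real.dist_eq]
      exact hsv
  linarith

/-- The triangle move in model coordinates. -/
theorem exists_model_push {C : Set ((ℝ × ℝ) × ℝ)} (hC : IsClosed C)
    (h : ∀ u v, 0 ≤ v → |u| + v ≤ 1 → ((u, 0), v) ∈ C → |u| = 1) :
    ∃ g : ((ℝ × ℝ) × ℝ) ≃ₜ ((ℝ × ℝ) × ℝ), (∀ x ∈ C, g x = x) ∧
      ∀ u, |u| ≤ 1 → g ((u, 0), 0) = ((u, 0), 1 - |u|) := by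
  -- The distance to the empty set is zero, so a point is added to ensure nonemptiness. A corner of
  -- the triangle is harmless, as it has `|u| = 1`.
  have hC' : IsClosed ({((1, 0), 0)} ∪ C) := isClosed_singleton.union hC
  obtain ⟨ε, hε, h0, hpos, hd⟩ := exists_push_radius hC' ⟨((1, 0), 0), by simp⟩ (by
    rintro u v hv huv (hmem | hmem)
    · have : u = 1 := congrArg (fun p => p.1.1) hmem
      simp [this]
    · exact h u v hv huv hmem)
  refine ⟨fiberHomeomorph (modelPush ε) (continuous_modelPush hε h0 hpos)
    (strictMono_modelPush h0 hpos) (surjective_modelPush hε h0 hpos), ?_, ?_⟩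
  · rintro ⟨⟨u, w⟩, v⟩ hx
    exact Prod.ext rfl (modelPush_eq_self hpos hd (Or.inr hx))
  · intro u hu
    refine Prod.ext rfl ?_
    change modelPush ε ((u, 0), 0) = 1 - |u|
    simp [modelPush, pushProfile_zero, fiberLength, hu]

/-! ### Deformations relative to a fixed set, and the triangle move -/

/-- `Deforms C A B`: a homeomorphism of the space that fixes `C` pointwise carries `A` to `B`. -/
def Deforms {X : Type*} [TopologicalSpace X] (C A B : Set X) : Prop :=
  ∃ h : X ≃ₜ X, (∀ x ∈ C, h x = x) ∧ h '' A = B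

namespace Deforms

variable {X : Type*} [TopologicalSpace X] {C C' A B D R : Set X}

theorem refl (C A : Set X) : Deforms C A A := ⟨Homeomorph.refl X, by simp, by simp⟩

theorem symm (h : Deforms C A B) : Deforms C B A := by
  obtain ⟨f, hf, rfl⟩ := h
  refine ⟨f.symm, fun x hx => f.injective (by simp [hf x hx]), ?_⟩
  rw [← image_comp]
  simp

theorem trans (h : Deforms C A B) (h' : Deforms C B D) : Deforms C A D := by
  obtain ⟨f, hf, rfl⟩ := h
  obtain ⟨g, hg, rfl⟩ := h'
  exact ⟨f.trans g, fun x hx => by simp [hf x hx, hg x hx], by rw [← image_comp]; rfl⟩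

theorem mono (h : Deforms C A B) (hC : C' ⊆ C) : Deforms C' A B := by
  obtain ⟨f, hf, hA⟩ := h
  exact ⟨f, fun x hx => hf x (hC hx), hA⟩

theorem union (h : Deforms C A B) (hR : R ⊆ C) : Deforms C (A ∪ R) (B ∪ R) := by
  obtain ⟨f, hf, rfl⟩ := h
  refine ⟨f, hf, ?_⟩
  rw [image_union]
  congr 1
  exact (image_congr fun x hx => hf x (hR hx)).trans (image_id _)

end Deforms

/-- The triangle move: a side of a triangle is pushed across the triangle to the other two sides. -/
theorem deforms_triangle {C : Set Space} (hC : IsClosed C) {a b c : Space}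
    (hind : LinearIndependent ℝ ![b - a, c - a])
    (h : C ∩ convexHull ℝ {a, b, c} ⊆ {a, b}) :
    Deforms C (segment ℝ a b) (segment ℝ a c ∪ segment ℝ c b) := by
  have hfin : Module.finrank ℝ Space = 3 := by simp
  obtain ⟨e, he⟩ := exists_linearIndependent_snoc_of_lt_finrank hind (by simp [hfin])
  let B := basisOfLinearIndependentOfCardEqFinrank he (by simp [hfin])
  have hB0 : B 0 = b - a := by simp [B]
  have hB1 : B 1 = c - a := by simp [B]
  have hB2 : B 2 = e := by simp [B]
  -- Affine chart taking the model triangle with corners `(u, v) = (-1, 0), (1, 0), (0, 1)` in the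
  -- plane `w = 0` to `a`, `b`, `c`; the vector `e` spans the direction transverse to the triangle.
  let φ : (ℝ × ℝ) × ℝ → Space := fun p =>
    a + ((1 + p.1.1 - p.2) / 2) • (b - a) + p.2 • (c - a) + p.1.2 • e
  let ψ : Space → (ℝ × ℝ) × ℝ := fun x =>
    ((2 * B.repr (x - a) 0 + B.repr (x - a) 1 - 1, B.repr (x - a) 2), B.repr (x - a) 1)
  have hφB : ∀ p, φ p - a = ((1 + p.1.1 - p.2) / 2) • B 0 + p.2 • B 1 + p.1.2 • B 2 := by
    intro p
    rw [hB0, hB1, hB2]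
    simp only [φ]
    abel
  let Φ : ((ℝ × ℝ) × ℝ) ≃ₜ Space :=
    { toFun := φ
      invFun := ψ
      left_inv := fun p => by
        simp only [ψ, hφB]
        simp
        rcases p with ⟨⟨u, w⟩, v⟩
        simp only [Prod.mk.injEq, and_true]
        ring
      right_inv := fun x => by
        rw [← sub_left_inj (a := a), hφB]
        conv_rhs => rw [← B.sum_repr (x - a), Fin.sum_univ_three]
        simp only [ψ]
        congr 3
        ring
      continuous_toFun := by simp only [φ]; fun_prop
      continuous_invFun := by
        have hr : ∀ i, Continuous fun x : Space => B.repr (x - a) i := fun i => by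
          have := (B.coord i).continuous_of_finiteDimensional
          exact this.comp (by fun_prop)
        have h0 := hr 0
        have h1 := hr 1
        have h2 := hr 2
        simp only [ψ]
        fun_prop }
  have hΦ : ∀ u w v, Φ ((u, w), v) = a + ((1 + u - v) / 2) • (b - a) + v • (c - a) + w • e :=
    fun _ _ _ => rfl
  have hab : segment ℝ a b = (fun u => Φ ((u, 0), 0)) '' Icc (-1) 1 := by
    rw [segment_eq_image']
    ext x
    simp only [mem_image, hΦ]
    constructor
    · rintro ⟨t, ht, rfl⟩
      refine ⟨2 * t - 1, ⟨by linarith [ht.1], by linarith [ht.2]⟩, ?_⟩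
      simp only [zero_smul, add_zero, sub_zero]
      congr 2
      ring
    · rintro ⟨u, hu, rfl⟩
      refine ⟨(1 + u) / 2, ⟨by linarith [hu.1], by linarith [hu.2]⟩, ?_⟩
      simp
  have hac : segment ℝ a c = (fun u => Φ ((u, 0), 1 - |u|)) '' Icc (-1) 0 := by
    rw [segment_eq_image']
    ext x
    simp only [mem_image, hΦ]
    constructor
    · rintro ⟨t, ht, rfl⟩
      refine ⟨t - 1, ⟨by linarith [ht.1], by linarith [ht.2]⟩, ?_⟩
      rw [abs_of_nonpos (by linarith [ht.2])]
      simp only [zero_smul, add_zero]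
      rw [show (1 + (t - 1) - (1 - -(t - 1))) / 2 = 0 by ring, zero_smul, add_zero]
      congr 2
      ring
    · rintro ⟨u, hu, rfl⟩
      refine ⟨1 + u, ⟨by linarith [hu.1], by linarith [hu.2]⟩, ?_⟩
      rw [abs_of_nonpos hu.2, show (1 + u - (1 - -u)) / 2 = 0 by ring]
      simp
  have hcb : segment ℝ c b = (fun u => Φ ((u, 0), 1 - |u|)) '' Icc 0 1 := by
    rw [segment_symm, segment_eq_image']
    ext x
    simp only [mem_image, hΦ]
    constructor
    · rintro ⟨t, ht, rfl⟩
      refine ⟨1 - t, ⟨by linarith [ht.2], by linarith [ht.1]⟩, ?_⟩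
      rw [abs_of_nonneg (by linarith [ht.2])]
      rw [show (1 + (1 - t) - (1 - (1 - t))) / 2 = 1 - t by ring,
        show 1 - (1 - t) = t by ring]
      module
    · rintro ⟨u, hu, rfl⟩
      refine ⟨1 - u, ⟨by linarith [hu.2], by linarith [hu.1]⟩, ?_⟩
      rw [abs_of_nonneg hu.1, show (1 + u - (1 - u)) / 2 = u by ring]
      module
  -- In the chart the only permitted contacts, `a` and `b`, are the corners with `|u| = 1`.
  obtain ⟨g, hgC, hg⟩ := exists_model_push (C := Φ ⁻¹' C) (hC.preimage Φ.continuous) (by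
    intro u v hv huv hmem
    have hu := abs_le.1 (show |u| ≤ 1 - v by linarith)
    have hin : Φ ((u, 0), v) ∈ convexHull ℝ {a, b, c} := by
      have h1 : Φ ((u, 0), v) = ((1 - u - v) / 2) • a + ((1 + u - v) / 2) • b + v • c := by
        rw [hΦ]
        module
      rw [h1]
      have hconv := convex_convexHull ℝ ({a, b, c} : Set Space)
      have ha : a ∈ convexHull ℝ {a, b, c} := subset_convexHull _ _ (by simp)
      have hb : b ∈ convexHull ℝ {a, b, c} := subset_convexHull _ _ (by simp)
      have hc : c ∈ convexHull ℝ {a, b, c} := subset_convexHull _ _ (by simp)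
      have := hconv.sum_mem (t := Finset.univ) (w := ![(1 - u - v) / 2, (1 + u - v) / 2, v])
        (z := ![a, b, c]) (by
          intro i _
          fin_cases i
          · simp; linarith [hu.2]
          · simp; linarith [hu.1]
          · simpa using hv) (by simp [Fin.sum_univ_three]; ring) (by
          intro i _
          fin_cases i <;> assumption)
      simpa [Fin.sum_univ_three] using this
    have hΦa : Φ ((-1, 0), 0) = a := by rw [hΦ]; simp
    have hΦb : Φ ((1, 0), 0) = b := by rw [hΦ]; norm_num
    rcases h ⟨hmem, hin⟩ with heq | heq
    · rw [← hΦa] at heq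
      have := Φ.injective heq
      simp only [Prod.mk.injEq] at this
      simp [this.1.1]
    · rw [mem_singleton_iff, ← hΦb] at heq
      have := Φ.injective heq
      simp only [Prod.mk.injEq] at this
      simp [this.1.1])
  refine ⟨(Φ.symm.trans g).trans Φ, ?_, ?_⟩
  · intro x hx
    have : g (Φ.symm x) = Φ.symm x := hgC _ (by simpa using hx)
    simp [this]
  · rw [hab, hac, hcb, ← image_union, Icc_union_Icc_eq_Icc (by norm_num) (by norm_num),
      ← image_comp]
    refine image_congr fun u hu => ?_
    have := hg u (abs_le.2 hu)
    simp [this]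

end KnotMosaic

namespace KnotMosaic

open Set

/-! ### Polygonal arcs with integral vertices -/

/-- Points of space with coordinates in `ℤ / 4`. -/
abbrev Pt := ℤ × ℤ × ℤ

/-- Segments between such points. -/
abbrev Seg := Pt × Pt

/-- The point of space with four times the given coordinates. -/
noncomputable def realPt (p : Pt) : Space := !₂[(p.1 : ℝ) / 4, (p.2.1 : ℝ) / 4, (p.2.2 : ℝ) / 4]

/-- The union of the segments of a list. -/
def segSet (l : List Seg) : Set Space := ⋃ s ∈ l, segment ℝ (realPt s.1) (realPt s.2)

theorem mem_segSet {l : List Seg} {x : Space} :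
    x ∈ segSet l ↔ ∃ s ∈ l, x ∈ segment ℝ (realPt s.1) (realPt s.2) := by simp [segSet]

@[simp] theorem segSet_nil : segSet [] = ∅ := by simp [segSet]

@[simp] theorem segSet_cons (s : Seg) (l : List Seg) :
    segSet (s :: l) = segment ℝ (realPt s.1) (realPt s.2) ∪ segSet l := by
  ext x
  simp [mem_segSet]

@[simp] theorem segSet_append (l l' : List Seg) : segSet (l ++ l') = segSet l ∪ segSet l' := by
  ext x
  simp [mem_segSet, or_and_right, exists_or]

theorem isClosed_segment (a b : Space) : IsClosed (segment ℝ a b) := by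
  rw [segment_eq_image']
  exact (isCompact_Icc.image (by fun_prop)).isClosed

theorem isClosed_segSet (l : List Seg) : IsClosed (segSet l) := by
  induction l with
  | nil => simp
  | cons s l ih => rw [segSet_cons]; exact (isClosed_segment _ _).union ih

/-- The list of edges of a polygon. -/
def edges : List Pt → List Seg
  | p :: q :: l => (p, q) :: edges (q :: l)
  | _ => []

/-! ### Separation of triangles from other convex sets -/

/-- The scalar product of integral vectors. -/
def dot (n p : Pt) : ℤ := n.1 * p.1 + n.2.1 * p.2.1 + n.2.2 * p.2.2

/-- The scalar product with an integral vector. -/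
noncomputable def dotR (n : Pt) : Space →ₗ[ℝ] ℝ where
  toFun x := n.1 * x 0 + n.2.1 * x 1 + n.2.2 * x 2
  map_add' x y := by simp; ring
  map_smul' c x := by simp; ring

theorem dotR_apply (n : Pt) (x : Space) :
    dotR n x = n.1 * x 0 + n.2.1 * x 1 + n.2.2 * x 2 := rfl

theorem dotR_realPt (n p : Pt) : dotR n (realPt p) = (dot n p : ℝ) / 4 := by
  simp [dotR_apply, realPt, dot]
  ring

/-- A point of a convex hull on the wrong side of a supporting plane is the only vertex in it. -/
theorem eq_of_mem_convexHull {V : Set Space} {f : Space →ₗ[ℝ] ℝ} {m : ℝ} {v x : Space}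
    (h : ∀ y ∈ V, m < f y ∨ y = v ∧ m ≤ f y) (hx : x ∈ convexHull ℝ V) (hm : f x ≤ m) : x = v := by
  rcases le_or_gt m (f v) with hv | hv
  -- An open half-space together with a single point of its closure is convex, so it contains the
  -- hull as soon as it contains the vertices.
  · have hconv : Convex ℝ (insert v {y | m < f y}) := by
      rw [convex_iff_forall_pos]
      intro y hy z hz s t hs ht hst
      by_cases hyz : y = v ∧ z = v
      · left
        rw [hyz.1, hyz.2, ← add_smul, hst, one_smul]
      · right
        have hy' : m ≤ f y := by
          rcases hy with rfl | hy
          exacts [hv, le_of_lt hy]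
        have hz' : m ≤ f z := by
          rcases hz with rfl | hz
          exacts [hv, le_of_lt hz]
        have hm' : m = s * m + t * m := by rw [← add_mul, hst, one_mul]
        simp only [mem_ofPred_eq, map_add, map_smul, smul_eq_mul]
        rcases not_and_or.1 hyz with hne | hne
        · have : m < f y := (mem_insert_iff.1 hy).resolve_left hne
          have h1 := mul_lt_mul_of_pos_left this hs
          have h2 := mul_le_mul_of_nonneg_left hz' ht.le
          linarith
        · have : m < f z := (mem_insert_iff.1 hz).resolve_left hne
          have h1 := mul_lt_mul_of_pos_left this ht
          have h2 := mul_le_mul_of_nonneg_left hy' hs.le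
          linarith
    have hsub : V ⊆ insert v {y | m < f y} := fun y hy =>
      (h y hy).elim Or.inr fun h => Or.inl h.1
    rcases convexHull_min hsub hconv hx with h | h
    · exact h
    · exact absurd hm (not_le.2 h)
  · have hsub : V ⊆ {y | m < f y} := fun y hy => (h y hy).elim id fun h' => by
      rw [h'.1] at h'
      exact absurd h'.2 (not_le.2 hv)
    have : m < f x := convexHull_min hsub (convex_halfSpace_gt f.isLinear m) hx
    exact absurd hm (not_le.2 this)

/-- All points of the list lie on the positive side of the plane `n · x = m`, apart from `v`, which
may lie in the plane. -/
def above (n : Pt) (m : ℤ) (v : Pt) (l : List Pt) : Bool :=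
  l.all fun t => decide (m < dot n t) || (decide (m = dot n t) && decide (t = v))

/-- The plane `n · x = m` separates the triangle with vertices `a`, `b`, `c` from its negative side,
apart from `a` or `b`. -/
def clears (n : Pt) (m : ℤ) (a b c : Pt) : Bool := above n m a [a, b, c] || above n m b [a, b, c]

/-- The triangle with the given vertices. -/
def triangle (a b c : Pt) : Set Space := convexHull ℝ {realPt a, realPt b, realPt c}

theorem eq_of_above {n : Pt} {m : ℤ} {v : Pt} {l : List Pt} (h : above n m v l = true) {x : Space}
    (hx : x ∈ convexHull ℝ {y | ∃ p ∈ l, realPt p = y}) (hm : dotR n x ≤ (m : ℝ) / 4) :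
    x = realPt v := by
  refine eq_of_mem_convexHull (f := dotR n) (m := (m : ℝ) / 4) ?_ hx hm
  rintro _ ⟨p, hp, rfl⟩
  have hp' := List.all_eq_true.1 h p hp
  simp only [Bool.or_eq_true, Bool.and_eq_true, decide_eq_true_eq] at hp'
  rw [dotR_realPt]
  rcases hp' with h1 | ⟨h1, h2⟩
  · left
    have : (m : ℝ) < dot n p := by exact_mod_cast h1
    linarith
  · right
    exact ⟨by rw [h2], by rw [h1]⟩

theorem eq_or_eq_of_clears {n : Pt} {m : ℤ} {a b c : Pt} (h : clears n m a b c = true) {x : Space}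
    (hx : x ∈ triangle a b c) (hm : dotR n x ≤ (m : ℝ) / 4) : x ∈ ({realPt a, realPt b} : Set Space) := by
  have hx' : x ∈ convexHull ℝ {y | ∃ p ∈ [a, b, c], realPt p = y} := by
    refine convexHull_mono ?_ hx
    rintro y (rfl | rfl | rfl)
    exacts [⟨a, by simp, rfl⟩, ⟨b, by simp, rfl⟩, ⟨c, by simp, rfl⟩]
  rcases Bool.or_eq_true_iff.1 h with h | h
  · exact Or.inl (eq_of_above h hx' hm)
  · exact Or.inr (eq_of_above h hx' hm)

/-- The negative of an integral vector. -/
def neg (p : Pt) : Pt := (-p.1, -p.2.1, -p.2.2)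

/-- The difference of integral vectors. -/
def sub (p q : Pt) : Pt := (p.1 - q.1, p.2.1 - q.2.1, p.2.2 - q.2.2)

/-- The vector product of integral vectors. -/
def cross (p q : Pt) : Pt :=
  (p.2.1 * q.2.2 - p.2.2 * q.2.1, p.2.2 * q.1 - p.1 * q.2.2, p.1 * q.2.1 - p.2.1 * q.1)

/-- Some plane orthogonal to `n` separates the triangle from the segment `s`. -/
def separates (n : Pt) (a b c : Pt) (s : Seg) : Bool :=
  clears n (max (dot n s.1) (dot n s.2)) a b c ||
    (let m := max (dot n a) (max (dot n b) (dot n c))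
     above n m a [s.1, s.2] || above n m b [s.1, s.2])

/-- The plane is placed either at the highest level of the segment, with the triangle above it, or
at the highest level of the triangle, with the segment above it. Contact is tolerated at one of `a`,
`b`, as in the triangle move. -/
theorem eq_or_eq_of_separates {n a b c : Pt} {s : Seg} (h : separates n a b c s = true) {x : Space}
    (hx : x ∈ triangle a b c) (hs : x ∈ segment ℝ (realPt s.1) (realPt s.2)) :
    x ∈ ({realPt a, realPt b} : Set Space) := by
  rcases Bool.or_eq_true_iff.1 h with h | h
  · refine eq_or_eq_of_clears h hx ?_
    have hconv : Convex ℝ {y | dotR n y ≤ ((max (dot n s.1) (dot n s.2) : ℤ) : ℝ) / 4} :=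
      convex_halfSpace_le (dotR n).isLinear _
    refine hconv.segment_subset ?_ ?_ hs
    · rw [mem_ofPred_eq, dotR_realPt]
      have : ((dot n s.1 : ℤ) : ℝ) ≤ ((max (dot n s.1) (dot n s.2) : ℤ) : ℝ) := by
        exact_mod_cast le_max_left _ _
      linarith
    · rw [mem_ofPred_eq, dotR_realPt]
      have : ((dot n s.2 : ℤ) : ℝ) ≤ ((max (dot n s.1) (dot n s.2) : ℤ) : ℝ) := by
        exact_mod_cast le_max_right _ _
      linarith
  · have hm : dotR n x ≤ ((max (dot n a) (max (dot n b) (dot n c)) : ℤ) : ℝ) / 4 := by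
      have hconv : Convex ℝ
          {y | dotR n y ≤ ((max (dot n a) (max (dot n b) (dot n c)) : ℤ) : ℝ) / 4} :=
        convex_halfSpace_le (dotR n).isLinear _
      refine convexHull_min ?_ hconv hx
      have key : ∀ p : Pt, dot n p ≤ max (dot n a) (max (dot n b) (dot n c)) →
          realPt p ∈ {y | dotR n y ≤ ((max (dot n a) (max (dot n b) (dot n c)) : ℤ) : ℝ) / 4} := by
        intro p hp
        rw [mem_ofPred_eq, dotR_realPt]
        have : ((dot n p : ℤ) : ℝ) ≤ ((max (dot n a) (max (dot n b) (dot n c)) : ℤ) : ℝ) := by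
          exact_mod_cast hp
        linarith
      rintro y (rfl | rfl | rfl)
      · exact key a (le_max_left _ _)
      · exact key b ((le_max_left _ _).trans (le_max_right _ _))
      · exact key c ((le_max_right _ _).trans (le_max_right _ _))
    have hs' : x ∈ convexHull ℝ {y | ∃ p ∈ [s.1, s.2], realPt p = y} := by
      rw [← convexHull_pair] at hs
      refine convexHull_mono ?_ hs
      rintro y (rfl | rfl)
      exacts [⟨s.1, by simp, rfl⟩, ⟨s.2, by simp, rfl⟩]
    rcases Bool.or_eq_true_iff.1 h with h | h
    · exact Or.inl (eq_of_above h hs' hm)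
    · exact Or.inr (eq_of_above h hs' hm)

/-- Normal directions of planes that may separate a triangle from a segment. -/
def normals (a b c : Pt) (s : Seg) : List Pt :=
  (0, 1, 0) :: (1, 0, 0) :: (0, 0, 1) :: (1, 1, 0) :: (1, -1, 0) ::
  (let d := sub s.2 s.1
   let u := sub b a
   let v := sub c a
   [cross u v, cross v d, cross u d, cross (sub c b) d, cross u (0, 0, 1), cross v (0, 0, 1)])

/-- The triangle can be separated from the segment. -/
def avoids (a b c : Pt) (s : Seg) : Bool :=
  (normals a b c s).any fun n => separates n a b c s || separates (neg n) a b c s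

/-- The list of normals is only a supply of candidates; nothing is required of it, since any normal
that passes the test is itself a proof of separation. -/
theorem eq_or_eq_of_avoids {a b c : Pt} {s : Seg} (h : avoids a b c s = true) {x : Space}
    (hx : x ∈ triangle a b c) (hs : x ∈ segment ℝ (realPt s.1) (realPt s.2)) :
    x ∈ ({realPt a, realPt b} : Set Space) := by
  obtain ⟨n, -, hn⟩ := List.any_eq_true.1 h
  rcases Bool.or_eq_true_iff.1 hn with hn | hn <;> exact eq_or_eq_of_separates hn hx hs

/-- Cramer's rule: some component of the cross product is a nonzero minor, and eliminating from the
corresponding two coordinate equations kills both coefficients. The factors `4` undo the quarter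
units. -/
theorem linearIndependent_of_cross {a b c : Pt} (h : cross (sub b a) (sub c a) ≠ (0, 0, 0)) :
    LinearIndependent ℝ ![realPt b - realPt a, realPt c - realPt a] := by
  rw [LinearIndependent.pair_iff]
  intro s t hst
  have h0 := congrArg (fun x : Space => x 0) hst
  have h1 := congrArg (fun x : Space => x 1) hst
  have h2 := congrArg (fun x : Space => x 2) hst
  simp [realPt] at h0 h1 h2
  obtain ⟨a0, a1, a2⟩ := a
  obtain ⟨b0, b1, b2⟩ := b
  obtain ⟨c0, c1, c2⟩ := c
  simp only [cross, sub, ne_eq, Prod.mk.injEq, not_and_or] at h h0 h1 h2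
  have key : ∀ D : ℤ, D ≠ 0 → (∀ D' : ℝ, D' = D → s * D' = 0 ∧ t * D' = 0) → s = 0 ∧ t = 0 := by
    intro D hD hD'
    have : (D : ℝ) ≠ 0 := by exact_mod_cast hD
    obtain ⟨h1, h2⟩ := hD' D rfl
    exact ⟨(mul_eq_zero.1 h1).resolve_right this, (mul_eq_zero.1 h2).resolve_right this⟩
  rcases h with h | h | h
  · refine key _ h fun D' hD' => ?_
    rw [hD']
    push_cast
    constructor
    · linear_combination 4 * (c2 - a2 : ℝ) * h1 - 4 * (c1 - a1 : ℝ) * h2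
    · linear_combination 4 * (b1 - a1 : ℝ) * h2 - 4 * (b2 - a2 : ℝ) * h1
  · refine key _ h fun D' hD' => ?_
    rw [hD']
    push_cast
    constructor
    · linear_combination 4 * (c0 - a0 : ℝ) * h2 - 4 * (c2 - a2 : ℝ) * h0
    · linear_combination 4 * (b2 - a2 : ℝ) * h0 - 4 * (b0 - a0 : ℝ) * h2
  · refine key _ h fun D' hD' => ?_
    rw [hD']
    push_cast
    constructor
    · linear_combination 4 * (c1 - a1 : ℝ) * h0 - 4 * (c0 - a0 : ℝ) * h1
    · linear_combination 4 * (b0 - a0 : ℝ) * h1 - 4 * (b1 - a1 : ℝ) * h0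

/-! ### Cells -/

/-- The distance from the boundary of the square `[a, a + k] × [b, b + k]`. -/
noncomputable def depthIn (a b k : ℝ) (x : Space) : ℝ :=
  min (min (x 0 - a) (a + k - x 0)) (min (x 1 - b) (b + k - x 1))

/-- The open region over a square in which a move of the block on that square takes place. -/
def openCell (a b k : ℝ) : Set Space :=
  {x | 0 < depthIn a b k x ∧ |x 2 - 1 / 2| < 1 / 2 + 3 * depthIn a b k x}

/-- The closed region over a square. -/
def closedCell (a b k : ℝ) : Set Space :=
  {x | 0 ≤ depthIn a b k x ∧ |x 2 - 1 / 2| ≤ 1 / 2 + 3 * depthIn a b k x}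

theorem continuous_depthIn (a b k : ℝ) : Continuous (depthIn a b k) := by
  unfold depthIn
  fun_prop

theorem isOpen_openCell (a b k : ℝ) : IsOpen (openCell a b k) := by
  have h := continuous_depthIn a b k
  have h1 : IsOpen {x | 0 < depthIn a b k x} := isOpen_lt continuous_const h
  have h2 : IsOpen {x : Space | |x 2 - 1 / 2| < 1 / 2 + 3 * depthIn a b k x} :=
    isOpen_lt (by fun_prop) (by fun_prop)
  exact h1.inter h2

theorem isClosed_closedCell (a b k : ℝ) : IsClosed (closedCell a b k) := by
  have h := continuous_depthIn a b k
  have h1 : IsClosed {x | 0 ≤ depthIn a b k x} := isClosed_le continuous_const h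
  have h2 : IsClosed {x : Space | |x 2 - 1 / 2| ≤ 1 / 2 + 3 * depthIn a b k x} :=
    isClosed_le (by fun_prop) (by fun_prop)
  exact h1.inter h2

/-- The part of space that a move of a `k × k` block fixes for reasons other than its strands: the
complement of the cell of the block and, if `q` is set, the cell of the black tile in `(1, 1)`. -/
def frozen (k : ℕ) (q : Bool) : Set Space :=
  (openCell 0 0 k)ᶜ ∪ if q then closedCell 1 1 1 else ∅

theorem isClosed_frozen (k : ℕ) (q : Bool) : IsClosed (frozen k q) := by
  refine (isOpen_openCell _ _ _).isClosed_compl.union ?_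
  split_ifs
  exacts [isClosed_closedCell _ _ _, isClosed_empty]

/-- The half-spaces whose intersection is the cell of a `k × k` block. -/
def cellFaces (k : ℤ) : List (Pt × ℤ) :=
  [((1, 0, 0), 0), ((-1, 0, 0), -4 * k), ((0, 1, 0), 0), ((0, -1, 0), -4 * k),
    ((3, 0, -1), -4), ((3, 0, 1), 0), ((-3, 0, -1), -4 - 12 * k), ((-3, 0, 1), -12 * k),
    ((0, 3, -1), -4), ((0, 3, 1), 0), ((0, -3, -1), -4 - 12 * k), ((0, -3, 1), -12 * k)]

/-- Unfolding the minimum in `depthIn` describes the cell by four walls `t > 0` and eight faces `z <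
1 + 3t` and `-3t < z`, where `t` runs over the distances from the four sides. -/
theorem exists_face_of_notMem {k : ℕ} {x : Space} (hx : x ∉ openCell 0 0 k) :
    ∃ f ∈ cellFaces k, dotR f.1 x ≤ (f.2 : ℝ) / 4 := by
  by_contra! hcon
  apply hx
  simp only [cellFaces, List.forall_mem_cons, dotR_apply] at hcon
  push_cast at hcon
  obtain ⟨h1, h2, h3, h4, h5, h6, h7, h8, h9, h10, h11, h12, -⟩ := hcon
  have hd : 0 < depthIn 0 0 k x :=
    lt_min (lt_min (by linarith) (by linarith)) (lt_min (by linarith) (by linarith))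
  refine ⟨hd, ?_⟩
  have key : |x 2 - 1 / 2| - 1 / 2 < 3 * depthIn 0 0 k x := by
    rw [← div_lt_iff₀' (by norm_num)]
    refine lt_min (lt_min ?_ ?_) (lt_min ?_ ?_) <;>
    · rw [div_lt_iff₀' (by norm_num), sub_lt_iff_lt_add, abs_lt]
      constructor <;> linarith
  linarith

/-- Half-spaces that contain the cell of the tile in `(1, 1)`. -/
def tileFaces : List (Pt × ℤ) :=
  [((-1, 0, 0), -4), ((1, 0, 0), 8), ((0, -1, 0), -4), ((0, 1, 0), 8),
    ((-3, 0, 1), -8), ((-3, 0, -1), -12), ((3, 0, 1), 28), ((3, 0, -1), 24),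
    ((0, -3, 1), -8), ((0, -3, -1), -12), ((0, 3, 1), 28), ((0, 3, -1), 24),
    ((-3, -3, 2), -16), ((-3, -3, -2), -24), ((-3, 3, 2), 20), ((-3, 3, -2), 12),
    ((3, -3, 2), 20), ((3, -3, -2), 12), ((3, 3, 2), 56), ((3, 3, -2), 48)]

/-- After the four walls and the eight roof and floor faces, the last eight inequalities are sums of
two neighbouring faces, that is, planes through the ridges over the diagonals. They separate
triangles that no single face separates. -/
theorem le_of_mem_closedCell {x : Space} (hx : x ∈ closedCell 1 1 1) :
    ∀ f ∈ tileFaces, dotR f.1 x ≤ (f.2 : ℝ) / 4 := by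
  obtain ⟨h1, h2⟩ := hx
  have h3 := abs_le.1 h2
  have a1 : depthIn 1 1 1 x ≤ x 0 - 1 := (min_le_left _ _).trans (min_le_left _ _)
  have a2 : depthIn 1 1 1 x ≤ 1 + 1 - x 0 := (min_le_left _ _).trans (min_le_right _ _)
  have a3 : depthIn 1 1 1 x ≤ x 1 - 1 := (min_le_right _ _).trans (min_le_left _ _)
  have a4 : depthIn 1 1 1 x ≤ 1 + 1 - x 1 := (min_le_right _ _).trans (min_le_right _ _)
  obtain ⟨h4, h5⟩ := h3
  simp only [tileFaces, List.forall_mem_cons, dotR_apply]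
  push_cast
  refine ⟨?_, ?_, ?_, ?_, ?_, ?_, ?_, ?_, ?_, ?_, ?_, ?_, ?_, ?_, ?_, ?_, ?_, ?_, ?_, ?_, by simp⟩ <;>
    linarith

/-! ### Pushing strands to an apex -/

/-- The segment `(a, b)` may be pushed across the triangle to `c` in the complement of the frozen part
and of the segments `obs`. -/
def stepOK (k : ℕ) (q : Bool) (a b c : Pt) (obs : List Seg) : Bool :=
  decide (cross (sub b a) (sub c a) ≠ (0, 0, 0)) &&
  ((cellFaces k).all fun f => clears f.1 f.2 a b c) &&
  (!q || tileFaces.any fun f => clears f.1 f.2 a b c) &&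
  obs.all fun s => avoids a b c s

/-- The complement of the cell is a union of half-spaces, so the triangle has to clear every one of
them. The cell of the black tile is an intersection, so a single half-space containing it suffices.
-/
theorem deforms_of_stepOK {k : ℕ} {q : Bool} {a b c : Pt} {obs : List Seg}
    (h : stepOK k q a b c obs = true) :
    Deforms (frozen k q ∪ segSet obs) (segSet [(a, b)]) (segSet [(a, c), (c, b)]) := by
  simp only [stepOK, Bool.and_eq_true, decide_eq_true_eq, List.all_eq_true] at h
  obtain ⟨⟨⟨h1, h2⟩, h3⟩, h4⟩ := h
  have key := deforms_triangle ((isClosed_frozen k q).union (isClosed_segSet obs))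
    (linearIndependent_of_cross h1) (by
      rintro x ⟨(hx | hx) | hx, hT⟩
      · obtain ⟨f, hf, hfx⟩ := exists_face_of_notMem hx
        exact eq_or_eq_of_clears (h2 f hf) hT hfx
      · cases q with
        | false => simp at hx
        | true =>
          simp only [Bool.not_true, Bool.false_or, List.any_eq_true] at h3
          obtain ⟨f, hf, hf'⟩ := h3
          exact eq_or_eq_of_clears hf' hT (le_of_mem_closedCell (by simpa using hx) f hf)
      · obtain ⟨s, hs, hsx⟩ := mem_segSet.1 hx
        exact eq_or_eq_of_avoids (h4 s hs) hT hsx)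
  simpa using key

/-- The rest of a strand may be pushed to the apex `c`. -/
def tailOK (k : ℕ) (q : Bool) (c : Pt) (obs : List Seg) : List Pt → Bool
  | p :: r :: l => stepOK k q c r p (obs ++ edges (r :: l)) && tailOK k q c obs (r :: l)
  | _ => true

/-- A triangle move read backwards shortens the path from `c` through `p` to `r` to the segment from
`c` to `r`, with the later edges as obstacles; induction along the strand leaves one segment. -/
theorem deforms_of_tailOK {k : ℕ} {q : Bool} {c : Pt} {obs : List Seg} (p : Pt) (l : List Pt)
    (h : tailOK k q c obs (p :: l) = true) :
    Deforms (frozen k q ∪ segSet obs) (segSet ((c, p) :: edges (p :: l)))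
      (segSet [(c, (p :: l).getLast (by simp))]) := by
  induction l generalizing p with
  | nil => exact Deforms.refl _ _
  | cons r l ih =>
    simp only [tailOK, Bool.and_eq_true] at h
    have h1 := (deforms_of_stepOK h.1).symm
    rw [segSet_append, ← union_assoc] at h1
    have h2 := (h1.union (R := segSet (edges (r :: l))) subset_union_right).mono
      (C' := frozen k q ∪ segSet obs) subset_union_left
    have h3 := ih r h.2
    rw [List.getLast_cons (by simp)]
    refine Deforms.trans ?_ h3
    simp only [edges, segSet_cons, segSet_nil, union_empty, union_assoc] at h2 ⊢
    exact h2

/-- The strand with the given vertices may be pushed to the apex `c`. -/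
def coneOK (k : ℕ) (q : Bool) (c : Pt) (obs : List Seg) : List Pt → Bool
  | p :: r :: l => stepOK k q p r c (obs ++ edges (r :: l)) && tailOK k q c ((p, c) :: obs) (r :: l)
  | _ => false

/-- The strand with the same end points as the given one and a single further vertex `c`. -/
def tent (c : Pt) : List Pt → List Seg
  | p :: l => [(p, c), (c, (p :: l).getLast (by simp))]
  | [] => []

/-- The first edge is pushed out to the apex. The rest then issues from the apex and is shortened to
a segment, the new edge from `p` to `c` being one more obstacle. -/
theorem deforms_of_coneOK {k : ℕ} {q : Bool} {c : Pt} {obs : List Seg} {l : List Pt}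
    (h : coneOK k q c obs l = true) :
    Deforms (frozen k q ∪ segSet obs) (segSet (edges l)) (segSet (tent c l)) := by
  match l, h with
  | p :: r :: l, h =>
    simp only [coneOK, Bool.and_eq_true] at h
    have h1 := deforms_of_stepOK h.1
    rw [segSet_append, ← union_assoc] at h1
    have h2 := (h1.union (R := segSet (edges (r :: l))) subset_union_right).mono
      (C' := frozen k q ∪ segSet obs) subset_union_left
    have h3 := deforms_of_tailOK r l h.2
    have h4 := (h3.union (R := segSet [(p, c)]) (by
      intro x hx
      right
      simp only [segSet_cons, segSet_nil, union_empty] at hx ⊢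
      exact Or.inl hx)).mono (C' := frozen k q ∪ segSet obs) (by
        rw [segSet_cons]
        exact union_subset_union_right _ subset_union_right)
    simp only [edges, tent, segSet_cons, segSet_nil, union_empty] at h2 h4 ⊢
    refine h2.trans ?_
    rw [List.getLast_cons (by simp), union_assoc]
    rw [union_comm (segment ℝ (realPt c) (realPt ((r :: l).getLast _))),
      union_comm (_ ∪ _) (segment ℝ (realPt p) (realPt c))] at h4
    exact h4

/-- Strands with given apexes may be pushed to their apexes one after the other. -/
def conesOK (k : ℕ) (q : Bool) : List Seg → List (List Pt × Pt) → Bool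
  | _, [] => true
  | obs, (l, c) :: L =>
    coneOK k q c (obs ++ L.flatMap fun s => edges s.1) l && conesOK k q (obs ++ tent c l) L

theorem Deforms.union_left {X : Type*} [TopologicalSpace X] {C R A B : Set X}
    (h : Deforms (C ∪ R) A B) : Deforms C (R ∪ A) (R ∪ B) := by
  rw [union_comm R, union_comm R]
  exact (h.union subset_union_right).mono subset_union_left

/-- While one strand moves, the strands still to come stay in their original position and those
already treated in their final one; both are obstacles. -/
theorem deforms_of_conesOK {k : ℕ} {q : Bool} {obs : List Seg} {L : List (List Pt × Pt)}
    (h : conesOK k q obs L = true) :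
    Deforms (frozen k q ∪ segSet obs) (segSet (L.flatMap fun s => edges s.1))
      (segSet (L.flatMap fun s => tent s.2 s.1)) := by
  induction L generalizing obs with
  | nil => exact Deforms.refl _ _
  | cons s L ih =>
    obtain ⟨l, c⟩ := s
    simp only [conesOK, Bool.and_eq_true] at h
    have h1 := deforms_of_coneOK h.1
    rw [segSet_append, ← union_assoc] at h1
    have h3 := ih h.2
    rw [segSet_append, ← union_assoc] at h3
    have h2 := h1.union_left
    rw [union_comm (segSet _) (segSet (edges l)), union_comm (segSet _) (segSet (tent c l))] at h2
    rw [List.flatMap_cons, List.flatMap_cons, segSet_append, segSet_append]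
    exact h2.trans h3.union_left

open Side VertexKind Tile

/-! ### Tiles as lists of segments -/

/-- The segments of the arcs of a tile. -/
def Tile.segs : Tile → List Seg
  | t0 => []
  | t1 => [((2, 0, 2), (4, 2, 2))]
  | t2 => [((4, 2, 2), (2, 4, 2))]
  | t3 => [((2, 4, 2), (0, 2, 2))]
  | t4 => [((0, 2, 2), (2, 0, 2))]
  | t5 => [((2, 0, 2), (2, 4, 2))]
  | t6 => [((0, 2, 2), (4, 2, 2))]
  | t7 => [((2, 0, 2), (4, 2, 2)), ((0, 2, 2), (2, 4, 2))]
  | t8 => [((0, 2, 2), (2, 0, 2)), ((4, 2, 2), (2, 4, 2))]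
  | t9 => [((2, 0, 2), (2, 2, 3)), ((2, 2, 3), (2, 4, 2)),
      ((0, 2, 2), (2, 2, 1)), ((2, 2, 1), (4, 2, 2))]
  | t10 => [((2, 0, 2), (2, 2, 1)), ((2, 2, 1), (2, 4, 2)),
      ((0, 2, 2), (2, 2, 3)), ((2, 2, 3), (4, 2, 2))]
  | vertex _ => []

theorem Tile.tameArcs_eq (t : Tile) : t.tameArcs = segSet t.segs := by
  cases t <;>
    simp [Tile.tameArcs, Tile.segs, straightArc, bentArc, Side.point, realPt, union_assoc] <;>
    norm_num

/-- The segments of the tile `t` in position `(i, j)`. -/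
def segsAt (i j : ℕ) (t : Tile) : List Seg :=
  t.segs.map fun s => ((s.1.1 + 4 * i, s.1.2.1 + 4 * j, s.1.2.2),
    (s.2.1 + 4 * i, s.2.2.1 + 4 * j, s.2.2.2))

/-- The arcs of the tile `t` in position `(i, j)`. -/
def arcsAt (i j : ℕ) (t : Tile) : Set Space := (fun x => x + corner i j) '' t.tameArcs

theorem arcsAt_eq (i j : ℕ) (t : Tile) : arcsAt i j t = segSet (segsAt i j t) := by
  have hpt : ∀ p : Pt, realPt (p.1 + 4 * i, p.2.1 + 4 * j, p.2.2) = corner i j + realPt p := by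
    intro p
    ext l
    fin_cases l <;> simp [realPt, corner] <;> ring
  rw [arcsAt, Tile.tameArcs_eq, segsAt]
  induction t.segs with
  | nil => simp
  | cons s l ih =>
    rw [segSet_cons, image_union, ih, List.map_cons, segSet_cons, hpt, hpt,
      ← segment_translate_image]
    simp only [add_comm]

/-- The segments of a `2 × 2` block. -/
def segs2 (a b c d : Tile) : List Seg := segsAt 0 0 a ++ segsAt 0 1 b ++ segsAt 1 0 c ++ segsAt 1 1 d

/-- The segments of a `3 × 3` block. -/
def segs3 (a b c d e f g h i : Tile) : List Seg :=
  segsAt 0 0 a ++ segsAt 0 1 b ++ segsAt 0 2 c ++ segsAt 1 0 d ++ segsAt 1 1 e ++ segsAt 1 2 f ++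
    segsAt 2 0 g ++ segsAt 2 1 h ++ segsAt 2 2 i

theorem tamePart_eq_arcsAt {n : ℕ} (M : Mosaic n) :
    M.tamePart = ⋃ (i : Fin n) (j : Fin n), arcsAt i j (M i j) := rfl

theorem tamePart_two (a b c d : Tile) :
    Mosaic.tamePart !![a, b; c, d] =
      arcsAt 0 0 a ∪ arcsAt 0 1 b ∪ arcsAt 1 0 c ∪ arcsAt 1 1 d := by
  rw [tamePart_eq_arcsAt]
  ext x
  simp only [mem_iUnion, Fin.exists_fin_two, mem_union]
  simp [or_assoc]

theorem tamePart_three (a b c d e f g h i : Tile) :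
    Mosaic.tamePart !![a, b, c; d, e, f; g, h, i] =
      arcsAt 0 0 a ∪ arcsAt 0 1 b ∪ arcsAt 0 2 c ∪ arcsAt 1 0 d ∪ arcsAt 1 1 e ∪ arcsAt 1 2 f ∪
        arcsAt 2 0 g ∪ arcsAt 2 1 h ∪ arcsAt 2 2 i := by
  rw [tamePart_eq_arcsAt]
  ext x
  simp only [mem_iUnion, Fin.exists_fin_succ, mem_union]
  simp [or_assoc]

/-! ### Strands of a block -/

/-- Picks a segment with end point `p` from a list. Returns the other end point and the remaining
segments. -/
def pick (p : Pt) : List Seg → Option (Pt × List Seg)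
  | [] => none
  | s :: l =>
    if s.1 = p then some (s.2, l) else
    if s.2 = p then some (s.1, l) else
    match pick p l with
    | none => none
    | some (r, l') => some (r, s :: l')

theorem segSet_of_pick {p r : Pt} {l l' : List Seg} (h : pick p l = some (r, l')) :
    segSet l = segSet [(p, r)] ∪ segSet l' := by
  induction l generalizing l' with
  | nil => simp [pick] at h
  | cons s l ih =>
    rw [pick] at h
    split_ifs at h with h1 h2
    · simp only [Option.some.injEq, Prod.mk.injEq] at h
      obtain ⟨rfl, rfl⟩ := h
      simp [← h1]
    · simp only [Option.some.injEq, Prod.mk.injEq] at h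
      obtain ⟨rfl, rfl⟩ := h
      simp [← h2, segment_symm]
    · split at h
      · simp at h
      · rename_i r' l'' hp
        simp only [Option.some.injEq, Prod.mk.injEq] at h
        obtain ⟨rfl, rfl⟩ := h
        rw [segSet_cons, ih hp, segSet_cons s, union_left_comm]

/-- The vertices after `p` of the strand that starts at `p` and ends at a point of `stops`, or where
there is no further segment, together with the segments that are not on this strand. -/
def trace (stops : List Pt) : ℕ → Pt → List Seg → List Pt × List Seg
  | 0, _, l => ([], l)
  | n + 1, p, l =>
    match pick p l with
    | none => ([], l)
    | some (r, l') =>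
      if r ∈ stops then ([r], l') else (r :: (trace stops n r l').1, (trace stops n r l').2)

/-- Tracing merely regroups the segments, so this holds for any stops and any bound `n` on the
number of steps. Whether the strand found is the intended one is left to the certificate check. -/
theorem segSet_of_trace (stops : List Pt) (n : ℕ) (p : Pt) (l : List Seg) :
    segSet l = segSet (edges (p :: (trace stops n p l).1)) ∪ segSet (trace stops n p l).2 := by
  induction n generalizing p l with
  | zero => simp [trace, edges]
  | succ n ih =>
    rw [trace]
    split
    · simp [edges]
    · rename_i r l' h
      rw [segSet_of_pick h]
      split_ifs
      · simp [edges]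
      · rw [ih r l']
        simp [edges, union_assoc]

/-- Decomposes a list of segments into strands with given starting points, each together with an apex,
and remaining segments. -/
def resolve (stops : List Pt) : List (Pt × Pt) → List Seg → List (List Pt × Pt) × List Seg
  | [], l => ([], l)
  | (p, c) :: L, l =>
    ((p :: (trace stops 16 p l).1, c) :: (resolve stops L (trace stops 16 p l).2).1,
      (resolve stops L (trace stops 16 p l).2).2)

theorem segSet_of_resolve (stops : List Pt) (L : List (Pt × Pt)) (l : List Seg) :
    segSet l = segSet ((resolve stops L l).1.flatMap fun s => edges s.1) ∪
      segSet (resolve stops L l).2 := by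
  induction L generalizing l with
  | nil => simp [resolve]
  | cons s L ih =>
    rw [segSet_of_trace stops 16 s.1 l, ih (trace stops 16 s.1 l).2]
    simp [resolve, union_assoc]

/-- Two blocks with lists of segments `A` and `B` are related by pushing strands to apexes, in the
complement of the frozen part and of the segments `fixed`. -/
def moveOK (k : ℕ) (q : Bool) (stops : List Pt) (cert : List (Pt × Pt)) (fixed A B : List Seg) :
    Bool :=
  conesOK k q ((resolve stops cert A).2 ++ fixed) (resolve stops cert A).1 &&
  conesOK k q ((resolve stops cert B).2 ++ fixed) (resolve stops cert B).1 &&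
  decide (((resolve stops cert A).1.flatMap fun s => tent s.2 s.1) =
    (resolve stops cert B).1.flatMap fun s => tent s.2 s.1) &&
  decide ((resolve stops cert A).2 = (resolve stops cert B).2)

/-- Both blocks deform to the same tents with the same remaining segments, so one deformation is
composed with the inverse of the other. -/
theorem deforms_of_moveOK {k : ℕ} {q : Bool} {stops : List Pt} {cert : List (Pt × Pt)}
    {fixed A B : List Seg} (h : moveOK k q stops cert fixed A B = true) :
    Deforms (frozen k q ∪ segSet fixed) (segSet A) (segSet B) := by
  simp only [moveOK, Bool.and_eq_true, decide_eq_true_eq] at h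
  obtain ⟨⟨⟨hA, hB⟩, ht⟩, hr⟩ := h
  have h1 := deforms_of_conesOK hA
  have h2 := deforms_of_conesOK hB
  rw [ht, hr] at h1
  have h3 := h1.trans h2.symm
  rw [segSet_append, union_comm (segSet _) (segSet fixed), ← union_assoc] at h3
  have h4 := h3.union_left
  rw [segSet_of_resolve stops cert A, segSet_of_resolve stops cert B, hr, union_comm (segSet _),
    union_comm (segSet (List.flatMap _ _))]
  exact h4

/-- The tile is black. -/
def Tile.isVertex : Tile → Bool
  | vertex _ => true
  | _ => false

/-- The side centres of the central tile of a `3 × 3` block. -/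
def innerStops : List Pt := [(4, 6, 2), (6, 4, 2), (8, 6, 2), (6, 8, 2)]

/-- The arcs that may lie in the outer corner of the NE, SW and SE tile of a block. -/
def cornerNE (k : ℕ) : List Seg := segsAt 0 (k - 1) t3

def cornerSW (k : ℕ) : List Seg := segsAt (k - 1) 0 t1

def cornerSE (k : ℕ) : List Seg := segsAt (k - 1) (k - 1) t2

/-- The starting point of a strand that leaves a block through the NW tile. -/
def startNW (a : Tile × Tile) : Pt := if a.1 = t5 then (2, 0, 2) else (0, 2, 2)

/-- Elements of `endNW`, `endNE`, `endSE`, `crossings` as lists. -/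
def endNWList : List (Tile × Tile) := [(t5, t1), (t3, t6)]

def endNEList : List (Tile × Tile) := [(t5, t2), (t4, t6)]

def endSEList : List (Tile × Tile) := [(t3, t5), (t6, t1)]

def crossingList : List Tile := [t9, t10]

/-- The triples related by `Passes`. -/
def passesList : List (Tile × (Tile × Tile) × (Tile × Tile)) :=
  [(t9, (t5, t9), (t6, t9)), (t9, (t5, t9), (t6, t10)), (t9, (t5, t10), (t6, t9)),
    (t10, (t5, t9), (t6, t10)), (t10, (t5, t10), (t6, t9)), (t10, (t5, t10), (t6, t10)),
    (vertex four, (t5, t10), (t6, t9)), (vertex four, (t5, t9), (t6, t10)),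
    (vertex horizontal, (t5, t9), (t0, t5)), (vertex horizontal, (t5, t10), (t0, t5)),
    (vertex vertical, (t0, t6), (t6, t9)), (vertex vertical, (t0, t6), (t6, t10))]

theorem mem_passesList {x : Tile} {h v : Tile × Tile} (hp : Passes x h v) :
    (x, h, v) ∈ passesList := by
  cases hp with
  | crossing hx hy hz hxyz =>
    rcases hx with rfl | rfl <;> rcases hy with rfl | rfl <;> rcases hz with rfl | rfl <;>
      -- Two of the eight choices, those with `y = z ≠ x`, are the cyclic configurations that the
      -- hypothesis excludes.
      first | decide | exact absurd (hxyz rfl) (by decide)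
  | vertexOver => decide
  | vertexUnder => decide
  | horizontal hy => rcases hy with rfl | rfl <;> decide
  | vertical hz => rcases hz with rfl | rfl <;> decide

/-- Starting points and apexes for a strand that starts in `p` and is pushed across the centre of a
`3 × 3` block: the moving strand, and the pieces of the other strands that it crosses. -/
def acrossCert (p : Pt) (h v : Tile × Tile) : List (Pt × Pt) :=
  -- If `h.2 = v.2`, the moving strand is over one strand and under the other, and stays at the
  -- middle height `1/2`. Otherwise it passes over or under everything. The heights `7/2` and `-5/2`
  -- then clear the cell of the central tile, which reaches from `-3/2` to `5/2` over the centre,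
  -- and remain in the cell of the block, which reaches from `-9/2` to `11/2`.
  (p, (6, 6, if h.2 = v.2 then 2 else if h.2 = t10 ∨ v.2 = t9 then 14 else -10)) ::
  -- A crossed strand is bent away from the moving one, to height `1` if it lies over it and to
  -- height `0` if it lies under it.
  ((if h.2 = t9 then [((6, 0, 2), (6, 2, 4)), ((6, 12, 2), (6, 10, 4))] else []) ++
  (if h.2 = t10 then [((6, 0, 2), (6, 2, 0)), ((6, 12, 2), (6, 10, 0))] else []) ++
  (if v.2 = t10 then [((0, 6, 2), (2, 6, 4)), ((12, 6, 2), (10, 6, 4))] else []) ++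
  (if v.2 = t9 then [((0, 6, 2), (2, 6, 0)), ((12, 6, 2), (10, 6, 0))] else []))

/-- Starting points and apexes for the two strands that start in the NW tile of a `2 × 2` block, where
`x` tells which of them lies above. -/
def crossingCert (x : Tile) : List (Pt × Pt) :=
  -- The upper strand goes to height `3/2` and the lower one to `-1/2`, both over the common corner
  -- of the four tiles.
  if x = t9 then [((2, 0, 2), (4, 4, 6)), ((0, 2, 2), (4, 4, -2))]
  else [((0, 2, 2), (4, 4, 6)), ((2, 0, 2), (4, 4, -2))]

/-! ### Certificates for the basic moves -/

/-- All arcs lie at height `1/2`. The apex at height `3/4` makes every triangle of the fan meet that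
plane only in an edge of the strand. The optional corner arcs are fixed obstacles, present in all
cases, so they need not be distinguished. -/
theorem planar_one_ok : moveOK 2 false [] [((0, 2, 2), (4, 4, 3))]
    (cornerNE 2 ++ cornerSW 2 ++ cornerSE 2) (segs2 t4 t0 t0 t0) (segs2 t7 t1 t3 t4) = true := by
  decide +kernel

theorem planar_two_ok : (endNWList.all fun a => endNEList.all fun b =>
    moveOK 2 false [] [(startNW a, (4, 4, 3))] (cornerSW 2 ++ cornerSE 2)
      (segs2 a.1 b.1 t0 t0) (segs2 a.2 b.2 t3 t4)) = true := by
  decide +kernel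

theorem planar_three_ok : (endNWList.all fun a => endSEList.all fun d =>
    moveOK 2 false [] [(startNW a, (4, 4, 3))] (cornerNE 2 ++ cornerSW 2)
      (segs2 a.1 t1 t0 d.1) (segs2 a.2 t0 t3 d.2)) = true := by
  decide +kernel

/-- The two strands keep their vertical order through the move. Pushing the upper one to the high
apex and the lower one to the low apex therefore gives the same tents in both blocks; the same
certificate serves move II. -/
theorem slide_adjacent_ok : (crossingList.all fun x =>
    moveOK 2 false [] (crossingCert x) (cornerSW 2 ++ cornerSE 2)
      (segs2 x t8 t3 t4) (segs2 t7 x.mirror t3 t4)) = true := by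
  decide +kernel

theorem slide_opposite_ok : (crossingList.all fun x =>
    moveOK 2 false [] (crossingCert x) (cornerNE 2 ++ cornerSW 2)
      (segs2 x t1 t3 t7) (segs2 t7 t1 t3 x)) = true := by
  decide +kernel

/-- There is only one strand, traced from the end that enters the kink on its overpass and pushed to
the high apex. -/
theorem reidemeister_one_ok : (crossingList.all fun x =>
    moveOK 2 false [] [(crossingCert x).head!] (cornerNE 2 ++ cornerSW 2 ++ cornerSE 2)
      (segs2 t4 t0 t0 t0) (segs2 x t1 t3 t4)) = true := by
  decide +kernel

theorem reidemeister_two_adjacent_ok : (crossingList.all fun x =>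
    moveOK 2 false [] (crossingCert x) (cornerSW 2 ++ cornerSE 2)
      (segs2 t7 t8 t3 t4) (segs2 x x t3 t4)) = true := by
  decide +kernel

theorem reidemeister_two_opposite_ok : (crossingList.all fun x =>
    moveOK 2 false [] (crossingCert x) (cornerNE 2 ++ cornerSW 2)
      (segs2 t7 t1 t3 t7) (segs2 x t1 t3 x.mirror)) = true := by
  decide +kernel

/-- Crossed strands are cut at the sides of the central tile. Its arcs, if any, are thus left among
the remaining segments and act as obstacles, while a black tile contributes its whole cell. -/
theorem across_one_ok : (passesList.all fun p =>
    moveOK 3 p.1.isVertex innerStops (acrossCert (0, 2, 2) p.2.1 p.2.2)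
      (cornerNE 3 ++ cornerSW 3 ++ cornerSE 3)
      (segs3 t4 p.2.2.1 t0 p.2.1.1 p.1 p.2.1.1 t0 p.2.2.1 t0)
      (segs3 t7 p.2.2.2 t1 p.2.1.2 p.1 p.2.1.2 t3 p.2.2.2 t4)) = true := by
  decide +kernel

theorem across_two_ok : (passesList.all fun p => endNWList.all fun a => endNEList.all fun b =>
    moveOK 3 p.1.isVertex innerStops (acrossCert (startNW a) p.2.1 p.2.2)
      (cornerSW 3 ++ cornerSE 3)
      (segs3 a.1 p.2.2.2 b.1 p.2.1.1 p.1 p.2.1.1 t0 p.2.2.1 t0)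
      (segs3 a.2 p.2.2.1 b.2 p.2.1.2 p.1 p.2.1.2 t3 p.2.2.2 t4)) = true := by
  decide +kernel

theorem across_three_ok : (passesList.all fun p => endNWList.all fun a => endSEList.all fun d =>
    moveOK 3 p.1.isVertex innerStops (acrossCert (startNW a) p.2.1 p.2.2)
      (cornerNE 3 ++ cornerSW 3)
      (segs3 a.1 p.2.2.2 t1 p.2.1.1 p.1 p.2.1.2 t0 p.2.2.1 d.1)
      (segs3 a.2 p.2.2.1 t0 p.2.1.2 p.1 p.2.1.1 t3 p.2.2.2 d.2)) = true := by
  decide +kernel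

/-! ### Deformations of mosaics -/

/-- The part of space that is fixed in deformations of a mosaic: the complement of the cell of the
mosaic and the closed cells of the black tiles. -/
def Mosaic.frozenPart {n : ℕ} (M : Mosaic n) : Set Space :=
  (openCell 0 0 n)ᶜ ∪ {x | ∃ (i j : Fin n) (k : VertexKind), M i j = vertex k ∧ x ∈ closedCell i j 1}

/-- The mosaics have the same black tiles and the same connection points on the boundary, and a
homeomorphism of space supported in the cell of the mosaics, away from black tiles, carries the arcs
of `M` to those of `N`. -/
structure CellDeform {n : ℕ} (M N : Mosaic n) : Prop where
  vertex_iff : ∀ i j k, M i j = vertex k ↔ N i j = vertex k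
  sides_iff : ∀ i j s, OnBoundary i j s → (s ∈ (M i j).sides ↔ s ∈ (N i j).sides)
  deforms : Deforms M.frozenPart M.tamePart N.tamePart

theorem frozenPart_congr {n : ℕ} {M N : Mosaic n}
    (h : ∀ i j k, M i j = vertex k ↔ N i j = vertex k) : M.frozenPart = N.frozenPart := by
  simp only [Mosaic.frozenPart, h]

namespace CellDeform

variable {n : ℕ} {M N P : Mosaic n}

theorem refl (M : Mosaic n) : CellDeform M M :=
  ⟨fun _ _ _ => Iff.rfl, fun _ _ _ _ => Iff.rfl, Deforms.refl _ _⟩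

theorem symm (h : CellDeform M N) : CellDeform N M :=
  ⟨fun i j k => (h.vertex_iff i j k).symm, fun i j s hs => (h.sides_iff i j s hs).symm, by
    rw [← frozenPart_congr h.vertex_iff]
    exact h.deforms.symm⟩

theorem trans (h : CellDeform M N) (h' : CellDeform N P) : CellDeform M P :=
  ⟨fun i j k => (h.vertex_iff i j k).trans (h'.vertex_iff i j k),
    fun i j s hs => (h.sides_iff i j s hs).trans (h'.sides_iff i j s hs),
    h.deforms.trans (by
      rw [frozenPart_congr h.vertex_iff]
      exact h'.deforms)⟩

end CellDeform

theorem Deforms.image {X : Type*} [TopologicalSpace X] {C A B : Set X} (h : Deforms C A B)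
    (φ : X ≃ₜ X) : Deforms (φ '' C) (φ '' A) (φ '' B) := by
  obtain ⟨f, hf, rfl⟩ := h
  refine ⟨(φ.symm.trans f).trans φ, ?_, ?_⟩
  · rintro _ ⟨x, hx, rfl⟩
    simp [hf x hx]
  · rw [← image_comp, ← image_comp]
    exact image_congr fun x _ => by simp

/-- Conjugation by a symmetry. One inclusion between the frozen parts is enough, because fixing more
points is the stronger condition. -/
theorem Deforms.transport {n : ℕ} {M N M' N' : Mosaic n} (φ : Space ≃ₜ Space)
    (h : Deforms M.frozenPart M.tamePart N.tamePart) (hM : φ '' M.tamePart = M'.tamePart)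
    (hN : φ '' N.tamePart = N'.tamePart) (hfr : ∀ x, φ x ∈ M'.frozenPart → x ∈ M.frozenPart) :
    Deforms M'.frozenPart M'.tamePart N'.tamePart := by
  rw [← hM, ← hN]
  refine (h.image φ).mono fun x hx => ⟨φ.symm x, hfr _ (by simpa using hx), by simp⟩

/-! ### Symmetries -/

/-- The quarter turn of the square of side length `n`. -/
noncomputable def turn (n : ℝ) : Space ≃ₜ Space where
  toFun x := !₂[x 1, n - x 0, x 2]
  invFun x := !₂[n - x 1, x 0, x 2]
  left_inv x := by ext i; fin_cases i <;> simp
  right_inv x := by ext i; fin_cases i <;> simp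
  continuous_toFun := by
    refine (PiLp.continuous_toLp 2 _).comp (continuous_pi fun i => ?_)
    fin_cases i <;> simp <;> fun_prop
  continuous_invFun := by
    refine (PiLp.continuous_toLp 2 _).comp (continuous_pi fun i => ?_)
    fin_cases i <;> simp <;> fun_prop

/-- The half turn about the NW–SE diagonal at height `1 / 2`. -/
noncomputable def halfTurn : Space ≃ₜ Space where
  toFun x := !₂[x 1, x 0, 1 - x 2]
  invFun x := !₂[x 1, x 0, 1 - x 2]
  left_inv x := by ext i; fin_cases i <;> simp
  right_inv x := by ext i; fin_cases i <;> simp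
  continuous_toFun := by
    refine (PiLp.continuous_toLp 2 _).comp (continuous_pi fun i => ?_)
    fin_cases i <;> simp <;> fun_prop
  continuous_invFun := by
    refine (PiLp.continuous_toLp 2 _).comp (continuous_pi fun i => ?_)
    fin_cases i <;> simp <;> fun_prop

/-- The reflection at the plane of height `1 / 2`. -/
noncomputable def reflection : Space ≃ₜ Space where
  toFun x := !₂[x 0, x 1, 1 - x 2]
  invFun x := !₂[x 0, x 1, 1 - x 2]
  left_inv x := by ext i; fin_cases i <;> simp
  right_inv x := by ext i; fin_cases i <;> simp
  continuous_toFun := by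
    refine (PiLp.continuous_toLp 2 _).comp (continuous_pi fun i => ?_)
    fin_cases i <;> simp <;> fun_prop
  continuous_invFun := by
    refine (PiLp.continuous_toLp 2 _).comp (continuous_pi fun i => ?_)
    fin_cases i <;> simp <;> fun_prop

theorem turn_apply (n : ℝ) (x : Space) : turn n x = !₂[x 1, n - x 0, x 2] := rfl

theorem halfTurn_apply (x : Space) : halfTurn x = !₂[x 1, x 0, 1 - x 2] := rfl

theorem reflection_apply (x : Space) : reflection x = !₂[x 0, x 1, 1 - x 2] := rfl

theorem image_segment_of_affine {f : Space → Space}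
    (hf : ∀ (a b : Space) (s t : ℝ), s + t = 1 → f (s • a + t • b) = s • f a + t • f b)
    (a b : Space) : f '' segment ℝ a b = segment ℝ (f a) (f b) := by
  ext x
  constructor
  · rintro ⟨_, ⟨s, t, hs, ht, hst, rfl⟩, rfl⟩
    exact ⟨s, t, hs, ht, hst, (hf a b s t hst).symm⟩
  · rintro ⟨s, t, hs, ht, hst, rfl⟩
    exact ⟨_, ⟨s, t, hs, ht, hst, rfl⟩, hf a b s t hst⟩

theorem turn_segment (n : ℝ) (a b : Space) :
    turn n '' segment ℝ a b = segment ℝ (turn n a) (turn n b) := by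
  refine image_segment_of_affine (fun a b s t hst => ?_) a b
  ext i
  fin_cases i <;> simp [turn_apply]
  linear_combination (-n) * hst

theorem halfTurn_segment (a b : Space) :
    halfTurn '' segment ℝ a b = segment ℝ (halfTurn a) (halfTurn b) := by
  refine image_segment_of_affine (fun a b s t hst => ?_) a b
  ext i
  fin_cases i <;> simp [halfTurn_apply]
  linear_combination -hst

theorem reflection_segment (a b : Space) :
    reflection '' segment ℝ a b = segment ℝ (reflection a) (reflection b) := by
  refine image_segment_of_affine (fun a b s t hst => ?_) a b
  ext i
  fin_cases i <;> simp [reflection_apply]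
  linear_combination -hst

theorem straightArc_comm (s t : Side) : straightArc s t = straightArc t s := segment_symm _ _ _

theorem bentArc_comm (s t : Side) (z : ℝ) : bentArc s t z = bentArc t s z := by
  rw [bentArc, union_comm, segment_symm ℝ s.point, segment_symm ℝ _ t.point, bentArc]

/-- The side that becomes the side `s` in a quarter turn. -/
def Side.unturn : Side → Side
  | north => west
  | east => north
  | south => east
  | west => south

/-- The side that becomes the side `s` in the diagonal flip. -/
def Side.unflip : Side → Side
  | north => west
  | west => north
  | south => east
  | east => south

/-- The connection data that become `k` in a quarter turn or in the diagonal flip. -/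
def VertexKind.unturn : VertexKind → VertexKind
  | horizontal => vertical
  | vertical => horizontal
  | four => four

theorem turn_point (s : Side) : turn 1 s.unturn.point = s.point := by
  cases s <;> ext i <;> fin_cases i <;> simp [turn_apply, Side.unturn, Side.point] <;> norm_num

theorem halfTurn_point (s : Side) : halfTurn s.unflip.point = s.point := by
  cases s <;> ext i <;> fin_cases i <;> simp [halfTurn_apply, Side.unflip, Side.point] <;> norm_num

theorem reflection_point (s : Side) : reflection s.point = s.point := by
  cases s <;> ext i <;> fin_cases i <;> simp [reflection_apply, Side.point] <;> norm_num

theorem turn_straightArc (s t : Side) :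
    turn 1 '' straightArc s.unturn t.unturn = straightArc s t := by
  rw [straightArc, turn_segment, turn_point, turn_point, straightArc]

theorem turn_bentArc (s t : Side) (z : ℝ) :
    turn 1 '' bentArc s.unturn t.unturn z = bentArc s t z := by
  have : turn 1 !₂[1 / 2, 1 / 2, z] = !₂[1 / 2, 1 / 2, z] := by
    ext i
    fin_cases i <;> simp [turn_apply]
    norm_num
  rw [bentArc, image_union, turn_segment, turn_segment, turn_point, turn_point, this, bentArc]

theorem halfTurn_straightArc (s t : Side) :
    halfTurn '' straightArc s.unflip t.unflip = straightArc s t := by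
  rw [straightArc, halfTurn_segment, halfTurn_point, halfTurn_point, straightArc]

theorem halfTurn_bentArc (s t : Side) (z : ℝ) :
    halfTurn '' bentArc s.unflip t.unflip (1 - z) = bentArc s t z := by
  have : halfTurn !₂[1 / 2, 1 / 2, 1 - z] = !₂[1 / 2, 1 / 2, z] := by
    ext i
    fin_cases i <;> simp [halfTurn_apply]
  rw [bentArc, image_union, halfTurn_segment, halfTurn_segment, halfTurn_point, halfTurn_point,
    this, bentArc]

theorem reflection_straightArc (s t : Side) : reflection '' straightArc s t = straightArc s t := by
  rw [straightArc, reflection_segment, reflection_point, reflection_point]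

theorem reflection_bentArc (s t : Side) (z : ℝ) :
    reflection '' bentArc s t (1 - z) = bentArc s t z := by
  have : reflection !₂[1 / 2, 1 / 2, 1 - z] = !₂[1 / 2, 1 / 2, z] := by
    ext i
    fin_cases i <;> simp [reflection_apply]
  rw [bentArc, image_union, reflection_segment, reflection_segment, reflection_point,
    reflection_point, this, bentArc]

set_option linter.unusedSimpArgs false in
theorem Tile.tameArcs_rotate (t : Tile) : t.rotate.tameArcs = turn 1 '' t.tameArcs := by
  have h1 := turn_straightArc north west
  have h2 := turn_straightArc west south
  have h3 := turn_straightArc south east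
  have h4 := turn_straightArc east north
  have h5 := turn_straightArc north south
  have h6 := turn_straightArc east west
  have h7 := turn_straightArc east south
  have h8 := fun z => turn_bentArc north south z
  have h9 := fun z => turn_bentArc east west z
  simp only [Side.unturn, straightArc_comm south west, straightArc_comm east south,
    straightArc_comm east north, straightArc_comm west north, straightArc_comm east west,
    straightArc_comm south north, bentArc_comm east west, bentArc_comm south north] at *
  cases t <;> simp only [Tile.rotate, Tile.tameArcs, image_union, image_empty,
    straightArc_comm south west, straightArc_comm east south,
    straightArc_comm east north, straightArc_comm west north, straightArc_comm east west,
    straightArc_comm south north, bentArc_comm east west, bentArc_comm south north, *]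
  case t8 => exact union_comm _ _
  case t9 => exact union_comm _ _
  case t10 => exact union_comm _ _
  case vertex k => cases k <;> simp [Tile.rotate, Tile.tameArcs]

-- The half turn exchanges the W–E and N–S strands of a crossing and reverses heights; the two
-- effects cancel, so crossing tiles are carried to themselves.
set_option linter.unusedSimpArgs false in
theorem Tile.tameArcs_flip (t : Tile) : t.flip.tameArcs = halfTurn '' t.tameArcs := by
  have h1 := halfTurn_straightArc north west
  have h2 := halfTurn_straightArc south east
  have h3 := halfTurn_straightArc east north
  have h4 := halfTurn_straightArc west south
  have h5 := halfTurn_straightArc north south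
  have h6 := halfTurn_straightArc east west
  have h8 := halfTurn_bentArc north south (1 / 4)
  have h9 := halfTurn_bentArc north south (3 / 4)
  have h10 := halfTurn_bentArc west east (1 / 4)
  have h11 := halfTurn_bentArc west east (3 / 4)
  norm_num [Side.unflip, straightArc_comm south west, straightArc_comm east south,
    straightArc_comm east north, straightArc_comm west north, straightArc_comm east west,
    straightArc_comm south north, bentArc_comm east west, bentArc_comm south north] at *
  cases t <;> simp only [Tile.flip, Tile.tameArcs, image_union, image_empty,
    straightArc_comm south west, straightArc_comm east south,
    straightArc_comm east north, straightArc_comm west north, straightArc_comm east west,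
    straightArc_comm south north, bentArc_comm east west, bentArc_comm south north, *]
  case t7 => exact union_comm _ _
  case t9 => exact union_comm _ _
  case t10 => exact union_comm _ _
  case vertex k => cases k <;> simp [Tile.flip, Tile.tameArcs]

theorem Tile.tameArcs_mirror (t : Tile) : t.mirror.tameArcs = reflection '' t.tameArcs := by
  have h8 := fun s t => reflection_bentArc s t (1 / 4)
  have h9 := fun s t => reflection_bentArc s t (3 / 4)
  norm_num at h8 h9
  cases t <;> simp only [Tile.mirror, Tile.tameArcs, image_union, image_empty,
    reflection_straightArc, h8, h9]

/-- The turn takes rows between `a` and `a + 1` to columns between `n - a - 1` and `n - a`, which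
explains the `1` in the hypothesis. -/
theorem turn_arcsAt {n a b c : ℕ} (h : a + c + 1 = n) (t : Tile) :
    turn n '' arcsAt a b t = arcsAt b c t.rotate := by
  rw [arcsAt, arcsAt, Tile.tameArcs_rotate, ← image_comp, ← image_comp]
  refine image_congr fun x _ => ?_
  subst h
  ext i
  fin_cases i <;> simp [turn_apply, corner]
  ring

theorem halfTurn_arcsAt (a b : ℕ) (t : Tile) :
    halfTurn '' arcsAt a b t = arcsAt b a t.flip := by
  rw [arcsAt, arcsAt, Tile.tameArcs_flip, ← image_comp, ← image_comp]
  refine image_congr fun x _ => ?_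
  ext i
  fin_cases i <;> simp [halfTurn_apply, corner]

theorem reflection_arcsAt (a b : ℕ) (t : Tile) :
    reflection '' arcsAt a b t = arcsAt a b t.mirror := by
  rw [arcsAt, arcsAt, Tile.tameArcs_mirror, ← image_comp, ← image_comp]
  refine image_congr fun x _ => ?_
  ext i
  fin_cases i <;> simp [reflection_apply, corner]

theorem turn_tamePart {n : ℕ} (M : Mosaic n) : turn n '' M.tamePart = M.rotate.tamePart := by
  rw [tamePart_eq_arcsAt, tamePart_eq_arcsAt]
  simp only [image_iUnion]
  have h : ∀ a b : Fin n, turn n '' arcsAt a b (M a b) = arcsAt b a.rev (M a b).rotate :=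
    fun a b => turn_arcsAt (by simp [Fin.val_rev]; omega) _
  ext x
  simp only [mem_iUnion, h, Mosaic.rotate, Matrix.of_apply]
  constructor
  · rintro ⟨a, b, hx⟩
    exact ⟨b, a.rev, by rwa [Fin.rev_rev]⟩
  · rintro ⟨i, j, hx⟩
    exact ⟨j.rev, i, by rwa [Fin.rev_rev]⟩

theorem halfTurn_tamePart {n : ℕ} (M : Mosaic n) : halfTurn '' M.tamePart = M.flip.tamePart := by
  rw [tamePart_eq_arcsAt, tamePart_eq_arcsAt]
  simp only [image_iUnion, halfTurn_arcsAt]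
  rw [iUnion_comm]
  rfl

theorem reflection_tamePart {n : ℕ} (M : Mosaic n) :
    reflection '' M.tamePart = M.mirror.tamePart := by
  rw [tamePart_eq_arcsAt, tamePart_eq_arcsAt]
  simp only [image_iUnion, reflection_arcsAt]
  rfl

theorem Tile.rotate_eq_vertex (t : Tile) (k : VertexKind) :
    t.rotate = vertex k ↔ t = vertex k.unturn := by
  rcases t with _ | _ | _ | _ | _ | _ | _ | _ | _ | _ | _ | k' <;>
    first | (cases k' <;> cases k <;> decide) | (cases k <;> decide)

theorem Tile.flip_eq_vertex (t : Tile) (k : VertexKind) :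
    t.flip = vertex k ↔ t = vertex k.unturn := by
  rcases t with _ | _ | _ | _ | _ | _ | _ | _ | _ | _ | _ | k' <;>
    first | (cases k' <;> cases k <;> decide) | (cases k <;> decide)

theorem Tile.mirror_eq_vertex (t : Tile) (k : VertexKind) :
    t.mirror = vertex k ↔ t = vertex k := by
  cases t <;> simp [Tile.mirror]

theorem Tile.mem_sides_rotate (t : Tile) (s : Side) : s ∈ t.rotate.sides ↔ s.unturn ∈ t.sides := by
  rcases t with _ | _ | _ | _ | _ | _ | _ | _ | _ | _ | _ | k' <;>
    first | (cases k' <;> cases s <;> decide) | (cases s <;> decide)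

theorem Tile.mem_sides_flip (t : Tile) (s : Side) : s ∈ t.flip.sides ↔ s.unflip ∈ t.sides := by
  rcases t with _ | _ | _ | _ | _ | _ | _ | _ | _ | _ | _ | k' <;>
    first | (cases k' <;> cases s <;> decide) | (cases s <;> decide)

theorem Tile.sides_mirror (t : Tile) : t.mirror.sides = t.sides := by
  cases t <;> rfl

theorem onBoundary_turn {n : ℕ} {i j : Fin n} {s : Side} (h : OnBoundary i j s) :
    OnBoundary j.rev i s.unturn := by
  cases s <;> simp only [OnBoundary, Side.unturn, Fin.val_rev] at h ⊢ <;> omega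

theorem onBoundary_flip {n : ℕ} {i j : Fin n} {s : Side} (h : OnBoundary i j s) :
    OnBoundary j i s.unflip := by
  cases s <;> exact h

theorem depthIn_turn {n a c : ℝ} (b k : ℝ) (h : a + c + k = n) (x : Space) :
    depthIn b c k (turn n x) = depthIn a b k x := by
  simp only [depthIn, turn_apply]
  simp
  rw [show n - x 0 - c = a + k - x 0 by linarith, show c + k - (n - x 0) = x 0 - a by linarith,
    min_comm (a + k - x 0), min_comm]

theorem depthIn_halfTurn (a b k : ℝ) (x : Space) :
    depthIn b a k (halfTurn x) = depthIn a b k x := by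
  simp only [depthIn, halfTurn_apply]
  simp
  rw [min_comm]

theorem depthIn_reflection (a b k : ℝ) (x : Space) :
    depthIn a b k (reflection x) = depthIn a b k x := by
  simp [depthIn, reflection_apply]

theorem abs_height (z : ℝ) : |1 - z - 1 / 2| = |z - 1 / 2| := by
  rw [← abs_neg]
  congr 1
  ring

namespace CellDeform

variable {n : ℕ} {M N : Mosaic n}

/-- Cells are defined by the distance from the boundary of a square and the height. The turn
preserves both, so it matches the frozen parts. -/
theorem rotate (h : CellDeform M N) : CellDeform M.rotate N.rotate := by
  refine ⟨fun i j k => ?_, fun i j s hs => ?_,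
    h.deforms.transport (turn n) (turn_tamePart M) (turn_tamePart N) ?_⟩
  · simp only [Mosaic.rotate, Matrix.of_apply, Tile.rotate_eq_vertex]
    exact h.vertex_iff _ _ _
  · simp only [Mosaic.rotate, Matrix.of_apply, Tile.mem_sides_rotate]
    exact h.sides_iff _ _ _ (onBoundary_turn hs)
  · rintro x (hx | ⟨i, j, k, hk, hx⟩)
    · left
      simp only [openCell, mem_compl_iff, mem_ofPred_eq] at hx ⊢
      rw [depthIn_turn (n := n) (a := 0) (c := 0) 0 n (by ring)] at hx
      simpa [turn_apply] using hx
    · right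
      refine ⟨j.rev, i, _, (Tile.rotate_eq_vertex _ _).1 hk, ?_⟩
      simp only [closedCell, mem_ofPred_eq] at hx ⊢
      have hrev : ((j.rev : ℕ) : ℝ) + (j : ℕ) + 1 = n := by
        have : (j.rev : ℕ) + j + 1 = n := by rw [Fin.val_rev]; omega
        exact_mod_cast this
      rw [depthIn_turn (i : ℝ) 1 hrev] at hx
      simpa [turn_apply] using hx

theorem flip (h : CellDeform M N) : CellDeform M.flip N.flip := by
  refine ⟨fun i j k => ?_, fun i j s hs => ?_,
    h.deforms.transport halfTurn (halfTurn_tamePart M) (halfTurn_tamePart N) ?_⟩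
  · simp only [Mosaic.flip, Matrix.of_apply, Tile.flip_eq_vertex]
    exact h.vertex_iff _ _ _
  · simp only [Mosaic.flip, Matrix.of_apply, Tile.mem_sides_flip]
    exact h.sides_iff _ _ _ (onBoundary_flip hs)
  · rintro x (hx | ⟨i, j, k, hk, hx⟩)
    · left
      simp only [openCell, mem_compl_iff, mem_ofPred_eq] at hx ⊢
      rw [depthIn_halfTurn] at hx
      rw [← abs_height]
      exact hx
    · right
      refine ⟨j, i, _, (Tile.flip_eq_vertex _ _).1 hk, ?_⟩
      simp only [closedCell, mem_ofPred_eq] at hx ⊢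
      rw [depthIn_halfTurn] at hx
      rw [← abs_height]
      exact hx

theorem mirror (h : CellDeform M N) : CellDeform M.mirror N.mirror := by
  refine ⟨fun i j k => ?_, fun i j s hs => ?_,
    h.deforms.transport reflection (reflection_tamePart M) (reflection_tamePart N) ?_⟩
  · simp only [Mosaic.mirror, Matrix.of_apply, Tile.mirror_eq_vertex]
    exact h.vertex_iff _ _ _
  · simp only [Mosaic.mirror, Matrix.of_apply, Tile.sides_mirror]
    exact h.sides_iff _ _ _ hs
  · rintro x (hx | ⟨i, j, k, hk, hx⟩)
    · left
      simp only [openCell, mem_compl_iff, mem_ofPred_eq] at hx ⊢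
      rw [depthIn_reflection] at hx
      rw [← abs_height]
      exact hx
    · right
      refine ⟨i, j, k, (Tile.mirror_eq_vertex _ _).1 hk, ?_⟩
      simp only [closedCell, mem_ofPred_eq] at hx ⊢
      rw [depthIn_reflection] at hx
      rw [← abs_height]
      exact hx

theorem act (h : CellDeform M N) (g : DihedralGroup 4) : CellDeform (M.act g) (N.act g) := by
  have key : ∀ m, CellDeform (Mosaic.rotate^[m] M) (Mosaic.rotate^[m] N) := by
    intro m
    induction m with
    | zero => exact h
    | succ m ih =>
      rw [Function.iterate_succ_apply', Function.iterate_succ_apply']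
      exact ih.rotate
  cases g with
  | r i => exact key _
  | sr i => exact (key _).flip

end CellDeform

/-! ### Block moves -/

theorem ne_vertex {t : Tile} (h : t.isVertex = false) (k : VertexKind) : t ≠ vertex k := by
  rintro rfl
  simp [Tile.isVertex] at h

/-- What is preserved in a position of a block in a move: neither tile is black, and connection points
on the sides in `S` stay the same. -/
def Preserves (S : Set Side) (p : Tile × Tile) : Prop :=
  p.1.isVertex = false ∧ p.2.isVertex = false ∧ ∀ s ∈ S, s ∈ p.1.sides ↔ s ∈ p.2.sides

theorem preserves_passNE {p : Tile × Tile} (h : p ∈ passNE) : Preserves {north, east} p := by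
  rcases h with rfl | rfl <;> simp [Preserves, Tile.isVertex, Tile.sides]

theorem preserves_passSW {p : Tile × Tile} (h : p ∈ passSW) : Preserves {south, west} p := by
  rcases h with rfl | rfl <;> simp [Preserves, Tile.isVertex, Tile.sides]

theorem preserves_passSE {p : Tile × Tile} (h : p ∈ passSE) : Preserves {south, east} p := by
  rcases h with rfl | rfl <;> simp [Preserves, Tile.isVertex, Tile.sides]

theorem preserves_endNW {p : Tile × Tile} (h : p ∈ endNW) : Preserves {north, west} p := by
  rcases h with rfl | rfl <;> simp [Preserves, Tile.isVertex, Tile.sides]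

theorem preserves_endNE {p : Tile × Tile} (h : p ∈ endNE) : Preserves {north, east} p := by
  rcases h with rfl | rfl <;> simp [Preserves, Tile.isVertex, Tile.sides]

theorem preserves_endSE {p : Tile × Tile} (h : p ∈ endSE) : Preserves {south, east} p := by
  rcases h with rfl | rfl <;> simp [Preserves, Tile.isVertex, Tile.sides]

theorem preserves_of_passes {x : Tile} {h v : Tile × Tile} (hp : Passes x h v) :
    Preserves {west, east} h ∧ Preserves {north, south} v := by
  have := mem_passesList hp
  simp only [passesList, List.mem_cons, Prod.mk.injEq, List.not_mem_nil, or_false] at this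
  rcases this with ⟨rfl, rfl, rfl⟩ | ⟨rfl, rfl, rfl⟩ | ⟨rfl, rfl, rfl⟩ | ⟨rfl, rfl, rfl⟩ |
    ⟨rfl, rfl, rfl⟩ | ⟨rfl, rfl, rfl⟩ | ⟨rfl, rfl, rfl⟩ | ⟨rfl, rfl, rfl⟩ | ⟨rfl, rfl, rfl⟩ |
    ⟨rfl, rfl, rfl⟩ | ⟨rfl, rfl, rfl⟩ | ⟨rfl, rfl, rfl⟩ <;>
    simp [Preserves, Tile.isVertex, Tile.sides]

theorem arcsAt_t0 (i j : ℕ) : arcsAt i j t0 = ∅ := by simp [arcsAt, Tile.tameArcs]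

/-- This splits the tile into the arc of the moving strand and the optional outer arc. The latter
lies in the corner arc that the certificates already treat as an obstacle, so one certificate covers
both choices. -/
theorem arcs_passNE {p : Tile × Tile} (h : p ∈ passNE) (i j : ℕ) :
    arcsAt i j p.2 = arcsAt i j t1 ∪ arcsAt i j p.1 ∧ arcsAt i j p.1 ⊆ arcsAt i j t3 := by
  rcases h with rfl | rfl
  · simp [arcsAt_t0]
  · simp only [arcsAt, Tile.tameArcs, straightArc_comm east north, image_union, subset_refl,
      and_self]

theorem arcs_passSW {p : Tile × Tile} (h : p ∈ passSW) (i j : ℕ) :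
    arcsAt i j p.2 = arcsAt i j t3 ∪ arcsAt i j p.1 ∧ arcsAt i j p.1 ⊆ arcsAt i j t1 := by
  rcases h with rfl | rfl
  · simp [arcsAt_t0]
  · simp only [arcsAt, Tile.tameArcs, straightArc_comm east north, image_union, subset_refl,
      and_true]
    exact union_comm _ _

theorem arcs_passSE {p : Tile × Tile} (h : p ∈ passSE) (i j : ℕ) :
    arcsAt i j p.2 = arcsAt i j t4 ∪ arcsAt i j p.1 ∧ arcsAt i j p.1 ⊆ arcsAt i j t2 := by
  rcases h with rfl | rfl
  · simp [arcsAt_t0]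
  · simp only [arcsAt, Tile.tameArcs, image_union, subset_refl, and_self]

theorem segSet_segs2 (a b c d : Tile) : segSet (segs2 a b c d) =
    arcsAt 0 0 a ∪ arcsAt 0 1 b ∪ arcsAt 1 0 c ∪ arcsAt 1 1 d := by
  simp [segs2, arcsAt_eq, union_assoc]

theorem segSet_segs3 (a b c d e f g h i : Tile) : segSet (segs3 a b c d e f g h i) =
    arcsAt 0 0 a ∪ arcsAt 0 1 b ∪ arcsAt 0 2 c ∪ arcsAt 1 0 d ∪ arcsAt 1 1 e ∪ arcsAt 1 2 f ∪
      arcsAt 2 0 g ∪ arcsAt 2 1 h ∪ arcsAt 2 2 i := by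
  simp [segs3, arcsAt_eq, union_assoc]

/-- The set `st` collects the optional arcs actually present. It is fixed by the certified
deformation and hence may be added to both sides. -/
theorem deforms_block {k : ℕ} {A B : Mosaic k} {q : Bool} {fixed A₀ B₀ : List Seg}
    {stops : List Pt} {cert : List (Pt × Pt)} {st : Set Space}
    (h : moveOK k q stops cert fixed A₀ B₀ = true)
    (hst : st ⊆ segSet fixed) (hA : A.tamePart = segSet A₀ ∪ st) (hB : B.tamePart = segSet B₀ ∪ st)
    (hq : ∀ i j, (A i j).isVertex = true → q = true ∧ i.val = 1 ∧ j.val = 1) :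
    Deforms A.frozenPart A.tamePart B.tamePart := by
  rw [hA, hB]
  refine ((deforms_of_moveOK h).union (hst.trans subset_union_right)).mono ?_
  rintro x (hx | ⟨i, j, l, hl, hx⟩)
  · exact Or.inl (Or.inl hx)
  · obtain ⟨rfl, hi, hj⟩ := hq i j (by rw [hl]; rfl)
    left
    right
    simpa [hi, hj] using hx

theorem segSet_cornerNE (k : ℕ) : segSet (cornerNE k) = arcsAt 0 (k - 1) t3 := (arcsAt_eq _ _ _).symm

theorem segSet_cornerSW (k : ℕ) : segSet (cornerSW k) = arcsAt (k - 1) 0 t1 := (arcsAt_eq _ _ _).symm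

theorem segSet_cornerSE (k : ℕ) : segSet (cornerSE k) = arcsAt (k - 1) (k - 1) t2 :=
  (arcsAt_eq _ _ _).symm

theorem startNW_mem {a : Tile × Tile} (h : a ∈ endNW) : a ∈ endNWList := by
  rcases h with rfl | rfl <;> decide

theorem mem_endNEList {a : Tile × Tile} (h : a ∈ endNE) : a ∈ endNEList := by
  rcases h with rfl | rfl <;> decide

theorem mem_endSEList {a : Tile × Tile} (h : a ∈ endSE) : a ∈ endSEList := by
  rcases h with rfl | rfl <;> decide

theorem mem_crossingList {a : Tile} (h : a ∈ crossings) : a ∈ crossingList := by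
  rcases h with rfl | rfl <;> decide

/-- A `2 × 2` block without black tiles. -/
theorem cellDeform_two {a b c d a' b' c' d' : Tile} {fixed A₀ B₀ : List Seg}
    {stops : List Pt} {cert : List (Pt × Pt)} {st : Set Space}
    (h : moveOK 2 false stops cert fixed A₀ B₀ = true) (hst : st ⊆ segSet fixed)
    (hA : arcsAt 0 0 a ∪ arcsAt 0 1 b ∪ arcsAt 1 0 c ∪ arcsAt 1 1 d = segSet A₀ ∪ st)
    (hB : arcsAt 0 0 a' ∪ arcsAt 0 1 b' ∪ arcsAt 1 0 c' ∪ arcsAt 1 1 d' = segSet B₀ ∪ st)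
    (ha : Preserves {north, west} (a, a')) (hb : Preserves {north, east} (b, b'))
    (hc : Preserves {south, west} (c, c')) (hd : Preserves {south, east} (d, d')) :
    CellDeform !![a, b; c, d] !![a', b'; c', d'] := by
  obtain ⟨ha1, ha2, ha3⟩ := ha
  obtain ⟨hb1, hb2, hb3⟩ := hb
  obtain ⟨hc1, hc2, hc3⟩ := hc
  obtain ⟨hd1, hd2, hd3⟩ := hd
  refine ⟨fun i j k => ?_, fun i j s hs => ?_, ?_⟩
  · fin_cases i <;> fin_cases j <;> simp [ne_vertex, *]
  · simp only [mem_insert_iff, mem_singleton_iff, forall_eq_or_imp, forall_eq] at *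
    fin_cases i <;> fin_cases j <;> cases s <;> simp [OnBoundary] at hs ⊢ <;> simp [*]
  · refine deforms_block h hst ?_ ?_ fun i j hij => ?_
    · rw [tamePart_two, hA]
    · rw [tamePart_two, hB]
    · fin_cases i <;> fin_cases j <;> simp_all

/-- A `3 × 3` block with a black tile or a crossing in the centre. -/
theorem cellDeform_three {a b c d x f g h i a' b' c' d' f' g' h' i' : Tile}
    {fixed A₀ B₀ : List Seg} {stops : List Pt} {cert : List (Pt × Pt)} {st : Set Space}
    (hok : moveOK 3 x.isVertex stops cert fixed A₀ B₀ = true) (hst : st ⊆ segSet fixed)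
    (hA : arcsAt 0 0 a ∪ arcsAt 0 1 b ∪ arcsAt 0 2 c ∪ arcsAt 1 0 d ∪ arcsAt 1 1 x ∪ arcsAt 1 2 f ∪
      arcsAt 2 0 g ∪ arcsAt 2 1 h ∪ arcsAt 2 2 i = segSet A₀ ∪ st)
    (hB : arcsAt 0 0 a' ∪ arcsAt 0 1 b' ∪ arcsAt 0 2 c' ∪ arcsAt 1 0 d' ∪ arcsAt 1 1 x ∪
      arcsAt 1 2 f' ∪ arcsAt 2 0 g' ∪ arcsAt 2 1 h' ∪ arcsAt 2 2 i' = segSet B₀ ∪ st)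
    (ha : Preserves {north, west} (a, a')) (hb : Preserves {north} (b, b'))
    (hc : Preserves {north, east} (c, c')) (hd : Preserves {west} (d, d'))
    (hf : Preserves {east} (f, f')) (hg : Preserves {south, west} (g, g'))
    (hh : Preserves {south} (h, h')) (hi : Preserves {south, east} (i, i')) :
    CellDeform !![a, b, c; d, x, f; g, h, i] !![a', b', c'; d', x, f'; g', h', i'] := by
  obtain ⟨ha1, ha2, ha3⟩ := ha
  obtain ⟨hb1, hb2, hb3⟩ := hb
  obtain ⟨hc1, hc2, hc3⟩ := hc
  obtain ⟨hd1, hd2, hd3⟩ := hd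
  obtain ⟨hf1, hf2, hf3⟩ := hf
  obtain ⟨hg1, hg2, hg3⟩ := hg
  obtain ⟨hh1, hh2, hh3⟩ := hh
  obtain ⟨hi1, hi2, hi3⟩ := hi
  refine ⟨fun i j k => ?_, fun i j s hs => ?_, ?_⟩
  · fin_cases i <;> fin_cases j <;> simp [ne_vertex, *]
  · simp only [mem_insert_iff, mem_singleton_iff, forall_eq_or_imp, forall_eq] at *
    fin_cases i <;> fin_cases j <;> cases s <;> simp [OnBoundary] at hs ⊢ <;> simp [*]
  · refine deforms_block hok hst ?_ ?_ fun i j hij => ?_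
    · rw [tamePart_three, hA]
    · rw [tamePart_three, hB]
    · fin_cases i <;> fin_cases j <;> simp_all

theorem Preserves.mono {S S' : Set Side} {p : Tile × Tile} (h : Preserves S p) (hS : S' ⊆ S) :
    Preserves S' p := ⟨h.1, h.2.1, fun s hs => h.2.2 s (hS hs)⟩

theorem Preserves.refl {S : Set Side} {t : Tile} (h : t.isVertex = false) : Preserves S (t, t) :=
  ⟨h, h, fun _ _ => Iff.rfl⟩

/-- Basic moves come from the certificates, with optional corner arcs split off into `st`.
Rotations, flips and mirror images follow by conjugation. -/
theorem BlockMove.cellDeform {k : ℕ} {A B : Mosaic k} (h : BlockMove A B) : CellDeform A B := by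
  induction h with
  | @planar_one b c d hb hc hd =>
    obtain ⟨hb1, hb2⟩ := arcs_passNE hb 0 1
    obtain ⟨hc1, hc2⟩ := arcs_passSW hc 1 0
    obtain ⟨hd1, hd2⟩ := arcs_passSE hd 1 1
    refine cellDeform_two planar_one_ok
      (st := arcsAt 0 1 b.1 ∪ arcsAt 1 0 c.1 ∪ arcsAt 1 1 d.1) ?_ ?_ ?_
      ?_ (preserves_passNE hb) (preserves_passSW hc) (preserves_passSE hd)
    · simp only [segSet_append, segSet_cornerNE, segSet_cornerSW, segSet_cornerSE]
      exact union_subset_union (union_subset_union hb2 hc2) hd2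
    · simp only [segSet_segs2, arcsAt_t0, union_empty]
      ac_rfl
    · simp only [segSet_segs2, hb1, hc1, hd1]
      ac_rfl
    · simp [Preserves, Tile.isVertex, Tile.sides]
  | @planar_two a b c d ha hb hc hd =>
    obtain ⟨hc1, hc2⟩ := arcs_passSW hc 1 0
    obtain ⟨hd1, hd2⟩ := arcs_passSE hd 1 1
    have hok := List.all_eq_true.1 (List.all_eq_true.1 planar_two_ok a (startNW_mem ha)) b
      (mem_endNEList hb)
    refine cellDeform_two hok (st := arcsAt 1 0 c.1 ∪ arcsAt 1 1 d.1) ?_ ?_ ?_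
      (preserves_endNW ha) (preserves_endNE hb) (preserves_passSW hc) (preserves_passSE hd)
    · simp only [segSet_append, segSet_cornerSW, segSet_cornerSE]
      exact union_subset_union hc2 hd2
    · simp only [segSet_segs2, arcsAt_t0, union_empty]
      ac_rfl
    · simp only [segSet_segs2, hc1, hd1]
      ac_rfl
  | @planar_three a b c d ha hb hc hd =>
    obtain ⟨hb1, hb2⟩ := arcs_passNE hb 0 1
    obtain ⟨hc1, hc2⟩ := arcs_passSW hc 1 0
    have hok := List.all_eq_true.1 (List.all_eq_true.1 planar_three_ok a (startNW_mem ha)) d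
      (mem_endSEList hd)
    -- In this move the NE tile loses the strand instead of gaining it, so the pair is used in
    -- reverse.
    obtain ⟨h1, h2, h3⟩ := preserves_passNE hb
    refine cellDeform_two hok (st := arcsAt 0 1 b.1 ∪ arcsAt 1 0 c.1) ?_ ?_ ?_
      (preserves_endNW ha) ⟨h2, h1, fun s hs => (h3 s hs).symm⟩ (preserves_passSW hc)
      (preserves_endSE hd)
    · simp only [segSet_append, segSet_cornerNE, segSet_cornerSW]
      exact union_subset_union hb2 hc2
    · simp only [segSet_segs2, arcsAt_t0, union_empty, hb1]
      ac_rfl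
    · simp only [segSet_segs2, arcsAt_t0, union_empty, hc1]
      ac_rfl
  | @slide_adjacent x c d hx hc hd =>
    obtain ⟨hc1, hc2⟩ := arcs_passSW hc 1 0
    obtain ⟨hd1, hd2⟩ := arcs_passSE hd 1 1
    have hok := List.all_eq_true.1 slide_adjacent_ok x (mem_crossingList hx)
    refine cellDeform_two hok (st := arcsAt 1 0 c.1 ∪ arcsAt 1 1 d.1) ?_ ?_ ?_
      ?_ ?_ (Preserves.refl (preserves_passSW hc).2.1) (Preserves.refl (preserves_passSE hd).2.1)
    · simp only [segSet_append, segSet_cornerSW, segSet_cornerSE]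
      exact union_subset_union hc2 hd2
    · simp only [segSet_segs2, hc1, hd1]
      ac_rfl
    · simp only [segSet_segs2, hc1, hd1]
      ac_rfl
    · rcases hx with rfl | rfl <;> simp [Preserves, Tile.isVertex, Tile.sides]
    · rcases hx with rfl | rfl <;> simp [Preserves, Tile.isVertex, Tile.sides, Tile.mirror]
  | @slide_opposite x b c hx hb hc =>
    obtain ⟨hb1, hb2⟩ := arcs_passNE hb 0 1
    obtain ⟨hc1, hc2⟩ := arcs_passSW hc 1 0
    have hok := List.all_eq_true.1 slide_opposite_ok x (mem_crossingList hx)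
    refine cellDeform_two hok (st := arcsAt 0 1 b.1 ∪ arcsAt 1 0 c.1) ?_ ?_ ?_
      ?_ (Preserves.refl (preserves_passNE hb).2.1) (Preserves.refl (preserves_passSW hc).2.1) ?_
    · simp only [segSet_append, segSet_cornerNE, segSet_cornerSW]
      exact union_subset_union hb2 hc2
    · simp only [segSet_segs2, hb1, hc1]
      ac_rfl
    · simp only [segSet_segs2, hb1, hc1]
      ac_rfl
    · rcases hx with rfl | rfl <;> simp [Preserves, Tile.isVertex, Tile.sides]
    · rcases hx with rfl | rfl <;> simp [Preserves, Tile.isVertex, Tile.sides]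
  | @reidemeister_one x b c d hx hb hc hd =>
    obtain ⟨hb1, hb2⟩ := arcs_passNE hb 0 1
    obtain ⟨hc1, hc2⟩ := arcs_passSW hc 1 0
    obtain ⟨hd1, hd2⟩ := arcs_passSE hd 1 1
    have hok := List.all_eq_true.1 reidemeister_one_ok x (mem_crossingList hx)
    refine cellDeform_two hok
      (st := arcsAt 0 1 b.1 ∪ arcsAt 1 0 c.1 ∪ arcsAt 1 1 d.1) ?_ ?_ ?_
      ?_ (preserves_passNE hb) (preserves_passSW hc) (preserves_passSE hd)
    · simp only [segSet_append, segSet_cornerNE, segSet_cornerSW, segSet_cornerSE]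
      exact union_subset_union (union_subset_union hb2 hc2) hd2
    · simp only [segSet_segs2, arcsAt_t0, union_empty]
      ac_rfl
    · simp only [segSet_segs2, hb1, hc1, hd1]
      ac_rfl
    · rcases hx with rfl | rfl <;> simp [Preserves, Tile.isVertex, Tile.sides]
  | @reidemeister_two_adjacent x c d hx hc hd =>
    obtain ⟨hc1, hc2⟩ := arcs_passSW hc 1 0
    obtain ⟨hd1, hd2⟩ := arcs_passSE hd 1 1
    have hok := List.all_eq_true.1 reidemeister_two_adjacent_ok x (mem_crossingList hx)
    refine cellDeform_two hok (st := arcsAt 1 0 c.1 ∪ arcsAt 1 1 d.1) ?_ ?_ ?_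
      ?_ ?_ (Preserves.refl (preserves_passSW hc).2.1) (Preserves.refl (preserves_passSE hd).2.1)
    · simp only [segSet_append, segSet_cornerSW, segSet_cornerSE]
      exact union_subset_union hc2 hd2
    · simp only [segSet_segs2, hc1, hd1]
      ac_rfl
    · simp only [segSet_segs2, hc1, hd1]
      ac_rfl
    · rcases hx with rfl | rfl <;> simp [Preserves, Tile.isVertex, Tile.sides]
    · rcases hx with rfl | rfl <;> simp [Preserves, Tile.isVertex, Tile.sides]
  | @reidemeister_two_opposite x b c hx hb hc =>
    obtain ⟨hb1, hb2⟩ := arcs_passNE hb 0 1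
    obtain ⟨hc1, hc2⟩ := arcs_passSW hc 1 0
    have hok := List.all_eq_true.1 reidemeister_two_opposite_ok x (mem_crossingList hx)
    refine cellDeform_two hok (st := arcsAt 0 1 b.1 ∪ arcsAt 1 0 c.1) ?_ ?_ ?_
      ?_ (Preserves.refl (preserves_passNE hb).2.1) (Preserves.refl (preserves_passSW hc).2.1) ?_
    · simp only [segSet_append, segSet_cornerNE, segSet_cornerSW]
      exact union_subset_union hb2 hc2
    · simp only [segSet_segs2, hb1, hc1]
      ac_rfl
    · simp only [segSet_segs2, hb1, hc1]
      ac_rfl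
    · rcases hx with rfl | rfl <;> simp [Preserves, Tile.isVertex, Tile.sides]
    · rcases hx with rfl | rfl <;> simp [Preserves, Tile.isVertex, Tile.sides, Tile.mirror]
  | @across_one x h v b c d hx hb hc hd =>
    obtain ⟨hb1, hb2⟩ := arcs_passNE hb 0 2
    obtain ⟨hc1, hc2⟩ := arcs_passSW hc 2 0
    obtain ⟨hd1, hd2⟩ := arcs_passSE hd 2 2
    have hok := List.all_eq_true.1 across_one_ok (x, h, v) (mem_passesList hx)
    obtain ⟨hh, hv⟩ := preserves_of_passes hx
    refine cellDeform_three hok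
      (st := arcsAt 0 2 b.1 ∪ arcsAt 2 0 c.1 ∪ arcsAt 2 2 d.1) ?_ ?_ ?_
      ?_ (hv.mono (by simp)) (preserves_passNE hb) (hh.mono (by simp)) (hh.mono (by simp))
      (preserves_passSW hc) (hv.mono (by simp)) (preserves_passSE hd)
    · simp only [segSet_append, segSet_cornerNE, segSet_cornerSW, segSet_cornerSE]
      exact union_subset_union (union_subset_union hb2 hc2) hd2
    · simp only [segSet_segs3, arcsAt_t0, union_empty]
      ac_rfl
    · simp only [segSet_segs3, hb1, hc1, hd1]
      ac_rfl
    · simp [Preserves, Tile.isVertex, Tile.sides]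
  | @across_two x h v a b c d hx ha hb hc hd =>
    obtain ⟨hc1, hc2⟩ := arcs_passSW hc 2 0
    obtain ⟨hd1, hd2⟩ := arcs_passSE hd 2 2
    have hok := List.all_eq_true.1 (List.all_eq_true.1 (List.all_eq_true.1 across_two_ok (x, h, v)
      (mem_passesList hx)) a (startNW_mem ha)) b (mem_endNEList hb)
    obtain ⟨hh, hv⟩ := preserves_of_passes hx
    have hv' : Preserves {north, south} (v.2, v.1) :=
      ⟨hv.2.1, hv.1, fun s hs => (hv.2.2 s hs).symm⟩
    refine cellDeform_three hok (st := arcsAt 2 0 c.1 ∪ arcsAt 2 2 d.1) ?_ ?_ ?_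
      (preserves_endNW ha) (hv'.mono (by simp)) (preserves_endNE hb) (hh.mono (by simp))
      (hh.mono (by simp)) (preserves_passSW hc) (hv.mono (by simp)) (preserves_passSE hd)
    · simp only [segSet_append, segSet_cornerSW, segSet_cornerSE]
      exact union_subset_union hc2 hd2
    · simp only [segSet_segs3, arcsAt_t0, union_empty]
      ac_rfl
    · simp only [segSet_segs3, hc1, hd1]
      ac_rfl
  | @across_three x h v a b c d hx ha hb hc hd =>
    obtain ⟨hb1, hb2⟩ := arcs_passNE hb 0 2
    obtain ⟨hc1, hc2⟩ := arcs_passSW hc 2 0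
    have hok := List.all_eq_true.1 (List.all_eq_true.1 (List.all_eq_true.1 across_three_ok
      (x, h, v) (mem_passesList hx)) a (startNW_mem ha)) d (mem_endSEList hd)
    obtain ⟨hh, hv⟩ := preserves_of_passes hx
    have hv' : Preserves {north, south} (v.2, v.1) :=
      ⟨hv.2.1, hv.1, fun s hs => (hv.2.2 s hs).symm⟩
    have hh' : Preserves {west, east} (h.2, h.1) :=
      ⟨hh.2.1, hh.1, fun s hs => (hh.2.2 s hs).symm⟩
    obtain ⟨h1, h2, h3⟩ := preserves_passNE hb
    refine cellDeform_three hok (st := arcsAt 0 2 b.1 ∪ arcsAt 2 0 c.1) ?_ ?_ ?_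
      (preserves_endNW ha) (hv'.mono (by simp)) ⟨h2, h1, fun s hs => (h3 s hs).symm⟩
      (hh.mono (by simp)) (hh'.mono (by simp)) (preserves_passSW hc) (hv.mono (by simp))
      (preserves_endSE hd)
    · simp only [segSet_append, segSet_cornerNE, segSet_cornerSW]
      exact union_subset_union hb2 hc2
    · simp only [segSet_segs3, arcsAt_t0, union_empty, hb1]
      ac_rfl
    · simp only [segSet_segs3, arcsAt_t0, union_empty, hc1]
      ac_rfl
  | rotate _ ih => exact ih.rotate
  | flip _ ih => exact ih.flip
  | mirror _ ih => exact ih.mirror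

/-! ### Mosaic moves -/

theorem depthIn_sub_corner (a b k : ℝ) (p q : ℕ) (x : Space) :
    depthIn a b k (x - corner p q) = depthIn (p + a) (q + b) k x := by
  simp [depthIn, corner]
  congr 2 <;> ring

theorem depthIn_le_depthIn {a b k a' b' k' : ℝ} (ha : a' ≤ a) (hb : b' ≤ b) (hak : a + k ≤ a' + k')
    (hbk : b + k ≤ b' + k') (x : Space) : depthIn a b k x ≤ depthIn a' b' k' x := by
  simp only [depthIn]
  gcongr

theorem openCell_subset_openCell {a b k a' b' k' : ℝ} (ha : a' ≤ a) (hb : b' ≤ b)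
    (hak : a + k ≤ a' + k') (hbk : b + k ≤ b' + k') : openCell a b k ⊆ openCell a' b' k' := by
  rintro x ⟨h1, h2⟩
  have := depthIn_le_depthIn ha hb hak hbk x
  exact ⟨h1.trans_le this, by linarith⟩

theorem sub_corner_mem_openCell {a b k : ℝ} {p q : ℕ} {x : Space} :
    x - corner p q ∈ openCell a b k ↔ x ∈ openCell (p + a) (q + b) k := by
  have h : (x - corner p q) 2 = x 2 := by simp [corner]
  simp only [openCell, mem_ofPred_eq, depthIn_sub_corner, h]

theorem sub_corner_mem_closedCell {a b k : ℝ} {p q : ℕ} {x : Space} :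
    x - corner p q ∈ closedCell a b k ↔ x ∈ closedCell (p + a) (q + b) k := by
  have h : (x - corner p q) 2 = x 2 := by simp [corner]
  simp only [closedCell, mem_ofPred_eq, depthIn_sub_corner, h]

/-- The vertical prism over the closed square of a tile. -/
def tilePrism (i j : ℕ) : Set Space := {x | x 0 ∈ Icc (i : ℝ) (i + 1) ∧ x 1 ∈ Icc (j : ℝ) (j + 1)}

theorem convex_tilePrism (i j : ℕ) : Convex ℝ (tilePrism i j) := by
  have h (l : Fin 3) (a b : ℝ) : Convex ℝ {x : Space | x l ∈ Icc a b} :=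
    (convex_Icc a b).is_linear_preimage (f := fun x : Space => x l)
      ⟨fun _ _ => rfl, fun _ _ => rfl⟩
  exact (h 0 _ _).inter (h 1 _ _)

theorem Tile.tameArcs_subset_of_convex {S : Set Space} (hS : Convex ℝ S)
    (hp : ∀ s : Side, s.point ∈ S) (hc : ∀ z ∈ Icc (0 : ℝ) 1, !₂[1 / 2, 1 / 2, z] ∈ S) (t : Tile) :
    t.tameArcs ⊆ S := by
  have hs (s t : Side) : straightArc s t ⊆ S := hS.segment_subset (hp s) (hp t)
  have hb (s t : Side) {z : ℝ} (hz : z ∈ Icc (0 : ℝ) 1) : bentArc s t z ⊆ S :=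
    union_subset (hS.segment_subset (hp s) (hc z hz)) (hS.segment_subset (hc z hz) (hp t))
  have h1 : (1 / 4 : ℝ) ∈ Icc (0 : ℝ) 1 := by norm_num
  have h3 : (3 / 4 : ℝ) ∈ Icc (0 : ℝ) 1 := by norm_num
  cases t <;> simp only [Tile.tameArcs, empty_subset, union_subset_iff, hs, hb _ _ h1, hb _ _ h3,
    and_self]

theorem tameArcs_subset_tilePrism (t : Tile) : t.tameArcs ⊆ tilePrism 0 0 := by
  refine t.tameArcs_subset_of_convex (convex_tilePrism 0 0) (fun s => ?_) fun z _ => ?_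
  · cases s <;> simp [tilePrism, Side.point] <;> norm_num
  · simp [tilePrism]
    norm_num

theorem tameArcs_height (t : Tile) : t.tameArcs ⊆ {x | x 2 ∈ Icc (0 : ℝ) 1} := by
  refine t.tameArcs_subset_of_convex ((convex_Icc 0 1).is_linear_preimage
    (f := fun x : Space => x 2) ⟨fun _ _ => rfl, fun _ _ => rfl⟩) (fun s => ?_) fun z hz => ?_
  · cases s <;> simp [Side.point] <;> norm_num
  · simpa using hz

theorem arcsAt_height (i j : ℕ) (t : Tile) : arcsAt i j t ⊆ {x | x 2 ∈ Icc (0 : ℝ) 1} := by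
  rintro _ ⟨x, hx, rfl⟩
  simpa [corner] using tameArcs_height t hx

theorem arcsAt_subset_tilePrism (i j : ℕ) (t : Tile) : arcsAt i j t ⊆ tilePrism i j := by
  rintro _ ⟨x, hx, rfl⟩
  have := tameArcs_subset_tilePrism t hx
  simp only [tilePrism, mem_ofPred_eq, mem_Icc, Nat.cast_zero] at this
  simp only [tilePrism, corner, mem_ofPred_eq, mem_Icc, PiLp.add_apply]
  simp
  obtain ⟨⟨h1, h2⟩, h3, h4⟩ := this
  refine ⟨⟨h1, ?_⟩, h3, ?_⟩ <;> linarith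

theorem closedCell_subset_tilePrism (i j : ℕ) : closedCell i j 1 ⊆ tilePrism i j := by
  rintro x ⟨h, -⟩
  simp only [depthIn, le_min_iff] at h
  obtain ⟨⟨h1, h2⟩, h3, h4⟩ := h
  exact ⟨⟨by linarith, by linarith⟩, by linarith, by linarith⟩

/-- A tile outside a square of tiles is disjoint from the open cell of the square. -/
theorem notMem_openCell_of_tilePrism {i j p q k : ℕ} {x : Space} (hx : x ∈ tilePrism i j)
    (h : i < p ∨ p + k ≤ i ∨ j < q ∨ q + k ≤ j) : x ∉ openCell p q k := by
  rintro ⟨hd, -⟩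
  simp only [depthIn, lt_min_iff] at hd
  obtain ⟨⟨h1, h2⟩, h3, h4⟩ := hd
  obtain ⟨⟨g1, g2⟩, g3, g4⟩ := hx
  rcases h with h | h | h | h
  · have : (i : ℝ) + 1 ≤ p := by exact_mod_cast h
    linarith
  · have : (p : ℝ) + k ≤ i := by exact_mod_cast h
    linarith
  · have : (j : ℝ) + 1 ≤ q := by exact_mod_cast h
    linarith
  · have : (q : ℝ) + k ≤ j := by exact_mod_cast h
    linarith

theorem image_arcsAt_add_corner (p q i j : ℕ) (t : Tile) :
    (fun x => x + corner p q) '' arcsAt i j t = arcsAt (p + i) (q + j) t := by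
  rw [arcsAt, arcsAt, ← image_comp]
  refine image_congr fun x _ => ?_
  ext l
  fin_cases l <;> simp [corner] <;> ring

/-- The position `(i, j)` of an `n`-mosaic lies in the `k × k` block with offset `(p, q)`. -/
def InBlock {n : ℕ} (k p q : ℕ) (i j : Fin n) : Prop :=
  (p ≤ i.val ∧ i.val < p + k) ∧ q ≤ j.val ∧ j.val < q + k

theorem InBlock.exists_shift {n k p q : ℕ} {i j : Fin n} (h : InBlock k p q i j)
    (hp : p + k ≤ n) (hq : q + k ≤ n) :
    ∃ i' j' : Fin k, i = shift p hp i' ∧ j = shift q hq j' := by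
  obtain ⟨⟨h1, h2⟩, h3, h4⟩ := h
  exact ⟨⟨i - p, by omega⟩, ⟨j - q, by omega⟩, Fin.ext (by simp [shift]; omega),
    Fin.ext (by simp [shift]; omega)⟩

theorem inBlock_shift {n k p q : ℕ} (hp : p + k ≤ n) (hq : q + k ≤ n) (i j : Fin k) :
    InBlock k p q (shift p hp i) (shift q hq j) := by
  simp only [InBlock, shift]
  omega

theorem tamePart_eq_block_union {k n : ℕ} {A : Mosaic k} {M : Mosaic n} {p q : ℕ} (hp : p + k ≤ n)
    (hq : q + k ≤ n) (hM : ∀ i j, M (shift p hp i) (shift q hq j) = A i j) :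
    M.tamePart = (fun x => x + corner p q) '' A.tamePart ∪
      {x | ∃ i j, ¬InBlock k p q i j ∧ x ∈ arcsAt i j (M i j)} := by
  simp only [tamePart_eq_arcsAt, image_iUnion, image_arcsAt_add_corner]
  ext x
  simp only [mem_iUnion, mem_union, mem_ofPred_eq]
  constructor
  · rintro ⟨i, j, hx⟩
    by_cases h : InBlock k p q i j
    · obtain ⟨i', j', rfl, rfl⟩ := h.exists_shift hp hq
      exact Or.inl ⟨i', j', by rwa [hM] at hx⟩
    · exact Or.inr ⟨i, j, h, hx⟩
  · rintro (⟨i, j, hx⟩ | ⟨i, j, -, hx⟩)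
    · exact ⟨shift p hp i, shift q hq j, by rwa [hM]⟩
    · exact ⟨i, j, hx⟩

theorem mem_image_add_corner_iff {p q : ℕ} {S : Set Space} {x : Space} :
    x ∈ (fun x => x + corner p q) '' S ↔ x - corner p q ∈ S := by
  constructor
  · rintro ⟨y, hy, rfl⟩
    simpa using hy
  · exact fun h => ⟨_, h, by simp⟩

theorem onBoundary_of_shift {k n p q : ℕ} (hp : p + k ≤ n) (hq : q + k ≤ n) {i j : Fin k} {s : Side}
    (h : OnBoundary (shift p hp i) (shift q hq j) s) : OnBoundary i j s := by
  cases s <;> simp only [OnBoundary, shift] at h ⊢ <;> omega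

/-- Translate the deformation of the block. Anything over a tile outside the block, arcs and black
cells alike, misses the open cell of the block and is fixed. The larger cell contains the smaller
one, so the complement of the former is fixed as well. -/
theorem CellDeform.of_block {k n : ℕ} {A B : Mosaic k} {M N : Mosaic n} (h : CellDeform A B)
    {p q : ℕ} (hp : p + k ≤ n) (hq : q + k ≤ n)
    (hM : ∀ i j, M (shift p hp i) (shift q hq j) = A i j)
    (hN : ∀ i j, N (shift p hp i) (shift q hq j) = B i j)
    (hMN : ∀ i j, ¬InBlock k p q i j → M i j = N i j) : CellDeform M N := by
  refine ⟨fun i j l => ?_, fun i j s hs => ?_, ?_⟩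
  · by_cases hb : InBlock k p q i j
    · obtain ⟨i', j', rfl, rfl⟩ := hb.exists_shift hp hq
      rw [hM, hN]
      exact h.vertex_iff _ _ _
    · rw [hMN _ _ hb]
  · by_cases hb : InBlock k p q i j
    · obtain ⟨i', j', rfl, rfl⟩ := hb.exists_shift hp hq
      rw [hM, hN]
      exact h.sides_iff _ _ _ (onBoundary_of_shift hp hq hs)
    · rw [hMN _ _ hb]
  · have outside : ∀ (i j : Fin n) x, ¬InBlock k p q i j → x ∈ tilePrism i j →
        x - corner p q ∈ A.frozenPart := by
      intro i j x hb hx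
      left
      rw [mem_compl_iff, sub_corner_mem_openCell, add_zero, add_zero]
      refine notMem_openCell_of_tilePrism hx ?_
      simp only [InBlock] at hb
      omega
    have hR : {x | ∃ i j, ¬InBlock k p q i j ∧ x ∈ arcsAt i j (M i j)} =
        {x | ∃ i j, ¬InBlock k p q i j ∧ x ∈ arcsAt i j (N i j)} := by
      ext x
      refine exists_congr fun i => exists_congr fun j => and_congr_right fun hb => ?_
      rw [hMN _ _ hb]
    rw [tamePart_eq_block_union hp hq hM, tamePart_eq_block_union hp hq hN, ← hR]
    refine ((h.deforms.image (Homeomorph.addRight (corner p q))).union ?_).mono ?_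
    · rintro x ⟨i, j, hb, hx⟩
      exact mem_image_add_corner_iff.2 (outside i j x hb (arcsAt_subset_tilePrism _ _ _ hx))
    · rintro x (hx | ⟨i, j, l, hl, hx⟩) <;> refine mem_image_add_corner_iff.2 ?_
      · left
        rw [mem_compl_iff, sub_corner_mem_openCell, add_zero, add_zero]
        refine fun hx' => hx (openCell_subset_openCell ?_ ?_ ?_ ?_ hx')
        · positivity
        · positivity
        · rw [zero_add]
          exact_mod_cast hp
        · rw [zero_add]
          exact_mod_cast hq
      · by_cases hb : InBlock k p q i j
        · obtain ⟨i', j', rfl, rfl⟩ := hb.exists_shift hp hq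
          refine Or.inr ⟨i', j', l, by rw [← hM, hl], ?_⟩
          rw [sub_corner_mem_closedCell]
          simpa [shift] using hx
        · exact outside i j x hb (closedCell_subset_tilePrism _ _ hx)

/-- Deformations of mosaics of arbitrary dimensions. -/
inductive RVDeform : RVMosaic → RVMosaic → Prop
  | mk {n : ℕ} {M N : Mosaic n} (h : CellDeform M N) : RVDeform ⟨n, M⟩ ⟨n, N⟩

theorem MosaicMove.rvDeform {M N : RVMosaic} (h : MosaicMove M N) : RVDeform M N := by
  obtain ⟨p, q, hp, hq, hAB, hM, hN, hMN⟩ := h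
  refine ⟨hAB.cellDeform.of_block hp hq hM hN fun i j hb => hMN i j ?_⟩
  rintro ⟨⟨i', rfl⟩, j', rfl⟩
  exact hb (inBlock_shift hp hq i' j')

theorem MoveEquivalent.rvDeform {M N : RVMosaic} (h : MoveEquivalent M N) : RVDeform M N := by
  induction h with
  | rel _ _ h => exact h.rvDeform
  | refl M => exact ⟨CellDeform.refl M.2⟩
  | symm _ _ _ ih =>
    obtain ⟨h⟩ := ih
    exact ⟨h.symm⟩
  | trans _ _ _ _ _ ih ih' =>
    obtain ⟨h⟩ := ih
    obtain ⟨h'⟩ := ih'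
    exact ⟨h.trans h'⟩

/-! ### Gluing homeomorphisms with disjoint supports -/

section Glue

variable {X ι : Type*} {U : ι → Set X}

open Classical in
/-- The map that is `f i` on `U i` for every `i`, and the identity elsewhere. -/
noncomputable def glue (U : ι → Set X) (f : ι → X → X) (x : X) : X :=
  if h : ∃ i, x ∈ U i then f h.choose x else x

theorem glue_of_mem (hU : Pairwise fun i j => Disjoint (U i) (U j)) (f : ι → X → X) {i : ι} {x : X}
    (hx : x ∈ U i) : glue U f x = f i x := by
  have h : ∃ i, x ∈ U i := ⟨i, hx⟩
  rw [glue, dif_pos h]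
  by_contra hne
  have : h.choose ≠ i := fun hi => hne (by rw [hi])
  exact (hU this).le_bot ⟨h.choose_spec, hx⟩

theorem glue_of_notMem (f : ι → X → X) {x : X} (hx : ∀ i, x ∉ U i) : glue U f x = x := by
  rw [glue, dif_neg]
  rintro ⟨i, hi⟩
  exact hx i hi

/-- The critical points are those outside every `U i`, where infinitely many `U i` may accumulate.
All but finitely many of the maps move points by less than `ε / 2`; the finitely many others are
continuous and fix the point. -/
theorem continuous_glue [MetricSpace X] (hU : Pairwise fun i j => Disjoint (U i) (U j)) (hopen : ∀ i, IsOpen (U i))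
    {f : ι → X → X} (hf : ∀ i, Continuous (f i)) (hfix : ∀ i, ∀ x ∉ U i, f i x = x)
    (hsmall : ∀ ε > 0, {i | ∃ x, ε ≤ dist (f i x) x}.Finite) : Continuous (glue U f) := by
  rw [continuous_iff_continuousAt]
  intro x
  by_cases hx : ∃ i, x ∈ U i
  · obtain ⟨i, hi⟩ := hx
    refine (hf i).continuousAt.congr ?_
    filter_upwards [(hopen i).mem_nhds hi] with y hy
    exact (glue_of_mem hU f hy).symm
  · push Not at hx
    rw [ContinuousAt, glue_of_notMem f hx, Metric.tendsto_nhds]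
    intro ε hε
    have hfin := hsmall (ε / 2) (by positivity)
    have h1 : ∀ᶠ y in nhds x, ∀ i ∈ {i | ∃ x, ε / 2 ≤ dist (f i x) x}, dist (f i y) x < ε := by
      rw [Filter.eventually_all_finite hfin]
      intro i _
      have := Metric.tendsto_nhds.1 ((hf i).tendsto x) ε hε
      rwa [hfix i x (hx i)] at this
    filter_upwards [h1, Metric.ball_mem_nhds x (half_pos hε)] with y hy hyx
    rw [Metric.mem_ball] at hyx
    by_cases h : ∃ i, y ∈ U i
    · obtain ⟨i, hi⟩ := h
      rw [glue_of_mem hU f hi]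
      by_cases hb : i ∈ {i | ∃ x, ε / 2 ≤ dist (f i x) x}
      · exact hy i hb
      · simp only [mem_ofPred_eq, not_exists, not_le] at hb
        linarith [dist_triangle (f i y) y x, hb y]
    · push Not at h
      rw [glue_of_notMem f h]
      linarith

/-- Each `f i` fixes the complement of `U i` and so preserves `U i`. Hence the inverses glue in the
same way, and to an inverse. -/
theorem exists_glued_homeomorph [MetricSpace X] (hU : Pairwise fun i j => Disjoint (U i) (U j))
    (hopen : ∀ i, IsOpen (U i)) (f : ι → X ≃ₜ X) (hfix : ∀ i, ∀ x ∉ U i, f i x = x)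
    (hsmall : ∀ ε > 0, {i | ∃ x, ε ≤ dist (f i x) x}.Finite) :
    ∃ H : X ≃ₜ X, (∀ i, ∀ x ∈ U i, H x = f i x) ∧ ∀ x, (∀ i, x ∉ U i) → H x = x := by
  have hmem : ∀ i x, x ∈ U i → f i x ∈ U i := by
    intro i x hx
    by_contra h
    rw [(f i).injective (hfix i _ h)] at h
    exact h hx
  have hfix' : ∀ i, ∀ x ∉ U i, (f i).symm x = x := by
    intro i x hx
    rw [Homeomorph.symm_apply_eq, hfix i x hx]
  have hmem' : ∀ i x, x ∈ U i → (f i).symm x ∈ U i := by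
    intro i x hx
    by_contra h
    have := hfix i _ h
    rw [Homeomorph.apply_symm_apply] at this
    rw [← this] at h
    exact h hx
  have hinv : ∀ g g' : ι → X → X, (∀ i x, x ∈ U i → g i x ∈ U i) → (∀ i x, g' i (g i x) = x) →
      ∀ x, glue U g' (glue U g x) = x := by
    intro g g' hg hgg x
    by_cases hx : ∃ i, x ∈ U i
    · obtain ⟨i, hi⟩ := hx
      rw [glue_of_mem hU g hi, glue_of_mem hU g' (hg i x hi), hgg]
    · push Not at hx
      rw [glue_of_notMem g hx, glue_of_notMem g' hx]
  refine ⟨⟨⟨glue U fun i => f i, glue U fun i => (f i).symm, hinv _ _ hmem (by simp),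
    hinv _ _ hmem' (by simp)⟩, ?_, ?_⟩, fun i x hx => glue_of_mem hU (fun i => f i) hx,
    fun x hx => glue_of_notMem (fun i => f i) hx⟩
  · exact continuous_glue hU hopen (fun i => (f i).continuous) hfix hsmall
  · refine continuous_glue hU hopen (fun i => (f i).symm.continuous) hfix' fun ε hε => ?_
    refine (hsmall ε hε).subset ?_
    rintro i ⟨x, hx⟩
    -- The displacement of the inverse at `x` is that of `f i` at the preimage of `x`.
    exact ⟨(f i).symm x, by rwa [Homeomorph.apply_symm_apply, dist_comm]⟩

end Glue

/-! ### Black tiles of rotated mosaics -/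

theorem vertexAt_rotate {n : ℕ} {M : Mosaic n} {p : ℕ × ℕ} {k : VertexKind}
    (h : M.VertexAt p.1 p.2 k) :
    M.rotate.VertexAt (rotatePos n p).1 (rotatePos n p).2 k.unturn := by
  obtain ⟨ha, hb, h⟩ := h
  have hrev : (⟨n - 1 - p.1, by omega⟩ : Fin n).rev = ⟨p.1, ha⟩ :=
    Fin.ext (by simp [Fin.val_rev]; omega)
  refine ⟨hb, by simp only [rotatePos]; omega, ?_⟩
  simp only [Mosaic.rotate, Matrix.of_apply, rotatePos, hrev, Tile.rotate_eq_vertex, h]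
  cases k <;> rfl

theorem vertexAt_flip {n : ℕ} {M : Mosaic n} {p : ℕ × ℕ} {k : VertexKind}
    (h : M.VertexAt p.1 p.2 k) : M.flip.VertexAt p.swap.1 p.swap.2 k.unturn := by
  obtain ⟨ha, hb, h⟩ := h
  refine ⟨hb, ha, ?_⟩
  simp only [Mosaic.flip, Matrix.of_apply, Prod.fst_swap, Prod.snd_swap, Tile.flip_eq_vertex, h]
  cases k <;> rfl

theorem vertexAt_act {n : ℕ} {M : Mosaic n} {p : ℕ × ℕ} {k : VertexKind} (g : DihedralGroup 4)
    (h : M.VertexAt p.1 p.2 k) :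
    ∃ k', (M.act g).VertexAt (actPos n g p).1 (actPos n g p).2 k' := by
  have key : ∀ m, ∃ k', (Mosaic.rotate^[m] M).VertexAt ((rotatePos n)^[m] p).1
      ((rotatePos n)^[m] p).2 k' := by
    intro m
    induction m with
    | zero => exact ⟨k, h⟩
    | succ m ih =>
      obtain ⟨k', ih⟩ := ih
      simp only [Function.iterate_succ_apply']
      exact ⟨_, vertexAt_rotate ih⟩
  cases g with
  | r i => exact key _
  | sr i =>
    obtain ⟨k', hk⟩ := key i.val
    exact ⟨_, vertexAt_flip hk⟩

/-- Injectivity holds only inside the square, because of the truncated subtraction in `rotatePos`.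
-/
theorem actPos_injOn (n : ℕ) (g : DihedralGroup 4) :
    InjOn (actPos n g) {p | p.1 < n ∧ p.2 < n} := by
  have hmaps : MapsTo (rotatePos n) {p | p.1 < n ∧ p.2 < n} {p | p.1 < n ∧ p.2 < n} := by
    rintro p ⟨h1, h2⟩
    simp only [rotatePos, mem_ofPred_eq]
    omega
  have hinj : InjOn (rotatePos n) {p | p.1 < n ∧ p.2 < n} := by
    rintro ⟨a, b⟩ ⟨h1, h2⟩ ⟨c, d⟩ ⟨h3, h4⟩ h
    simp only [rotatePos, Prod.mk.injEq] at *
    omega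
  cases g with
  | r i => exact hinj.iterate hmaps _
  | sr i => exact Prod.swap_injective.comp_injOn (hinj.iterate hmaps _)

/-! ### Rooted trees -/

theorem RootedTree.exists_child_le {T : RootedTree} {u w : T} (h : u < w) : ∃ c, u ⋖ c ∧ c ≤ w := by
  obtain ⟨n, hn⟩ := exists_pred_iterate_of_le h.le
  induction n generalizing w with
  | zero => exact absurd hn h.ne'
  | succ n ih =>
    have hcov : Order.pred w ⋖ w := Order.pred_covBy_of_not_isMin (not_isMin_of_lt h)
    rcases (Order.le_pred_of_lt h).eq_or_lt with heq | hlt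
    · exact ⟨w, heq ▸ hcov, le_rfl⟩
    · obtain ⟨c, hc, hcw⟩ := ih hlt (by rwa [Function.iterate_succ_apply] at hn)
      exact ⟨c, hc, hcw.trans hcov.le⟩

theorem RootedTree.induction {T : RootedTree} {P : T → Prop} (bot : P ⊥)
    (edge : ∀ e : Edge T, P e.1.1 → P e.1.2) (v : T) : P v := by
  obtain ⟨n, hn⟩ := (bot_le (a := v)).exists_pred_iterate
  induction n generalizing v with
  | zero => exact (show v = ⊥ from hn) ▸ bot
  | succ n ih =>
    by_cases hv : v = ⊥
    · exact hv ▸ bot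
    · exact edge ⟨(Order.pred v, v), Order.pred_covBy_of_not_isMin (by rwa [isMin_iff_eq_bot])⟩
        (ih _ (by rwa [Function.iterate_succ_apply] at hn))

/-- Two different vertices are comparable, or lie in the subtrees of two different children. -/
theorem RootedTree.exists_children {T : RootedTree} {u w : T} (h : ¬u ≤ w) (h' : ¬w ≤ u) :
    ∃ e e' : Edge T, e.1.1 = e'.1.1 ∧ e ≠ e' ∧ e.1.2 ≤ u ∧ e'.1.2 ≤ w := by
  -- The branching point is the meet. A child of it below both `u` and `w` would lie below the meet,
  -- so the two children differ.
  obtain ⟨c, hc, hcu⟩ := exists_child_le (u := u ⊓ w) (w := u) (by simpa using h)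
  obtain ⟨d, hd, hdw⟩ := exists_child_le (u := u ⊓ w) (w := w) (by simpa using h')
  refine ⟨⟨(_, c), hc⟩, ⟨(_, d), hd⟩, rfl, fun he => ?_, hcu, hdw⟩
  obtain rfl : c = d := congrArg (fun e : Edge T => e.1.2) he
  exact hc.lt.not_ge (le_inf hcu hdw)

/-! ### Frames -/

/-- Placing the child means shrinking it to unit size, moving it into the targeted tile, and then
placing the parent. -/
theorem Frame.child_map (f : Frame) (n m : ℕ) (x : OrientedEmbedding) (y : Space) :
    (f.child n m x).map y = f.map ((m : ℝ)⁻¹ • y +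
      corner (actPos n f.orientation (x.row, x.col)).1 (actPos n f.orientation (x.row, x.col)).2) := by
  simp only [Frame.map, Frame.child, smul_add, smul_smul, div_eq_mul_inv]
  abel

theorem depthIn_smul {m : ℕ} (hm : m ≠ 0) (y : Space) :
    depthIn 0 0 1 ((m : ℝ)⁻¹ • y) = (m : ℝ)⁻¹ * depthIn 0 0 m y := by
  have hm' : (0 : ℝ) ≤ (m : ℝ)⁻¹ := by positivity
  have : (m : ℝ) ≠ 0 := by exact_mod_cast hm
  simp only [depthIn, mul_min_of_nonneg _ _ hm']
  simp
  congr 2 <;> field_simp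

theorem add_corner_mem_openCell {p q : ℕ} {y : Space} :
    y + corner p q ∈ openCell p q 1 ↔ y ∈ openCell 0 0 1 := by
  have := sub_corner_mem_openCell (a := 0) (b := 0) (k := 1) (p := p) (q := q) (x := y + corner p q)
  simpa using this.symm

theorem add_corner_mem_closedCell {p q : ℕ} {y : Space} :
    y + corner p q ∈ closedCell p q 1 ↔ y ∈ closedCell 0 0 1 := by
  have := sub_corner_mem_closedCell (a := 0) (b := 0) (k := 1) (p := p) (q := q)
    (x := y + corner p q)
  simpa using this.symm

/-- The shrinking is towards height `0`, not towards the middle height. The lower bound `-3d` simply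
scales with the distance `d`, and the upper bound becomes `m⁻¹ + 3d/m`, at most `1 + 3d/m`. -/
theorem smul_mem_openCell {m : ℕ} (hm : m ≠ 0) {y : Space} (hy : y ∈ openCell 0 0 m) :
    (m : ℝ)⁻¹ • y ∈ openCell 0 0 1 := by
  obtain ⟨h1, h2⟩ := hy
  have hm1 : (1 : ℝ) ≤ m := by exact_mod_cast Nat.one_le_iff_ne_zero.2 hm
  have hi : 0 < (m : ℝ)⁻¹ := by positivity
  have hi1 : (m : ℝ)⁻¹ ≤ 1 := inv_le_one_of_one_le₀ hm1
  refine ⟨by rw [depthIn_smul hm]; positivity, ?_⟩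
  rw [depthIn_smul hm]
  rw [abs_lt] at h2 ⊢
  simp only [PiLp.smul_apply, smul_eq_mul]
  constructor <;> nlinarith

theorem smul_mem_closedCell {m : ℕ} (hm : m ≠ 0) {y : Space} (hy : y ∈ closedCell 0 0 m) :
    (m : ℝ)⁻¹ • y ∈ closedCell 0 0 1 := by
  obtain ⟨h1, h2⟩ := hy
  have hm1 : (1 : ℝ) ≤ m := by exact_mod_cast Nat.one_le_iff_ne_zero.2 hm
  have hi : 0 < (m : ℝ)⁻¹ := by positivity
  have hi1 : (m : ℝ)⁻¹ ≤ 1 := inv_le_one_of_one_le₀ hm1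
  refine ⟨by rw [depthIn_smul hm]; positivity, ?_⟩
  rw [depthIn_smul hm]
  rw [abs_le] at h2 ⊢
  simp only [PiLp.smul_apply, smul_eq_mul]
  constructor <;> nlinarith

theorem closedCell_subset_closedCell {a b k a' b' k' : ℝ} (ha : a' ≤ a) (hb : b' ≤ b)
    (hak : a + k ≤ a' + k') (hbk : b + k ≤ b' + k') : closedCell a b k ⊆ closedCell a' b' k' := by
  rintro x ⟨h1, h2⟩
  have := depthIn_le_depthIn ha hb hak hbk x
  exact ⟨h1.trans this, by linarith⟩

theorem openCell_subset_closedCell (a b k : ℝ) : openCell a b k ⊆ closedCell a b k :=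
  fun _ h => ⟨h.1.le, h.2.le⟩

theorem tile_openCell_subset {n i j : ℕ} (hi : i < n) (hj : j < n) :
    openCell i j 1 ⊆ openCell 0 0 n := by
  refine openCell_subset_openCell ?_ ?_ ?_ ?_
  · positivity
  · positivity
  · rw [zero_add]
    exact_mod_cast hi
  · rw [zero_add]
    exact_mod_cast hj

theorem tile_closedCell_subset {n i j : ℕ} (hi : i < n) (hj : j < n) :
    closedCell i j 1 ⊆ closedCell 0 0 n := by
  refine closedCell_subset_closedCell ?_ ?_ ?_ ?_
  · positivity
  · positivity
  · rw [zero_add]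
    exact_mod_cast hi
  · rw [zero_add]
    exact_mod_cast hj

theorem tamePart_subset_closedCell {n : ℕ} (M : Mosaic n) : M.tamePart ⊆ closedCell 0 0 n := by
  rw [tamePart_eq_arcsAt]
  refine iUnion_subset fun i => iUnion_subset fun j => fun x hx => ?_
  obtain ⟨⟨h1, h2⟩, h3, h4⟩ := arcsAt_subset_tilePrism _ _ _ hx
  obtain ⟨h5, h6⟩ := arcsAt_height _ _ _ hx
  refine tile_closedCell_subset i.2 j.2 ?_
  have hd : 0 ≤ depthIn i j 1 x := by
    simp only [depthIn, le_min_iff]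
    refine ⟨⟨?_, ?_⟩, ?_, ?_⟩ <;> linarith
  exact ⟨hd, by rw [abs_le]; constructor <;> linarith⟩

theorem tamePart_disjoint_openCell {n : ℕ} {M : Mosaic n} {a b : ℕ} {k : VertexKind}
    (h : M.VertexAt a b k) : Disjoint M.tamePart (openCell a b 1) := by
  obtain ⟨ha, hb, h⟩ := h
  rw [disjoint_left, tamePart_eq_arcsAt]
  intro x hx
  simp only [mem_iUnion] at hx
  obtain ⟨i, j, hx⟩ := hx
  have hne : ¬(i = ⟨a, ha⟩ ∧ j = ⟨b, hb⟩) := by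
    rintro ⟨rfl, rfl⟩
    rw [h] at hx
    simp [arcsAt, Tile.tameArcs] at hx
  have := notMem_openCell_of_tilePrism (p := a) (q := b) (k := 1)
    (arcsAt_subset_tilePrism _ _ _ hx) (by simp only [Fin.ext_iff] at hne; omega)
  simpa using this

theorem disjoint_cells {a b a' b' : ℕ} (h : (a, b) ≠ (a', b')) :
    Disjoint (closedCell a b 1) (openCell a' b' 1) := by
  rw [disjoint_left]
  intro x hx
  have := notMem_openCell_of_tilePrism (p := a') (q := b') (k := 1)
    (closedCell_subset_tilePrism _ _ hx) (by simp only [ne_eq, Prod.mk.injEq] at h; omega)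
  simpa using this

theorem isOpen_compl_frozenPart {n : ℕ} (M : Mosaic n) : IsOpen M.frozenPartᶜ := by
  rw [isOpen_compl_iff]
  refine (isOpen_openCell _ _ _).isClosed_compl.union ?_
  have : {x | ∃ (i j : Fin n) (k : VertexKind), M i j = vertex k ∧ x ∈ closedCell i j 1} =
      ⋃ p ∈ {p : Fin n × Fin n | ∃ k, M p.1 p.2 = vertex k}, closedCell p.1 p.2 1 := by
    ext x
    simp
  rw [this]
  exact (toFinite _).isClosed_biUnion fun _ _ => isClosed_closedCell _ _ _

/-- Over a unit square the depth is at most `1/2`, so heights differ from `1/2` by at most `2`. The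
squared distance is then at most `1 + 1 + 16`, less than `25`. -/
theorem dist_le_of_mem_closedCell {a b : ℕ} {x y : Space} (hx : x ∈ closedCell a b 1)
    (hy : y ∈ closedCell a b 1) : dist x y ≤ 5 := by
  have hb : ∀ z ∈ closedCell a b 1, |z 2 - 1 / 2| ≤ 2 := by
    rintro z ⟨-, h⟩
    have h1 : depthIn a b 1 z ≤ z 0 - a := (min_le_left _ _).trans (min_le_left _ _)
    have h2 : depthIn a b 1 z ≤ a + 1 - z 0 := (min_le_left _ _).trans (min_le_right _ _)
    linarith
  obtain ⟨⟨h1, h2⟩, h3, h4⟩ := closedCell_subset_tilePrism _ _ hx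
  obtain ⟨⟨g1, g2⟩, g3, g4⟩ := closedCell_subset_tilePrism _ _ hy
  have h5 := abs_le.1 (hb x hx)
  have g5 := abs_le.1 (hb y hy)
  rw [EuclideanSpace.dist_eq, Fin.sum_univ_three]
  refine Real.sqrt_le_iff.2 ⟨by norm_num, ?_⟩
  simp only [Real.dist_eq, sq_abs]
  have e1 : (x 0 - y 0) ^ 2 ≤ 1 := by nlinarith
  have e2 : (x 1 - y 1) ^ 2 ≤ 1 := by nlinarith
  have e3 : (x 2 - y 2) ^ 2 ≤ 16 := by nlinarith
  linarith

/-! ### Faces of the unit cube -/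

/-- The face of the unit cube on a given side. -/
def Side.face : Side → Set Space
  | north => {x | x 0 ∈ Icc (0 : ℝ) 0 ∧ x 1 ∈ Icc (0 : ℝ) 1 ∧ x 2 ∈ Icc (0 : ℝ) 1}
  | south => {x | x 0 ∈ Icc (1 : ℝ) 1 ∧ x 1 ∈ Icc (0 : ℝ) 1 ∧ x 2 ∈ Icc (0 : ℝ) 1}
  | west => {x | x 0 ∈ Icc (0 : ℝ) 1 ∧ x 1 ∈ Icc (0 : ℝ) 0 ∧ x 2 ∈ Icc (0 : ℝ) 1}
  | east => {x | x 0 ∈ Icc (0 : ℝ) 1 ∧ x 1 ∈ Icc (1 : ℝ) 1 ∧ x 2 ∈ Icc (0 : ℝ) 1}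

theorem convex_face (s : Side) : Convex ℝ s.face := by
  have h (l : Fin 3) (a b : ℝ) : Convex ℝ {x : Space | x l ∈ Icc a b} :=
    (convex_Icc a b).is_linear_preimage (f := fun x : Space => x l)
      ⟨fun _ _ => rfl, fun _ _ => rfl⟩
  cases s <;> exact (h 0 _ _).inter ((h 1 _ _).inter (h 2 _ _))

theorem point_mem_face (s : Side) : s.point ∈ s.face := by
  cases s <;> simp [Side.face, Side.point] <;> norm_num

/-- With `point_mem_face` and convexity, this puts a whole connecting segment in one face of the
cube of the targeted tile, although its two ends have different heights. -/
theorem smul_point_mem_face {m : ℕ} {i j : Fin m} {s : Side} (h : OnBoundary i j s) :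
    (m : ℝ)⁻¹ • (s.point + corner i j) ∈ s.face := by
  have hm : (1 : ℝ) ≤ m := by exact_mod_cast i.pos
  have hi : (i : ℝ) + 1 ≤ m := by exact_mod_cast i.2
  have hj : (j : ℝ) + 1 ≤ m := by exact_mod_cast j.2
  have hi0 : (0 : ℝ) ≤ (i : ℕ) := by positivity
  have hj0 : (0 : ℝ) ≤ (j : ℕ) := by positivity
  have key : ∀ y : ℝ, 0 ≤ y → y ≤ m → (m : ℝ)⁻¹ * y ∈ Icc (0 : ℝ) 1 := by
    intro y h0 h1
    refine ⟨by positivity, ?_⟩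
    rw [inv_mul_le_iff₀ (by positivity)]
    linarith
  have hne : (m : ℝ) ≠ 0 := by positivity
  cases s
  · have h' : (i : ℝ) = 0 := by exact_mod_cast h
    refine ⟨?_, ?_, ?_⟩ <;> simp only [Side.point, corner, PiLp.smul_apply, PiLp.add_apply,
      smul_eq_mul]
    · simp [h']
    · exact key _ (by simp; linarith) (by simp; linarith)
    · exact key _ (by simp) (by simp; linarith)
  · have h' : (j : ℝ) + 1 = m := by exact_mod_cast h
    refine ⟨?_, ?_, ?_⟩ <;> simp only [Side.point, corner, PiLp.smul_apply, PiLp.add_apply,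
      smul_eq_mul]
    · exact key _ (by simp; linarith) (by simp; linarith)
    · simp [add_comm (1 : ℝ), h', hne]
    · exact key _ (by simp) (by simp; linarith)
  · have h' : (i : ℝ) + 1 = m := by exact_mod_cast h
    refine ⟨?_, ?_, ?_⟩ <;> simp only [Side.point, corner, PiLp.smul_apply, PiLp.add_apply,
      smul_eq_mul]
    · simp [add_comm (1 : ℝ), h', hne]
    · exact key _ (by simp; linarith) (by simp; linarith)
    · exact key _ (by simp) (by simp; linarith)
  · have h' : (j : ℝ) = 0 := by exact_mod_cast h
    refine ⟨?_, ?_, ?_⟩ <;> simp only [Side.point, corner, PiLp.smul_apply, PiLp.add_apply,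
      smul_eq_mul]
    · exact key _ (by simp; linarith) (by simp; linarith)
    · simp [h']
    · exact key _ (by simp) (by simp; linarith)

theorem depthIn_of_mem_face {s : Side} {x : Space} (h : x ∈ s.face) : depthIn 0 0 1 x = 0 := by
  cases s <;> obtain ⟨⟨h1, h2⟩, ⟨h3, h4⟩, -⟩ := h <;> apply le_antisymm <;>
    simp only [depthIn, le_min_iff, min_le_iff]
  all_goals first
    | (refine ⟨⟨?_, ?_⟩, ?_, ?_⟩ <;> linarith)
    | (left; left; linarith)
    | (left; right; linarith)
    | (right; left; linarith)
    | (right; right; linarith)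

theorem face_subset_closedCell (s : Side) : s.face ⊆ closedCell 0 0 1 := by
  intro x hx
  have h2 : x 2 ∈ Icc (0 : ℝ) 1 := by cases s <;> exact hx.2.2
  refine ⟨(depthIn_of_mem_face hx).ge, ?_⟩
  rw [depthIn_of_mem_face hx, abs_le]
  constructor <;> linarith [h2.1, h2.2]

theorem face_disjoint_openCell (s : Side) : Disjoint s.face (openCell 0 0 1) :=
  disjoint_left.2 fun _ hx h => (depthIn_of_mem_face hx ▸ h.1).false

/-! ### Regions of the vertices of a tree mosaic -/

theorem Frame.map_segment (f : Frame) (a b : Space) :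
    f.map '' segment ℝ a b = segment ℝ (f.map a) (f.map b) := by
  refine image_segment_of_affine (fun a b s t hst => ?_) a b
  rw [Frame.map, Frame.map, Frame.map, smul_add, smul_add, smul_add, add_add_add_comm, ← add_smul,
    hst, one_smul, smul_comm s, smul_comm t]

/-- The similarity of a frame as a homeomorphism. -/
noncomputable def Frame.homeomorph (f : Frame) (h : f.scale ≠ 0) : Space ≃ₜ Space :=
  (Homeomorph.smulOfNeZero f.scale h).trans (Homeomorph.addRight f.position)

theorem Frame.dist_map (f : Frame) (h : 0 ≤ f.scale) (x y : Space) :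
    dist (f.map x) (f.map y) = f.scale * dist x y := by
  rw [Frame.map, Frame.map, dist_add_right, dist_smul₀, Real.norm_of_nonneg h]

namespace TreeMosaic

variable {T : RootedTree} {M : TreeMosaic T}

theorem ne_bot_of_edge (e : Edge T) : e.1.2 ≠ ⊥ := fun h => not_lt_bot (h ▸ e.2.lt)

theorem eq_bot_or_edge (v : T) : v = ⊥ ∨ ∃ e : Edge T, e.1.2 = v :=
  RootedTree.induction (P := fun v => v = ⊥ ∨ ∃ e : Edge T, e.1.2 = v) (Or.inl rfl)
    (fun e _ => Or.inr ⟨e, rfl⟩) v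

/-- The position of the black tile targeted by an edge, in the placed mosaic. -/
noncomputable def target (M : TreeMosaic T) (e : Edge T) : ℕ × ℕ :=
  actPos (M.dim e.1.1) (M.frame e.1.1).orientation ((M.embedding e).row, (M.embedding e).col)

/-- The placed cell of the mosaic of a vertex. -/
noncomputable def region (M : TreeMosaic T) (v : T) : Set Space :=
  (M.frame v).map '' openCell 0 0 (M.dim v)

/-- The placed closed cell of the mosaic of a vertex. -/
noncomputable def closedRegion (M : TreeMosaic T) (v : T) : Set Space :=
  (M.frame v).map '' closedCell 0 0 (M.dim v)

/-- The part of space that may be moved in a deformation of the mosaic of a vertex. -/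
noncomputable def support (M : TreeMosaic T) (v : T) : Set Space :=
  (M.frame v).map '' (M.placedMosaic v).frozenPartᶜ

theorem frame_edge_map (e : Edge T) (y : Space) : (M.frame e.1.2).map y =
    (M.frame e.1.1).map ((M.dim e.1.2 : ℝ)⁻¹ • y + corner (M.target e).1 (M.target e).2) := by
  rw [frame_edge, Frame.child_map, target]

theorem support_subset_region (v : T) : M.support v ⊆ M.region v := by
  refine image_mono fun x hx => ?_
  by_contra h
  exact hx (Or.inl h)

theorem region_subset_closedRegion (v : T) : M.region v ⊆ M.closedRegion v :=
  image_mono (openCell_subset_closedCell _ _ _)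

end TreeMosaic

namespace TreeMosaic.IsTreeKnotMosaic

variable {T : RootedTree} {M : TreeMosaic T}

/-! ### Supports of the deformations of the mosaics of a tree mosaic -/

theorem three_le_dim (hM : M.IsTreeKnotMosaic) (e : Edge T) : 3 ≤ M.dim e.1.2 :=
  hM.suitablyConnected.three_le_dim e.1.2 (ne_bot_of_edge e)

theorem dim_ne_zero (hM : M.IsTreeKnotMosaic) (e : Edge T) : M.dim e.1.2 ≠ 0 := by
  have := hM.three_le_dim e
  omega

theorem scale_pos (hM : M.IsTreeKnotMosaic) (v : T) : 0 < (M.frame v).scale := by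
  refine RootedTree.induction (P := fun v => 0 < (M.frame v).scale) ?_ (fun e he => ?_) v
  · simp [frame_bot]
  · have : 0 < (M.dim e.1.2 : ℝ) := by exact_mod_cast Nat.pos_of_ne_zero (hM.dim_ne_zero e)
    simp only [frame_edge, Frame.child]
    positivity

theorem depth_bot : depth (⊥ : T) = 0 := by simp [depth]

/-- The dimension of the root does not enter; every further vertex divides the scale by its own
dimension, at least `3`. -/
theorem scale_le (hM : M.IsTreeKnotMosaic) (v : T) : (M.frame v).scale ≤ (1 / 3) ^ depth v := by
  refine RootedTree.induction (P := fun v => (M.frame v).scale ≤ (1 / 3) ^ depth v) ?_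
    (fun e he => ?_) v
  · rw [frame_bot, depth_bot, pow_zero]
  · have h3 : (3 : ℝ) ≤ M.dim e.1.2 := by exact_mod_cast hM.three_le_dim e
    have h0 := (hM.scale_pos e.1.1).le
    simp only [frame_edge, Frame.child, depth_edge, pow_succ]
    calc (M.frame e.1.1).scale / M.dim e.1.2 ≤ (M.frame e.1.1).scale / 3 := by gcongr
      _ ≤ (1 / 3) ^ depth e.1.1 / 3 := by gcongr
      _ = _ := by ring

theorem map_injective (hM : M.IsTreeKnotMosaic) (v : T) : Function.Injective (M.frame v).map :=
  ((M.frame v).homeomorph (hM.scale_pos v).ne').injective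

theorem targeted (hM : M.IsTreeKnotMosaic) (e : Edge T) : ∃ k,
    (M.mosaic e.1.1).2.VertexAt (M.embedding e).row (M.embedding e).col k :=
  (hM.wellDefined e.1.1).mapsTo rfl

theorem vertexAt_target (hM : M.IsTreeKnotMosaic) (e : Edge T) : ∃ k,
    (M.placedMosaic e.1.1).VertexAt (M.target e).1 (M.target e).2 k := by
  obtain ⟨k, hk⟩ := hM.targeted e
  exact vertexAt_act (p := ((M.embedding e).row, (M.embedding e).col)) _ hk

theorem target_ne (hM : M.IsTreeKnotMosaic) {e e' : Edge T} (h : e.1.1 = e'.1.1) (hne : e ≠ e') :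
    M.target e ≠ M.target e' := by
  intro ht
  obtain ⟨_, h1, h2, _⟩ := hM.targeted e
  obtain ⟨_, h3, h4, _⟩ := hM.targeted e'
  refine hne ((hM.wellDefined e.1.1).injOn rfl h.symm ?_)
  rw [target, target, ← h] at ht
  rw [← h] at h3 h4
  exact actPos_injOn _ _ ⟨h1, h2⟩ ⟨h3, h4⟩ ht

theorem region_subset_tile (hM : M.IsTreeKnotMosaic) (e : Edge T) : M.region e.1.2 ⊆
    (M.frame e.1.1).map '' openCell (M.target e).1 (M.target e).2 1 := by
  rintro _ ⟨y, hy, rfl⟩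
  rw [frame_edge_map]
  exact mem_image_of_mem _ (add_corner_mem_openCell.2 (smul_mem_openCell (hM.dim_ne_zero e) hy))

theorem closedRegion_subset_tile (hM : M.IsTreeKnotMosaic) (e : Edge T) : M.closedRegion e.1.2 ⊆
    (M.frame e.1.1).map '' closedCell (M.target e).1 (M.target e).2 1 := by
  rintro _ ⟨y, hy, rfl⟩
  rw [frame_edge_map]
  exact mem_image_of_mem _ (add_corner_mem_closedCell.2 (smul_mem_closedCell (hM.dim_ne_zero e) hy))

theorem region_anti (hM : M.IsTreeKnotMosaic) {u : T} (w : T) (h : u ≤ w) :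
    M.region w ⊆ M.region u := by
  revert h
  refine RootedTree.induction (P := fun w => u ≤ w → M.region w ⊆ M.region u) (fun h => ?_)
    (fun e ih h => ?_) w
  · rw [le_bot_iff.1 h]
  · rcases h.eq_or_lt with rfl | hlt
    · rfl
    · refine Subset.trans ?_ (ih (e.2.pred_eq ▸ Order.le_pred_of_lt hlt))
      obtain ⟨k, ha, hb, -⟩ := hM.vertexAt_target e
      exact (hM.region_subset_tile e).trans (image_mono (tile_openCell_subset ha hb))

theorem closedRegion_anti (hM : M.IsTreeKnotMosaic) {u : T} (w : T) (h : u ≤ w) :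
    M.closedRegion w ⊆ M.closedRegion u := by
  revert h
  refine RootedTree.induction (P := fun w => u ≤ w → M.closedRegion w ⊆ M.closedRegion u)
    (fun h => ?_) (fun e ih h => ?_) w
  · rw [le_bot_iff.1 h]
  · rcases h.eq_or_lt with rfl | hlt
    · rfl
    · refine Subset.trans ?_ (ih (e.2.pred_eq ▸ Order.le_pred_of_lt hlt))
      obtain ⟨k, ha, hb, -⟩ := hM.vertexAt_target e
      exact (hM.closedRegion_subset_tile e).trans (image_mono (tile_closedCell_subset ha hb))

theorem tile_subset_frozenPart (hM : M.IsTreeKnotMosaic) (e : Edge T) :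
    closedCell (M.target e).1 (M.target e).2 1 ⊆ (M.placedMosaic e.1.1).frozenPart := by
  obtain ⟨k, ha, hb, hk⟩ := hM.vertexAt_target e
  exact fun x hx => Or.inr ⟨_, _, k, hk, hx⟩

/-- If `v` is an ancestor of `u`, then `u` lives in the closed cell of a black tile of `v`, which is
frozen there. Otherwise `u` and `v` lie in the cells of two different black tiles of a common
ancestor. -/
theorem disjoint_support (hM : M.IsTreeKnotMosaic) {u v : T} (h : ¬u ≤ v) :
    Disjoint (M.closedRegion u) (M.support v) := by
  by_cases hvu : v ≤ u
  · obtain ⟨c, hc, hcu⟩ := RootedTree.exists_child_le (lt_of_le_not_ge hvu h)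
    refine Disjoint.mono_left ((hM.closedRegion_anti u hcu).trans
      (hM.closedRegion_subset_tile ⟨(v, c), hc⟩)) ?_
    rw [support, disjoint_image_iff (hM.map_injective v), disjoint_compl_right_iff_subset]
    exact hM.tile_subset_frozenPart ⟨(v, c), hc⟩
  · obtain ⟨e, e', h1, hne, hu, hv⟩ := RootedTree.exists_children h hvu
    refine Disjoint.mono ((hM.closedRegion_anti u hu).trans (hM.closedRegion_subset_tile e))
      ((support_subset_region v).trans ((hM.region_anti v hv).trans (hM.region_subset_tile e'))) ?_
    rw [← h1, disjoint_image_iff (hM.map_injective _)]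
    exact disjoint_cells (hM.target_ne h1 hne)

theorem pairwise_disjoint_support (hM : M.IsTreeKnotMosaic) :
    Pairwise fun u v => Disjoint (M.support u) (M.support v) := by
  intro u v huv
  have hsub := fun w => (support_subset_region (M := M) w).trans (region_subset_closedRegion w)
  by_cases h : u ≤ v
  · exact ((hM.disjoint_support fun h' => huv (h.antisymm h')).mono_left (hsub v)).symm
  · exact (hM.disjoint_support h).mono_left (hsub u)

/-- A descendant of `u` has its support in the region of a child of `u`; for all other vertices the
closed region of `u` is already disjoint from the support. -/
theorem notMem_support (hM : M.IsTreeKnotMosaic) {u v : T} (huv : u ≠ v) {x : Space}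
    (hx : x ∈ M.closedRegion u) (h : ∀ e : Edge T, e.1.1 = u → x ∉ M.region e.1.2) :
    x ∉ M.support v := by
  by_cases hle : u ≤ v
  · obtain ⟨c, hc, hcv⟩ := RootedTree.exists_child_le (lt_of_le_of_ne hle huv)
    exact fun hv => h ⟨(u, c), hc⟩ rfl (hM.region_anti v hcv (support_subset_region v hv))
  · exact fun hv => (hM.disjoint_support hle).le_bot ⟨hx, hv⟩

theorem notMem_support_of_mem_tamePart (hM : M.IsTreeKnotMosaic) {u v : T} (huv : u ≠ v) {x : Space}
    (hx : x ∈ (M.frame u).map '' (M.placedMosaic u).tamePart) : x ∉ M.support v := by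
  refine hM.notMem_support huv (image_mono (tamePart_subset_closedCell _) hx) ?_
  rintro e rfl he
  obtain ⟨k, hk⟩ := hM.vertexAt_target e
  have := (tamePart_disjoint_openCell hk).image (f := (M.frame e.1.1).map)
    (hM.map_injective e.1.1).injOn (subset_univ _) (subset_univ _)
  exact this.le_bot ⟨hx, hM.region_subset_tile e he⟩

/-- The segment lies in a side face of the targeted tile, hence in the closed cell but not in the
open one. The former protects it from the deformation of the parent; with the disjointness of
different tiles, the latter protects it from all others, the child's included. -/
theorem notMem_support_of_mem_connectingSegments (hM : M.IsTreeKnotMosaic) (e : Edge T) (v : T)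
    {x : Space} (hx : x ∈ M.connectingSegments e) : x ∉ M.support v := by
  obtain ⟨k, s, i, j, -, -, ⟨hb, -⟩, hx⟩ := hx
  change x ∈ segment ℝ ((M.frame e.1.1).map (s.point + corner (M.target e).1 (M.target e).2)) _ at hx
  rw [frame_edge_map, ← Frame.map_segment] at hx
  obtain ⟨y, hy, rfl⟩ := hx
  have hy' : ∃ z ∈ s.face, z + corner (M.target e).1 (M.target e).2 = y := by
    have := segment_translate_image ℝ (corner (M.target e).1 (M.target e).2) s.point
      ((M.dim e.1.2 : ℝ)⁻¹ • (s.point + corner i j))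
    rw [add_comm s.point, add_comm (_ • _), ← this] at hy
    obtain ⟨z, hz, rfl⟩ := hy
    exact ⟨z, (convex_face s).segment_subset (point_mem_face s) (smul_point_mem_face hb) hz,
      add_comm _ _⟩
  obtain ⟨z, hz, rfl⟩ := hy'
  have hclosed := add_corner_mem_closedCell (p := (M.target e).1) (q := (M.target e).2).2
    (face_subset_closedCell s hz)
  have hopen : z + corner (M.target e).1 (M.target e).2 ∉
      openCell (M.target e).1 (M.target e).2 1 := fun h =>
    (face_disjoint_openCell s).le_bot ⟨hz, add_corner_mem_openCell.1 h⟩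
  by_cases hv : e.1.1 = v
  · subst hv
    rintro ⟨y, hy, hyz⟩
    rw [hM.map_injective _ hyz] at hy
    exact hy (hM.tile_subset_frozenPart e hclosed)
  · obtain ⟨k', ha, hb', -⟩ := hM.vertexAt_target e
    refine hM.notMem_support hv (mem_image_of_mem _ (tile_closedCell_subset ha hb' hclosed)) ?_
    intro e' he' hmem
    obtain ⟨y, hy, hyz⟩ := hM.region_subset_tile e' hmem
    rw [he'] at hyz
    rw [hM.map_injective _ hyz] at hy
    by_cases hee : e = e'
    · subst hee
      exact hopen hy
    · exact (disjoint_cells (hM.target_ne he'.symm hee)).le_bot ⟨hclosed, hy⟩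

theorem finite_children (hM : M.IsTreeKnotMosaic) (u : T) : {e : Edge T | e.1.1 = u}.Finite := by
  refine Finite.of_injOn (hM.wellDefined u).mapsTo (hM.wellDefined u).injOn ?_
  refine ((finite_Iio (M.dim u)).prod (finite_Iio (M.dim u))).subset ?_
  rintro p ⟨k, h1, h2, -⟩
  exact ⟨h1, h2⟩

/-- Local finiteness comes from well-definedness: children correspond to black tiles of a finite
matrix. -/
theorem finite_depth_le (hM : M.IsTreeKnotMosaic) (d : ℕ) : {v : T | depth v ≤ d}.Finite := by
  induction d with
  | zero =>
    refine (finite_singleton ⊥).subset fun v hv => ?_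
    rcases eq_bot_or_edge v with rfl | ⟨e, rfl⟩
    · rfl
    · simp [depth_edge] at hv
  | succ d ih =>
    refine ((ih.biUnion fun u _ => (hM.finite_children u).image fun e => e.1.2).insert ⊥).subset
      fun v hv => ?_
    rcases eq_bot_or_edge v with rfl | ⟨e, rfl⟩
    · exact mem_insert _ _
    · refine Or.inr (mem_biUnion (x := e.1.1) ?_ ⟨e, rfl, rfl⟩)
      simpa [depth_edge] using hv

theorem dist_le_of_mem_closedRegion (hM : M.IsTreeKnotMosaic) (e : Edge T) {x y : Space}
    (hx : x ∈ M.closedRegion e.1.2) (hy : y ∈ M.closedRegion e.1.2) :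
    dist x y ≤ (1 / 3) ^ depth e.1.1 * 5 := by
  obtain ⟨x, hx', rfl⟩ := hM.closedRegion_subset_tile e hx
  obtain ⟨y, hy', rfl⟩ := hM.closedRegion_subset_tile e hy
  rw [Frame.dist_map _ (hM.scale_pos _).le]
  have := hM.scale_le e.1.1
  have := dist_le_of_mem_closedCell hx' hy'
  gcongr

/-- No point moves farther than the diameter of a support, which tends to zero with the depth, and
only finitely many vertices have bounded depth. -/
theorem finite_displacement (hM : M.IsTreeKnotMosaic) {f : T → Space ≃ₜ Space}
    (hf : ∀ v, ∀ x ∉ M.support v, f v x = x) {ε : ℝ} (hε : 0 < ε) :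
    {v | ∃ x, ε ≤ dist (f v x) x}.Finite := by
  obtain ⟨d, hd⟩ := exists_pow_lt_of_lt_one (show 0 < ε / 5 by positivity)
    (show (1 / 3 : ℝ) < 1 by norm_num)
  refine (hM.finite_depth_le d).subset ?_
  rintro v ⟨x, hx⟩
  by_contra hv
  simp only [mem_ofPred_eq, not_le] at hv
  rcases eq_bot_or_edge v with rfl | ⟨e, rfl⟩
  · simp [depth_bot] at hv
  rw [depth_edge] at hv
  have hsub := (support_subset_region (M := M) e.1.2).trans (region_subset_closedRegion e.1.2)
  have hne : f e.1.2 x ≠ x := fun h => by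
    rw [h, dist_self] at hx
    exact hε.not_ge hx
  have hxs : x ∈ M.support e.1.2 := by
    by_contra h
    exact hne (hf _ _ h)
  -- The image of a moved point is moved too, by injectivity, so both lie in the support.
  have hfs : f e.1.2 x ∈ M.support e.1.2 := by
    by_contra h
    exact hne ((f e.1.2).injective (hf _ _ h))
  have h1 := hM.dist_le_of_mem_closedRegion e (hsub hfs) (hsub hxs)
  have h2 : (1 / 3 : ℝ) ^ depth e.1.1 ≤ (1 / 3) ^ d :=
    pow_le_pow_of_le_one (by norm_num) (by norm_num) (by omega)
  linarith

/-! ### Deformations of tree mosaics -/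

/-- The deformations are conjugated by the frames and glued. The arcs of `v` see only the
deformation of `v`, and the connecting segments see none. -/
theorem exists_homeomorph (hM : M.IsTreeKnotMosaic) (B : T → Set Space)
    (hB : ∀ v, Deforms (M.placedMosaic v).frozenPart (M.placedMosaic v).tamePart (B v)) :
    ∃ h : Space ≃ₜ Space, h '' M.realization =
      closure ((⋃ v, (M.frame v).map '' B v) ∪ ⋃ e, M.connectingSegments e) := by
  choose f hfix himg using hB
  set φ : T → Space ≃ₜ Space := fun v => (M.frame v).homeomorph (hM.scale_pos v).ne'
  have hφ : ∀ v x, φ v x = (M.frame v).map x := fun _ _ => rfl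
  set F : T → Space ≃ₜ Space := fun v => ((φ v).symm.trans (f v)).trans (φ v)
  have hF : ∀ v x, F v ((M.frame v).map x) = (M.frame v).map (f v x) := by
    intro v x
    simp only [F, ← hφ, Homeomorph.trans_apply, Homeomorph.symm_apply_apply]
  have hFfix : ∀ v, ∀ x ∉ M.support v, F v x = x := by
    intro v x hx
    obtain ⟨y, rfl⟩ := (φ v).surjective x
    rw [hφ, hF, hfix]
    by_contra hy
    exact hx ⟨y, hy, rfl⟩
  have hopen : ∀ v, IsOpen (M.support v) := fun v =>
    (φ v).isOpenMap _ (isOpen_compl_frozenPart _)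
  obtain ⟨H, hH, hH'⟩ := exists_glued_homeomorph hM.pairwise_disjoint_support hopen F hFfix
    fun ε hε => hM.finite_displacement hFfix hε
  refine ⟨H, ?_⟩
  have htame : ∀ v, H '' ((M.frame v).map '' (M.placedMosaic v).tamePart) =
      (M.frame v).map '' B v := by
    intro v
    -- Arc points outside the support of `v` are fixed by `F v`, and they lie in no other support
    -- either.
    have : EqOn H (F v) ((M.frame v).map '' (M.placedMosaic v).tamePart) := by
      intro x hx
      by_cases hxv : x ∈ M.support v
      · exact hH v x hxv
      · rw [hFfix v x hxv]
        refine hH' x fun w => ?_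
        by_cases hvw : v = w
        · exact hvw ▸ hxv
        · exact hM.notMem_support_of_mem_tamePart hvw hx
    rw [this.image_eq, ← himg v, image_image, image_image]
    simp only [hF]
  have hseg : ∀ e, H '' M.connectingSegments e = M.connectingSegments e := by
    intro e
    have : EqOn H id (M.connectingSegments e) := fun x hx =>
      hH' x fun v => hM.notMem_support_of_mem_connectingSegments e v hx
    rw [this.image_eq, image_id]
  rw [realization, H.image_closure, image_union, image_iUnion, image_iUnion]
  simp only [htame, hseg]

end TreeMosaic.IsTreeKnotMosaic

/-! ### Mosaic-level equivalence -/

theorem RVDeform.deforms {M N : RVMosaic} (h : RVDeform M N) (g : DihedralGroup 4) :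
    Deforms (M.2.act g).frozenPart (M.2.act g).tamePart (N.2.act g).tamePart := by
  obtain ⟨h⟩ := h
  exact (h.act g).deforms

theorem RVDeform.vertexAt_iff {M N : RVMosaic} (h : RVDeform M N) (g : DihedralGroup 4) (a b : ℕ)
    (k : VertexKind) : (M.2.act g).VertexAt a b k ↔ (N.2.act g).VertexAt a b k := by
  obtain ⟨h⟩ := h
  exact exists_congr fun ha => exists_congr fun hb => (h.act g).vertex_iff _ _ _

/-- The predicate `P` takes natural numbers, so it applies to positions in both mosaics although
their index types agree only propositionally. -/
theorem RVDeform.boundaryPoint_iff {M N : RVMosaic} (h : RVDeform M N) (g : DihedralGroup 4)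
    (s : Side) (P : ℕ → ℕ → Prop) :
    (∃ i j : Fin M.1, (M.2.act g).BoundaryPoint i j s ∧ P i j) ↔
      ∃ i j : Fin N.1, (N.2.act g).BoundaryPoint i j s ∧ P i j := by
  obtain ⟨h⟩ := h
  exact exists_congr fun i => exists_congr fun j => and_congr_left fun _ =>
    and_congr_right fun hb => (h.act g).sides_iff i j s hb

namespace TreeMosaic.MosaicLevelEquivalent

variable {T : RootedTree} {M₁ M₂ : TreeMosaic T}

theorem frame_eq (h : MosaicLevelEquivalent M₁ M₂) (v : T) : M₁.frame v = M₂.frame v := by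
  refine RootedTree.induction (P := fun v => M₁.frame v = M₂.frame v) ?_ (fun e he => ?_) v
  · rw [frame_bot, frame_bot]
  · rw [frame_edge, frame_edge, he, h.dim_eq, h.dim_eq, h.embedding_eq]

theorem target_eq (h : MosaicLevelEquivalent M₁ M₂) (e : Edge T) : M₁.target e = M₂.target e := by
  rw [target, target, h.frame_eq, h.dim_eq, h.embedding_eq]

/-- A connecting segment is determined by frames, black tiles and boundary connection points. Moves
preserve the latter two, in every orientation. -/
theorem connectingSegments_eq (h : MosaicLevelEquivalent M₁ M₂) (e : Edge T) :
    M₁.connectingSegments e = M₂.connectingSegments e := by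
  have key : ∀ (M : TreeMosaic T) (x : Space), x ∈ M.connectingSegments e ↔
      ∃ k s, (M.placedMosaic e.1.1).VertexAt (M.target e).1 (M.target e).2 k ∧ s ∈ k.sides ∧
        ∃ i j : Fin (M.dim e.1.2), (M.placedMosaic e.1.2).BoundaryPoint i j s ∧
          x ∈ segment ℝ ((M.frame e.1.1).map (s.point + corner (M.target e).1 (M.target e).2))
            ((M.frame e.1.2).map (s.point + corner i j)) := by
    intro M x
    constructor
    · rintro ⟨k, s, i, j, h1, h2, h3, h4⟩
      exact ⟨k, s, h1, h2, i, j, h3, h4⟩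
    · rintro ⟨k, s, h1, h2, i, j, h3, h4⟩
      exact ⟨k, s, i, j, h1, h2, h3, h4⟩
  ext x
  rw [key, key, ← h.target_eq, ← h.frame_eq, ← h.frame_eq]
  refine exists_congr fun k => exists_congr fun s => and_congr ?_ (and_congr_right fun _ => ?_)
  · rw [placedMosaic, placedMosaic, ← h.frame_eq]
    exact (h.moveEquivalent e.1.1).rvDeform.vertexAt_iff _ _ _ _
  · rw [placedMosaic, placedMosaic, ← h.frame_eq]
    exact (h.moveEquivalent e.1.2).rvDeform.boundaryPoint_iff _ s fun i j =>
      x ∈ segment ℝ ((M₁.frame e.1.1).map (s.point + corner (M₁.target e).1 (M₁.target e).2))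
        ((M₁.frame e.1.2).map (s.point + corner i j))

end TreeMosaic.MosaicLevelEquivalent

end KnotMosaic

theorem mainTheorem4 (T : RootedTree) (M₁ M₂ : TreeMosaic T)
    (hM₁ : M₁.IsTreeKnotMosaic) (hM₂ : M₂.IsTreeKnotMosaic)
    (hM : TreeMosaic.MosaicLevelEquivalent M₁ M₂) :
    ∃ h : Space ≃ₜ Space, h '' M₁.realization = M₂.realization := by
  obtain ⟨h, hh⟩ := hM₁.exists_homeomorph (fun v => (M₂.placedMosaic v).tamePart) fun v => by
    rw [TreeMosaic.placedMosaic, TreeMosaic.placedMosaic, ← hM.frame_eq]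
    exact (hM.moveEquivalent v).rvDeform.deforms _
  refine ⟨h, ?_⟩
  rw [hh, TreeMosaic.realization]
  simp only [hM.frame_eq, hM.connectingSegments_eq]
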